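/- All manifolds are smooth, real, finite-dimensional, Hausdorff, second countable and connected. Let $\pi:Y\to X$ be a fibred manifold (a smooth surjective submersion), $n=\dim X$, with fibred coordinates $(x^\lambda,y^i)$ and $\omega=dx^1\wedge\dots\wedge dx^n$, $\omega_\lambda=\partial_\lambda\rfloor\omega$. Let $J^1Y$ be its first order jet manifold, with coordinates $(x^\lambda,y^i,y^i_\lambda)$, and let $\Pi=\bigwedge^nT^*X\otimes TX\otimes V^*Y\to Y$ be the Legendre manifold, with coordinates $(x^\lambda,y^i,p^\lambda_i)$. Let $L=\mathcal L\,\omega$ be a first order Lagrangian density on $J^1Y$, with Legendre morphism $\widehat L:J^1Y\to\Pi$ over $Y$, $p^\lambda_i\circ\widehat L=\partial\mathcal L/\partial y^i_\lambda$, and constraint space $Q=\widehat L(J^1Y)$. On an open set $U\subset\Pi$: a momentum morphism is a smooth map $\Phi:U\to J^1Y$ over $Y$, with components $\Phi^i_\lambda=y^i_\lambda\circ\Phi$; a Hamiltonian form is an $n$-form which locally reads $H=p^\lambda_i\,dy^i\wedge\omega_\lambda-\mathcal H\omega$ with smooth $\mathcal H$, and it defines the momentum morphism $\widehat H$ by $y^i_\lambda\circ\widehat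 H=\partial\mathcal H/\partial p^\lambda_i$. For a momentum morphism $\Phi$ put $H_\Phi=p^\lambda_i\,dy^i\wedge\omega_\lambda-p^\lambda_i\Phi^i_\lambda\omega$ and $H_{L\Phi}=H_\Phi+L\circ\Phi$. A Hamiltonian form $H$ on $U$ is associated with $L$ if $\widehat L\circ\widehat H=\mathrm{Id}$ on $Q\cap U$ and $H=H_{\widehat H}+L\circ\widehat H$ on $U$. $L$ is almost regular if $Q$ is an embedded submanifold of $\Pi$ and $\widehat L:J^1Y\to Q$ is a submersion; $L$ is semiregular if $\widehat L^{-1}(p)$ is a connected submanifold of $J^1Y$ for every $p\in Q$. A family of Hamiltonian forms on $U$, all associated with $L$, is called complete over $U$ if the following holds for every smooth section $\overline s$ of $J^1Y\to X$ over an open set $W\subset X$ which solves the first order Euler-Lagrange equations $$\partial_\lambda\overline s^i=\overline s^i_\lambda,\qquad \partial_i\mathcal L-(\partial_\lambda+\overline s^j_\lambda\partial_j+\partial_\lambda\overline s^j_\mu\,\partial^\mu_j)\,\partial^\lambda_i\mathcal L=0 \qquad(\partial^\lambda_i=\partial/\partial y^i_\lambda)$$ and satisfies $\widehat L(\overline s(W))\subset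 U$, and for every $C\subset W$ which is closed relative to the projection of $U$ to $X$ (for instance a point of $W$, or $W$ itself if $W$ is the whole projection of $U$): there are a form $H$ of the family, an open $W'$ with $C\subset W'\subset W$, and a section $r$ of $\Pi\to X$ over $W'$ with values in $U$ which solves the Hamilton equations $\partial_\lambda r^i=\partial\mathcal H/\partial p^\lambda_i$, $\partial_\lambda r^\lambda_i=-\partial\mathcal H/\partial y^i$ of $H$, such that on $W'$ $$r=\widehat L\circ\overline s,\qquad \overline s=\widehat H\circ r,\qquad \overline s=J^1(\pi_{\Pi Y}\circ r),$$ where $\pi_{\Pi Y}:\Pi\to Y$ is the projection. **Proposition.** Let $L$ be an almost regular Lagrangian density. (i) Every point $q\in Q$ has an open neighbourhood $U$ in $\Pi$ on which there is a momentum morphism $\Phi$ with $\widehat L\circ\Phi=\mathrm{Id}$ on $Q\cap U$ and $\widehat H_{L\Phi}=\Phi$; and the Hamiltonian form $H_{L\Phi}$ on $U$ is associated with $L$. (ii) If $L$ is moreover semiregular, every point $p\in Q$ has an open neighbourhood $U$ in $\Pi$ with a family of Hamiltonian forms on $U$, all associated with $L$, that is complete over $U$. -/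

import Mathlib

open scoped Manifold ContDiff Topology

noncomputable section

namespace Multimomentum

/-! ### Models

The base `X` is modelled on `Eu n` and the total space `Y` on `Eu n × Eu m`.  As always in Mathlib,
`TangentSpace` at a point is (by definition) the model vector space, so that tangent vectors of `X`
are written as elements of `Eu n`, and tangent vectors of `Y` as elements of `Eu n × Eu m`. -/

/-- The Euclidean space of dimension `k`. -/
abbrev Eu (k : ℕ) : Type := EuclideanSpace ℝ (Fin k)

/-- Exterior `n`-forms on a tangent space of `X`, `n = dim X` (values of densities). -/
abbrev Dens (n : ℕ) : Type := (Eu n) [⋀^Fin n]→L[ℝ] ℝ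

/-- Exterior `n`-forms on a tangent space of `Y`. -/
abbrev TotForm (n m : ℕ) : Type := (Eu n × Eu m) [⋀^Fin n]→L[ℝ] ℝ

/-- Coordinates `y^i_λ` of a jet: `(A e_λ)_i = y^i_λ`. -/
abbrev JetCoef (n m : ℕ) : Type := Eu n →L[ℝ] Eu m

/-- Coordinates `p^λ_i` of a momentum, arranged as the linear form `A ↦ p^λ_i A^i_λ`. -/
abbrev MomCoef (n m : ℕ) : Type := JetCoef n m →L[ℝ] ℝ

/-- Coordinate space `(x^λ, y^i, y^i_λ)`. -/
abbrev JetModel (n m : ℕ) : Type := (Eu n × Eu m) × JetCoef n m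

/-- Coordinate space `(x^λ, y^i, p^λ_i)`. -/
abbrev MomModel (n m : ℕ) : Type := (Eu n × Eu m) × MomCoef n m

/-- The basis vector `e_λ`. -/
abbrev unitVec {k : ℕ} (l : Fin k) : Eu k := EuclideanSpace.single l (1 : ℝ)

/-- `dx^λ ⊗ e_i`, the unit vector of the coordinate `y^i_λ`. -/
def jetUnit {n m : ℕ} (l : Fin n) (i : Fin m) : JetCoef n m :=
  (EuclideanSpace.proj l : Eu n →L[ℝ] ℝ).smulRight (unitVec i)

/-- The unit vector of the coordinate `p^λ_i`. -/
def momUnit {n m : ℕ} (l : Fin n) (i : Fin m) : MomCoef n m :=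
  (EuclideanSpace.proj i : Eu m →L[ℝ] ℝ) ∘L ContinuousLinearMap.apply ℝ (Eu m) (unitVec l)

/-- The volume form `dx^1 ∧ ... ∧ dx^n` of `Eu n`. -/
def stdVol (n : ℕ) : Dens n :=
  { toMultilinearMap := (EuclideanSpace.basisFun (Fin n) ℝ).toBasis.det.toMultilinearMap
    cont := by
      change Continuous fun v : Fin n → Eu n => (EuclideanSpace.basisFun (Fin n) ℝ).toBasis.det v
      simp only [Module.Basis.det_apply]
      refine Continuous.matrix_det (continuous_matrix fun i j => ?_)
      simp only [Module.Basis.toMatrix_apply, OrthonormalBasis.coe_toBasis_repr_apply,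
        EuclideanSpace.basisFun_repr]
      fun_prop
    map_eq_zero_of_eq' :=
      (EuclideanSpace.basisFun (Fin n) ℝ).toBasis.det.map_eq_zero_of_eq' }

/-! ### Embedded submanifolds of a finite-dimensional normed space -/

section Submanifolds

variable {V : Type*} [NormedAddCommGroup V] [NormedSpace ℝ V]

/-- `χ` is a smooth local diffeomorphism of `V` that flattens `S` to the linear subspace `K`. -/
structure IsSliceChart (S : Set V) (χ : OpenPartialHomeomorph V V) (K : Submodule ℝ V) : Prop where
  smooth : ContDiffOn ℝ ∞ χ χ.source
  smooth_symm : ContDiffOn ℝ ∞ χ.symm χ.target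
  flat : ∀ v ∈ χ.source, v ∈ S ↔ χ v ∈ K

/-- `S` is an embedded smooth submanifold. -/
def IsEmbeddedSubmanifold (S : Set V) : Prop :=
  ∀ s ∈ S, ∃ (χ : OpenPartialHomeomorph V V) (K : Submodule ℝ V),
    s ∈ χ.source ∧ IsSliceChart S χ K

end Submanifolds

/-! ### Fibred manifolds, the jet manifold and the Legendre manifold -/

section Geometry

variable {n m : ℕ}
variable {X : Type*} [TopologicalSpace X] [ChartedSpace (Eu n) X]
variable {Y : Type*} [TopologicalSpace Y] [ChartedSpace (Eu n × Eu m) Y]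

/-- A fibred manifold `Y → X`: a smooth surjective submersion, `dim X = n`, `dim Y = n + m`. -/
structure FibredManifold (n m : ℕ) (X : Type*) [TopologicalSpace X] [ChartedSpace (Eu n) X]
    (Y : Type*) [TopologicalSpace Y] [ChartedSpace (Eu n × Eu m) Y] where
  /-- the projection -/
  proj : Y → X
  surjective : Function.Surjective proj
  submersion : Manifold.IsSubmersion 𝓘(ℝ, Eu n × Eu m) 𝓘(ℝ, Eu n) ∞ proj

/-- The tangent map of `π` at `y`. -/
def dproj (π : FibredManifold n m X Y) (y : Y) : (Eu n × Eu m) →L[ℝ] Eu n :=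
  mfderiv 𝓘(ℝ, Eu n × Eu m) 𝓘(ℝ, Eu n) π.proj y

/-- The fibre of `T^*X ⊗ VY` over `y`: linear maps from `T_{π y} X` to the vertical space
`V_y Y = ker (dπ)_y`. -/
def VertHom (π : FibredManifold n m X Y) (y : Y) : Submodule ℝ (Eu n →L[ℝ] (Eu n × Eu m)) where
  carrier := {σ | dproj π y ∘L σ = 0}
  add_mem' := by
    intro a b ha hb
    simp only [Set.mem_ofPred_eq] at ha hb ⊢
    rw [ContinuousLinearMap.comp_add, ha, hb, add_zero]
  zero_mem' := by simp
  smul_mem' := by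
    intro c a ha
    simp only [Set.mem_ofPred_eq] at ha ⊢
    rw [ContinuousLinearMap.comp_smul, ha]
    ext1 v
    simp

/-- The fibre of `J¹Y` over `y`.  The jet `j¹_x s` of a section with `s x = y` is identified with
the tangent map `T_x s : T_x X → T_y Y`. -/
def JetAt (π : FibredManifold n m X Y) (y : Y) : Type :=
  {ℓ : Eu n →L[ℝ] (Eu n × Eu m) // dproj π y ∘L ℓ = ContinuousLinearMap.id ℝ (Eu n)}

/-- The first order jet manifold `J¹Y`. -/
structure Jet (π : FibredManifold n m X Y) where
  /-- the projection to `Y` -/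
  pt : Y
  /-- the jet over this point -/
  jet : JetAt π pt

/-- The affine action of `T^*X ⊗ VY` on `J¹Y`. -/
def JetAt.translate {π : FibredManifold n m X Y} {y : Y} (ℓ : JetAt π y) (σ : VertHom π y) : JetAt π y :=
  ⟨ℓ.1 + σ.1, by
    have h := σ.2
    change dproj π y ∘L σ.1 = 0 at h
    rw [ContinuousLinearMap.comp_add, ℓ.2, h, add_zero]⟩

/-- The Legendre manifold `Π = ⋀ⁿT^*X ⊗ TX ⊗ V^*Y`.  Its fibre over `y` is the space of linear maps
from `T^*X ⊗ V_yY` to `⋀ⁿT^*X`. -/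
structure Momentum (π : FibredManifold n m X Y) where
  /-- the projection `π_{ΠY}` to `Y` -/
  pt : Y
  /-- the momentum over this point -/
  mom : VertHom π pt →L[ℝ] Dens n

/-- Fibred coordinates: a chart of `Y` together with a chart of `X` such that `π` becomes
the projection `(x, y) ↦ x`. -/
structure FibredChart (π : FibredManifold n m X Y) where
  /-- the chart `(x^λ)` of the base -/
  base : OpenPartialHomeomorph X (Eu n)
  /-- the chart `(x^λ, y^i)` of the total space -/
  total : OpenPartialHomeomorph Y (Eu n × Eu m)
  base_mem : base ∈ IsManifold.maximalAtlas 𝓘(ℝ, Eu n) ∞ X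
  total_mem : total ∈ IsManifold.maximalAtlas 𝓘(ℝ, Eu n × Eu m) ∞ Y
  mapsTo : ∀ y ∈ total.source, π.proj y ∈ base.source
  fibred : ∀ y ∈ total.source, base (π.proj y) = (total y).1

namespace FibredChart

variable {π : FibredManifold n m X Y} (c : FibredChart π)

/-- Tangent map of the base chart at `x`. -/
def dbase (x : X) : Eu n →L[ℝ] Eu n := mfderiv 𝓘(ℝ, Eu n) 𝓘(ℝ, Eu n) c.base x

/-- Tangent map of the inverse of the base chart, at the coordinates of `x`. -/
def dbaseInv (x : X) : Eu n →L[ℝ] Eu n :=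
  mfderiv 𝓘(ℝ, Eu n) 𝓘(ℝ, Eu n) c.base.symm (c.base x)

/-- Tangent map of the total chart at `y`. -/
def dtotal (y : Y) : (Eu n × Eu m) →L[ℝ] (Eu n × Eu m) :=
  mfderiv 𝓘(ℝ, Eu n × Eu m) 𝓘(ℝ, Eu n × Eu m) c.total y

/-- Tangent map of the inverse of the total chart, at the coordinates of `y`. -/
def dtotalInv (y : Y) : (Eu n × Eu m) →L[ℝ] (Eu n × Eu m) :=
  mfderiv 𝓘(ℝ, Eu n × Eu m) 𝓘(ℝ, Eu n × Eu m) c.total.symm (c.total y)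

/-- The coordinate vector fields `∂_λ` on `X`. -/
def baseFrame (x : X) : Fin n → Eu n := fun l => c.dbaseInv x (unitVec l)

/-- The coordinate vector fields `∂_λ` on `Y`. -/
def totalFrame (y : Y) : Fin n → Eu n × Eu m := fun l => c.dtotalInv y (unitVec l, 0)

theorem dbaseInv_comp_dbase [IsManifold 𝓘(ℝ, Eu n) ∞ X] {x : X} (hx : x ∈ c.base.source) :
    c.dbaseInv x ∘L c.dbase x = ContinuousLinearMap.id ℝ (Eu n) := by
  have h : c.base.MDifferentiable 𝓘(ℝ, Eu n) 𝓘(ℝ, Eu n) :=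
    ⟨(contMDiffOn_of_mem_maximalAtlas c.base_mem).mdifferentiableOn (by simp),
      (contMDiffOn_symm_of_mem_maximalAtlas c.base_mem).mdifferentiableOn (by simp)⟩
  exact h.symm_comp_deriv hx

theorem dtotal_comp_dtotalInv [IsManifold 𝓘(ℝ, Eu n × Eu m) ∞ Y] {y : Y}
    (hy : y ∈ c.total.source) :
    c.dtotal y ∘L c.dtotalInv y = ContinuousLinearMap.id ℝ (Eu n × Eu m) := by
  have h : c.total.MDifferentiable 𝓘(ℝ, Eu n × Eu m) 𝓘(ℝ, Eu n × Eu m) :=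
    ⟨(contMDiffOn_of_mem_maximalAtlas c.total_mem).mdifferentiableOn (by simp),
      (contMDiffOn_symm_of_mem_maximalAtlas c.total_mem).mdifferentiableOn (by simp)⟩
  have := h.comp_symm_deriv (c.total.map_source hy)
  rw [c.total.left_inv hy] at this
  exact this

theorem dproj_eq [IsManifold 𝓘(ℝ, Eu n) ∞ X] [IsManifold 𝓘(ℝ, Eu n × Eu m) ∞ Y] {y : Y}
    (hy : y ∈ c.total.source) :
    dproj π y = c.dbaseInv (π.proj y) ∘L ContinuousLinearMap.fst ℝ (Eu n) (Eu m) ∘L c.dtotal y := by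
  have htot : MDifferentiableAt 𝓘(ℝ, Eu n × Eu m) 𝓘(ℝ, Eu n × Eu m) c.total y :=
    (contMDiffAt_of_mem_maximalAtlas c.total_mem hy).mdifferentiableAt (by simp)
  have hinv : MDifferentiableAt 𝓘(ℝ, Eu n) 𝓘(ℝ, Eu n) c.base.symm (c.base (π.proj y)) :=
    (contMDiffAt_symm_of_mem_maximalAtlas c.base_mem
      (c.base.map_source (c.mapsTo y hy))).mdifferentiableAt (by simp)
  have hfst : HasMFDerivAt 𝓘(ℝ, Eu n × Eu m) 𝓘(ℝ, Eu n) (Prod.fst : Eu n × Eu m → Eu n)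
      (c.total y) (ContinuousLinearMap.fst ℝ (Eu n) (Eu m)) :=
    (hasFDerivAt_fst (𝕜 := ℝ) (p := c.total y)).hasMFDerivAt
  have h1 := hfst.comp y htot.hasMFDerivAt
  have hinv' := hinv.hasMFDerivAt
  rw [c.fibred y hy] at hinv'
  have h2 := HasMFDerivAt.comp y (g := c.base.symm) (f := Prod.fst ∘ c.total) hinv' h1
  have heq : (c.base.symm ∘ (Prod.fst ∘ c.total)) =ᶠ[𝓝 y] π.proj := by
    filter_upwards [c.total.open_source.mem_nhds hy] with z hz
    simp only [Function.comp_apply]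
    rw [← c.fibred z hz, c.base.left_inv (c.mapsTo z hz)]
  have h3 := (h2.congr_of_eventuallyEq heq.symm).mfderiv
  unfold dproj dbaseInv dtotal
  rw [h3, c.fibred y hy]
  rfl

theorem dproj_comp_dtotalInv [IsManifold 𝓘(ℝ, Eu n) ∞ X] [IsManifold 𝓘(ℝ, Eu n × Eu m) ∞ Y]
    {y : Y} (hy : y ∈ c.total.source) :
    dproj π y ∘L c.dtotalInv y = c.dbaseInv (π.proj y) ∘L ContinuousLinearMap.fst ℝ (Eu n) (Eu m) := by
  rw [c.dproj_eq hy]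
  have h := c.dtotal_comp_dtotalInv hy
  refine ContinuousLinearMap.ext fun v => ?_
  have hv := DFunLike.congr_fun h v
  simp only [ContinuousLinearMap.comp_apply, ContinuousLinearMap.id_apply] at hv ⊢
  rw [hv]

/-- Jet coordinates `(x^λ, y^i, y^i_λ)` (meaningful if `z` lies over the domain of the chart). -/
def jetCoord (z : Jet π) : JetModel n m :=
  (c.total z.pt, ContinuousLinearMap.snd ℝ (Eu n) (Eu m) ∘L c.dtotal z.pt ∘L z.jet.1 ∘L
    c.dbaseInv (π.proj z.pt))

variable [IsManifold 𝓘(ℝ, Eu n) ∞ X] [IsManifold 𝓘(ℝ, Eu n × Eu m) ∞ Y]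

/-- The jet at `y` with coordinates `y^i_λ = A`. -/
def jetAt (y : Y) (hy : y ∈ c.total.source) (A : JetCoef n m) : JetAt π y :=
  ⟨c.dtotalInv y ∘L ((ContinuousLinearMap.id ℝ (Eu n)).prod A) ∘L c.dbase (π.proj y), by
    have h := c.dproj_comp_dtotalInv hy
    have h' := c.dbaseInv_comp_dbase (c.mapsTo y hy)
    ext1 v
    have hv := DFunLike.congr_fun h (c.dbase (π.proj y) v, A (c.dbase (π.proj y) v))
    have hv' := DFunLike.congr_fun h' v
    simp only [ContinuousLinearMap.comp_apply, ContinuousLinearMap.id_apply,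
      ContinuousLinearMap.prod_apply, ContinuousLinearMap.coe_fst'] at hv hv' ⊢
    rw [hv, hv']⟩

/-- The jet with given coordinates in the chart. -/
def jetOf (v : JetModel n m) (hv : v.1 ∈ c.total.target) : Jet π :=
  ⟨c.total.symm v.1, c.jetAt (c.total.symm v.1) (c.total.map_target hv) v.2⟩

/-- `A^i_λ ↦ A^i_λ dx^λ ⊗ ∂_i`, the chart isomorphism onto `T^*X ⊗ V_yY`. -/
def vertOf (y : Y) (hy : y ∈ c.total.source) : JetCoef n m →L[ℝ] VertHom π y :=
  ContinuousLinearMap.codRestrict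
    ((ContinuousLinearMap.compL ℝ (Eu n) (Eu m) (Eu n × Eu m)
        (c.dtotalInv y ∘L ContinuousLinearMap.inr ℝ (Eu n) (Eu m))) ∘L
      (ContinuousLinearMap.compL ℝ (Eu n) (Eu n) (Eu m)).flip (c.dbase (π.proj y)))
    (VertHom π y) (by
      intro A
      change dproj π y ∘L _ = 0
      have h := c.dproj_comp_dtotalInv hy
      ext1 v
      have hv := DFunLike.congr_fun h (0, A (c.dbase (π.proj y) v))
      simpa using hv)

open Classical in
/-- Coordinates `(x^λ, y^i, p^λ_i)` of a momentum, where `p = p^λ_i ω ⊗ ∂_λ ⊗ dy^i` and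
`ω = dx^1 ∧ ... ∧ dx^n`; the value `0` is used outside the domain of the chart. -/
def momCoord (p : Momentum π) : MomModel n m :=
  if h : p.pt ∈ c.total.source then
    (c.total p.pt,
      ContinuousAlternatingMap.apply ℝ (Eu n) ℝ (c.baseFrame (π.proj p.pt)) ∘L p.mom ∘L c.vertOf p.pt h)
  else 0

/-- The momentum with coordinates `v = (x^λ, y^i, p^λ_i)`. -/
def momOf (v : MomModel n m) : Momentum π where
  pt := c.total.symm v.1
  mom := (v.2 ∘L
      (ContinuousLinearMap.compL ℝ (Eu n) (Eu n × Eu m) (Eu m)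
        (ContinuousLinearMap.snd ℝ (Eu n) (Eu m) ∘L c.dtotal (c.total.symm v.1))) ∘L
      ((ContinuousLinearMap.compL ℝ (Eu n) (Eu n) (Eu n × Eu m)).flip
        (c.dbaseInv (π.proj (c.total.symm v.1)))) ∘L
      (VertHom π (c.total.symm v.1)).subtypeL).smulRight
    ((stdVol n).compContinuousLinearMap (c.dbase (π.proj (c.total.symm v.1))))

/-- The coordinate domain of a subset `U` of `Π`. -/
def momDom (U : Set (Momentum π)) : Set (MomModel n m) :=
  {v | v.1 ∈ c.total.target ∧ c.momOf v ∈ U}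

end FibredChart

/-- The manifold topology of `Π`: a set is open iff it is open in all fibred coordinates. -/
instance (π : FibredManifold n m X Y) : TopologicalSpace (Momentum π) where
  IsOpen U := ∀ c : FibredChart π, IsOpen (c.momDom U)
  isOpen_univ := by
    intro c
    have : c.momDom Set.univ = Prod.fst ⁻¹' c.total.target := by
      ext v
      simp [FibredChart.momDom]
    rw [this]
    exact c.total.open_target.preimage continuous_fst
  isOpen_inter := by
    intro U V hU hV c
    have : c.momDom (U ∩ V) = c.momDom U ∩ c.momDom V := by
      ext v
      simp only [FibredChart.momDom, Set.mem_inter_iff, Set.mem_ofPred_eq]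
      tauto
    rw [this]
    exact (hU c).inter (hV c)
  isOpen_sUnion := by
    intro S hS c
    have : c.momDom (⋃₀ S) = ⋃ U ∈ S, c.momDom U := by
      ext v
      simp only [FibredChart.momDom, Set.mem_sUnion, Set.mem_iUnion, Set.mem_ofPred_eq]
      tauto
    rw [this]
    exact isOpen_biUnion fun U hU => hS U hU c

/-! ### Lagrangian densities -/

section Lagrangian

variable [IsManifold 𝓘(ℝ, Eu n) ∞ X] [IsManifold 𝓘(ℝ, Eu n × Eu m) ∞ Y]
variable {π : FibredManifold n m X Y}

open Classical in
/-- The coordinate expression `𝓛(x^λ, y^i, y^i_λ)` of `L = 𝓛 ω`, extended by `0`. -/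
def FibredChart.lag (c : FibredChart π) (L : Jet π → Dens n) (v : JetModel n m) : ℝ :=
  if h : v.1 ∈ c.total.target then
    L (c.jetOf v h) (c.baseFrame (π.proj (c.total.symm v.1)))
  else 0

/-- `L : J¹Y → ⋀ⁿT^*X` (over `X`) is a smooth horizontal density, i.e. a Lagrangian density. -/
def IsLagrangianDensity (L : Jet π → Dens n) : Prop :=
  ∀ c : FibredChart π, ContDiffOn ℝ ∞ (c.lag L) {v | v.1 ∈ c.total.target}

/-- The Legendre morphism `L̂ : J¹Y → Π`: the derivative of `L` along the affine fibres of
`J¹Y → Y`; in coordinates `p^λ_i ∘ L̂ = ∂𝓛/∂y^i_λ`. -/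
def legendre (L : Jet π → Dens n) (z : Jet π) : Momentum π :=
  ⟨z.pt, fderiv ℝ (fun σ : VertHom π z.pt => L ⟨z.pt, z.jet.translate σ⟩) 0⟩

/-- The constraint space `Q = L̂(J¹Y)`. -/
def constraintSpace (L : Jet π → Dens n) : Set (Momentum π) := Set.range (legendre L)

open Classical in
/-- The coordinate expression of `L̂`, extended by `0`. -/
def FibredChart.legendreCoord (c : FibredChart π) (L : Jet π → Dens n) (v : JetModel n m) :
    MomModel n m :=
  if h : v.1 ∈ c.total.target then c.momCoord (legendre L (c.jetOf v h)) else 0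

/-- `L` is almost regular: `Q` is an embedded submanifold of `Π`, and `L̂ : J¹Y → Q` is a
submersion, i.e. its differential at each jet `z` is onto the tangent space of `Q` at `L̂ z`
(which is `K` in a chart flattening `Q` to the linear subspace `K`). -/
structure IsAlmostRegular (L : Jet π → Dens n) : Prop where
  submanifold : ∀ c : FibredChart π, IsEmbeddedSubmanifold (c.momDom (constraintSpace L))
  submersion : ∀ (c : FibredChart π) (z : Jet π), z.pt ∈ c.total.source →
    ∀ (χ : OpenPartialHomeomorph (MomModel n m) (MomModel n m))
      (K : Submodule ℝ (MomModel n m)),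
      IsSliceChart (c.momDom (constraintSpace L)) χ K → c.momCoord (legendre L z) ∈ χ.source →
      Set.range (fderiv ℝ (χ ∘ c.legendreCoord L) (c.jetCoord z)) = (K : Set (MomModel n m))

/-- The preimage `L̂⁻¹(p)`.  It lies in the fibre of `J¹Y` over the base point of `p`, which is a
closed affine subspace of `Hom(T_xX, T_yY)`, and it is viewed as a subset of that space. -/
def legendreFibre (L : Jet π → Dens n) (p : Momentum π) : Set (Eu n →L[ℝ] (Eu n × Eu m)) :=
  {ℓ | ∃ z : JetAt π p.pt, z.1 = ℓ ∧ legendre L ⟨p.pt, z⟩ = p}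

/-- `L` is semiregular: the preimage of each point of `Q` is a connected submanifold. -/
def IsSemiregular (L : Jet π → Dens n) : Prop :=
  ∀ p ∈ constraintSpace L,
    IsConnected (legendreFibre L p) ∧ IsEmbeddedSubmanifold (legendreFibre L p)

/-- `s : X → J¹Y` restricts to a smooth section of `J¹Y → X` over the open set `W`. -/
structure IsJetSection (s : X → Jet π) (W : Set X) : Prop where
  isOpen : IsOpen W
  isSection : ∀ x ∈ W, π.proj (s x).pt = x
  smooth : ContMDiffOn 𝓘(ℝ, Eu n) 𝓘(ℝ, Eu n × Eu m) ∞ (fun x => (s x).pt) W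
  smooth_coord : ∀ c : FibredChart π,
    ContDiffOn ℝ ∞ (fun u => c.jetCoord (s (c.base.symm u)))
      {u | u ∈ c.base.target ∧ c.base.symm u ∈ W ∧ (s (c.base.symm u)).pt ∈ c.total.source}

/-- `s` is a solution over `W` of the first order Euler-Lagrange equations
`∂_λ s^i = s^i_λ`, `∂_i 𝓛 - (∂_λ + s^j_λ ∂_j + ∂_λ s^j_μ ∂^μ_j) ∂^λ_i 𝓛 = 0`. -/
structure IsEulerLagrangeSolution (L : Jet π → Dens n) (s : X → Jet π) (W : Set X) : Prop where
  isJetSection : IsJetSection s W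
  holonomic : ∀ (c : FibredChart π), ∀ x ∈ W, (s x).pt ∈ c.total.source →
    ∀ (l : Fin n) (i : Fin m),
      fderiv ℝ (fun u => (c.jetCoord (s (c.base.symm u))).1.2) (c.base x) (unitVec l) i =
        (c.jetCoord (s x)).2 (unitVec l) i
  equation : ∀ (c : FibredChart π), ∀ x ∈ W, (s x).pt ∈ c.total.source →
    ∀ i : Fin m,
      fderiv ℝ (c.lag L) (c.jetCoord (s x)) ((0, unitVec i), 0) -
        ∑ l : Fin n,
          fderiv ℝ (fun v => fderiv ℝ (c.lag L) v (0, jetUnit l i)) (c.jetCoord (s x))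
            ((unitVec l, (c.jetCoord (s x)).2 (unitVec l)),
              fderiv ℝ (fun u => (c.jetCoord (s (c.base.symm u))).2) (c.base x) (unitVec l)) = 0

end Lagrangian

/-! ### Hamiltonian forms and momentum morphisms -/

section Hamiltonian

variable {π : FibredManifold n m X Y}

/-- The function `ℋ` in `H = p^λ_i dy^i ∧ ω_λ - ℋ ω`, i.e. `ℋ = -H(∂_1, ..., ∂_n)`, in fibred
coordinates. -/
def FibredChart.hamiltonian (c : FibredChart π) (H : Momentum π → TotForm n m)
    (v : MomModel n m) : ℝ :=
  - H (c.momOf v) (c.totalFrame (c.total.symm v.1))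

/-- `H` is a Hamiltonian form on the open set `U ⊆ Π`, i.e. locally
`H = p^λ_i dy^i ∧ ω_λ - ℋ ω` with smooth `ℋ`.  Such an `n`-form on `U` is horizontal over `Y`, so it
is given by `n`-forms `H p` on `T_yY`, where `y` is the base point of `p`.  Without coordinates:
`H p` vanishes on any two vertical vectors, and the pullback of `H p` by a jet `ℓ : T_xX → T_yY` is
an affine function of `ℓ` with linear part `p`. -/
structure IsHamiltonianForm (U : Set (Momentum π)) (H : Momentum π → TotForm n m) : Prop where
  semibasic : ∀ p ∈ U, ∀ (v : Fin n → Eu n × Eu m) (i j : Fin n), i ≠ j →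
    dproj π p.pt (v i) = 0 → dproj π p.pt (v j) = 0 → H p v = 0
  linearPart : ∀ p ∈ U, ∀ (ℓ : JetAt π p.pt) (σ : VertHom π p.pt),
    (H p).compContinuousLinearMap (ℓ.translate σ).1 =
      (H p).compContinuousLinearMap ℓ.1 + p.mom σ
  smooth : ∀ c : FibredChart π, ContDiffOn ℝ ∞ (c.hamiltonian H) (c.momDom U)

/-- `Φ` is a momentum morphism `U → J¹Y` (over `Y`) on `U ⊆ Π`; values outside `U` are
irrelevant. -/
def IsMomentumMorphism (U : Set (Momentum π)) (Φ : ∀ p : Momentum π, JetAt π p.pt) : Prop :=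
  ∀ c : FibredChart π,
    ContDiffOn ℝ ∞ (fun v => (c.jetCoord ⟨(c.momOf v).pt, Φ (c.momOf v)⟩).2) (c.momDom U)

/-- For a covector `α` of `X`, the map `v ↦ α ⊗ (v - ℓ(dπ v))` from `T_yY` to
`T^*X ⊗ V_yY`, where `v - ℓ(dπ v)` is the vertical part of `v` with respect to the jet `ℓ`. -/
def JetAt.tensorVert {y : Y} (ℓ : JetAt π y) (α : Eu n →L[ℝ] ℝ) :
    (Eu n × Eu m) →L[ℝ] VertHom π y :=
  ContinuousLinearMap.codRestrict
    (ContinuousLinearMap.smulRightL ℝ (Eu n) (Eu n × Eu m) α ∘L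
      (ContinuousLinearMap.id ℝ (Eu n × Eu m) - ℓ.1 ∘L dproj π y))
    (VertHom π y) (by
      intro v
      change dproj π y ∘L _ = 0
      refine ContinuousLinearMap.ext fun a => ?_
      have h := DFunLike.congr_fun ℓ.2 (dproj π y v)
      simp only [ContinuousLinearMap.comp_apply, ContinuousLinearMap.id_apply] at h
      simp [h])

/-- The vector-valued form `v ↦ Σ_λ p^λ_i (v^i - ℓ^i_μ v^μ) e_λ` on `T_yY`, with the components
`p^λ_i` taken with respect to the standard basis `e_1, ..., e_n` of the model space of `T_xX`. -/
def Momentum.contraction (p : Momentum π) (ℓ : JetAt π p.pt) : (Eu n × Eu m) →L[ℝ] Eu n :=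
  ∑ l : Fin n,
    (ContinuousAlternatingMap.apply ℝ (Eu n) ℝ (fun k : Fin n => unitVec k) ∘L p.mom ∘L
      ℓ.tensorVert (EuclideanSpace.proj l)).smulRight (unitVec l)

/-- `H_Φ = Φ ⌋ θ = p^λ_i dy^i ∧ ω_λ - p^λ_i Φ^i_λ ω = p^λ_i (dy^i - Φ^i_μ dx^μ) ∧ ω_λ`, i.e.
`H_Φ(v_1, ..., v_n) = Σ_k ω(dπ v_1, ..., T v_k, ..., dπ v_n)` with
`T v = Σ_λ p^λ_i (v^i - Φ^i_μ v^μ) e_λ`. -/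
def formOfMorphism (Φ : ∀ p : Momentum π, JetAt π p.pt) (p : Momentum π) : TotForm n m :=
  (stdVol n).fderivCompContinuousLinearMap (dproj π p.pt) (p.contraction (Φ p))

/-- `H_{LΦ} = H_Φ + L ∘ Φ`. -/
def formOfLagrangian (L : Jet π → Dens n) (Φ : ∀ p : Momentum π, JetAt π p.pt)
    (p : Momentum π) : TotForm n m :=
  formOfMorphism Φ p + (L ⟨p.pt, Φ p⟩).compContinuousLinearMap (dproj π p.pt)

variable [IsManifold 𝓘(ℝ, Eu n) ∞ X] [IsManifold 𝓘(ℝ, Eu n × Eu m) ∞ Y]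

/-- `Φ` is on `U` the momentum morphism `Ĥ` defined by `H`: `y^i_λ ∘ Ĥ = ∂ℋ/∂p^λ_i`. -/
def IsMorphismOfForm (U : Set (Momentum π)) (H : Momentum π → TotForm n m)
    (Φ : ∀ p : Momentum π, JetAt π p.pt) : Prop :=
  ∀ (c : FibredChart π), ∀ p ∈ U, p.pt ∈ c.total.source → ∀ (l : Fin n) (i : Fin m),
    (c.jetCoord ⟨p.pt, Φ p⟩).2 (unitVec l) i =
      fderiv ℝ (c.hamiltonian H) (c.momCoord p) (0, momUnit l i)

/-- `L̂ ∘ Φ = Id` on `Q ∩ U`. -/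
def IsAssociatedMorphism (L : Jet π → Dens n) (U : Set (Momentum π))
    (Φ : ∀ p : Momentum π, JetAt π p.pt) : Prop :=
  ∀ p ∈ constraintSpace L ∩ U, legendre L ⟨p.pt, Φ p⟩ = p

/-- The Hamiltonian form `H` on `U` is associated with `L`: with `Ĥ` the momentum morphism
of `H`, `L̂ ∘ Ĥ = Id` on `Q ∩ U` and `H = H_Ĥ + L ∘ Ĥ` on `U`. -/
def IsAssociatedForm (L : Jet π → Dens n) (U : Set (Momentum π))
    (H : Momentum π → TotForm n m) : Prop :=
  IsHamiltonianForm U H ∧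
    ∃ Φ : ∀ p : Momentum π, JetAt π p.pt,
      IsMomentumMorphism U Φ ∧ IsMorphismOfForm U H Φ ∧ IsAssociatedMorphism L U Φ ∧
        ∀ p ∈ U, H p = formOfLagrangian L Φ p

/-- `r : X → Π` restricts to a smooth section of `Π → X` over the open set `W`. -/
structure IsMomentumSection (r : X → Momentum π) (W : Set X) : Prop where
  isOpen : IsOpen W
  isSection : ∀ x ∈ W, π.proj (r x).pt = x
  smooth : ContMDiffOn 𝓘(ℝ, Eu n) 𝓘(ℝ, Eu n × Eu m) ∞ (fun x => (r x).pt) W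
  smooth_coord : ∀ c : FibredChart π,
    ContDiffOn ℝ ∞ (fun u => c.momCoord (r (c.base.symm u)))
      {u | u ∈ c.base.target ∧ c.base.symm u ∈ W ∧ (r (c.base.symm u)).pt ∈ c.total.source}

/-- `r` is a solution over `W`, with values in `U`, of the Hamilton equations
`∂_λ r^i = ∂ℋ/∂p^λ_i`, `∂_λ r^λ_i = -∂ℋ/∂y^i` of a Hamiltonian form `H` on `U`. -/
structure IsHamiltonSolution (U : Set (Momentum π)) (H : Momentum π → TotForm n m)
    (r : X → Momentum π) (W : Set X) : Prop where
  isMomentumSection : IsMomentumSection r W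
  mem : ∀ x ∈ W, r x ∈ U
  equation_field : ∀ (c : FibredChart π), ∀ x ∈ W, (r x).pt ∈ c.total.source →
    ∀ (l : Fin n) (i : Fin m),
      fderiv ℝ (fun u => (c.momCoord (r (c.base.symm u))).1.2) (c.base x) (unitVec l) i =
        fderiv ℝ (c.hamiltonian H) (c.momCoord (r x)) (0, momUnit l i)
  equation_momentum : ∀ (c : FibredChart π), ∀ x ∈ W, (r x).pt ∈ c.total.source →
    ∀ i : Fin m,
      ∑ l : Fin n,
        fderiv ℝ (fun u => (c.momCoord (r (c.base.symm u))).2 (jetUnit l i)) (c.base x)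
          (unitVec l) =
        - fderiv ℝ (c.hamiltonian H) (c.momCoord (r x)) ((0, unitVec i), 0)

/-- A family `F` of Hamiltonian forms on `U` is complete over `U`.  Let `s` be any solution of the
first order Euler-Lagrange equations over an open `W ⊆ X` whose image `L̂ ∘ s` lies in `U`, and
let `C ⊆ W` be closed relative to the projection of `U` to `X` (for instance a single point of `W`
or, if `W` is the whole projection of `U`, the set `W` itself).  Then there are a form `H ∈ F` and a
solution `r` of the Hamilton equations of `H` over a neighbourhood `W'` of `C` in `W`, with
`r = L̂ ∘ s`, `s = Ĥ ∘ r`, `s = J¹(π_{ΠY} ∘ r)`. -/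
def IsCompleteFamily (L : Jet π → Dens n) (U : Set (Momentum π))
    (F : Set (Momentum π → TotForm n m)) : Prop :=
  ∀ (s : X → Jet π) (W : Set X), IsEulerLagrangeSolution L s W → (∀ x ∈ W, legendre L (s x) ∈ U) →
    ∀ C ⊆ W, (∃ D : Set X, IsClosed D ∧ C = D ∩ (fun p : Momentum π => π.proj p.pt) '' U) →
      ∃ H ∈ F, ∃ Φ : ∀ p : Momentum π, JetAt π p.pt, IsMorphismOfForm U H Φ ∧
        ∃ W' : Set X, C ⊆ W' ∧ W' ⊆ W ∧ ∃ r : X → Momentum π, IsHamiltonSolution U H r W' ∧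
          ∀ x ∈ W', r x = legendre L (s x) ∧ s x = ⟨(r x).pt, Φ (r x)⟩ ∧
            (s x).jet.1 =
              mfderiv 𝓘(ℝ, Eu n) 𝓘(ℝ, Eu n × Eu m) (fun x' => (r x').pt) x

end Hamiltonian

end Geometry

end Multimomentum

end

open Multimomentum

/-!
Fibred coordinates turn the Lagrangian into a function `f (y, v)` on `Ω × J`, where `y` is a point
of `Y` and `v` the jet coordinates, and the Legendre morphism into `(y, v) ↦ (y, ∂f/∂v)`.  The proof
has an analytic part about such functions and a geometric part.

**Analysis.**  Let `P` be a projection of `J` onto the kernel `N` of the fibrewise Hessian at a jet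
`z₀`.  By the inverse function theorem `(y, ∂f/∂v|_{ker P}, P v)` are coordinates near `z₀`
(`AdaptedChart`).  Almost regularity says that the image `Q` is a submanifold whose tangent space is
the range of the derivative of the Legendre map; hence near `z₀` the kernel of the Hessian has
constant dimension, and a point `(y, p)` of `Q` is determined by `y` and `p|_{ker P}`
(`exists_separating_nhds`).  Solving `∂f/∂v|_{ker P} = p|_{ker P}`, `P v = b` for `v` gives a smooth
`Φ (y, p)` which inverts the Legendre map on `Q`.  The differences `Φ (y, p') - Φ (y, p)` lie in
`ker P`, where `p` and `∂f/∂v (Φ (y, p))` agree; this is `exists_local_section`.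

If the fibres of the Legendre map are connected, a whole smooth family of such sections passes
through all jets over a fixed neighbourhood (`exists_local_family`).  Indeed the fibres are affine
subspaces, translates of the kernel of the Hessian.  Locally this follows from differentiating the
energy `∂f/∂v · v - f`, which is constant along fibres (`exists_sub_mem_nullSpace`), and
connectedness makes it global (`fibre_eq_of_isPreconnected`).  So a section can be moved along the
kernel until its `P`-component takes any prescribed value.

**Geometry.**  The pullback of `H_Φ` by a jet `ℓ` is `p (ℓ - Φ p)` (`formOfMorphism_pullback`), so the
Hamiltonian of `H_{LΦ}` is `p Φ - 𝓛 ∘ Φ` in every chart, and `Φ` is its momentum morphism as soon as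
`(p - L̂ (Φ p)) ∂Φ/∂p = 0`.  The property of the differences stated above is a form of this condition
without coordinates (`IsFlat`), so it suffices to check it in one chart.  This proves that the forms
`H_{LΦ}` are associated with `L`.

For completeness let `s` solve the Euler-Lagrange equations.  In the family of sections the parameter
`b` is chosen as the jet coordinates of `s`, which depend on `x` only, cut off outside a neighbourhood
of the given closed set so that `Φ` is defined on all of `U`.  Near this set `Φ ∘ L̂ ∘ s = s`.  Since
`∂ℋ/∂y = -∂𝓛/∂y` at points with `p = L̂ (Φ p)`, the Euler-Lagrange equations for `s` become the
Hamilton equations for `L̂ ∘ s` (`IsEulerLagrangeSolution.isHamiltonSolution`).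
-/

open scoped Manifold ContDiff Topology

noncomputable section

namespace Multimomentum

/-! ### Functions on a trivial vector bundle and their fibrewise Legendre map -/

section Fibrewise
open Set Module

variable {E J : Type*} [NormedAddCommGroup E] [NormedSpace ℝ E]
  [NormedAddCommGroup J] [NormedSpace ℝ J]

/-- The derivative of `f : E × J → ℝ` along the second factor. -/
def vertDeriv (f : E × J → ℝ) (z : E × J) : J →L[ℝ] ℝ :=
  fderiv ℝ f z ∘L ContinuousLinearMap.inr ℝ E J

/-- The fibrewise Legendre map `(y, v) ↦ (y, ∂f/∂v)`. -/
def legMap (f : E × J → ℝ) (z : E × J) : E × (J →L[ℝ] ℝ) := (z.1, vertDeriv f z)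

/-- The Hessian of `f : E × J → ℝ` along the second factor. -/
def vertHess (f : E × J → ℝ) (z : E × J) : J →L[ℝ] J →L[ℝ] ℝ :=
  fderiv ℝ (vertDeriv f) z ∘L ContinuousLinearMap.inr ℝ E J

/-- The kernel of the fibrewise Hessian. -/
def nullSpace (f : E × J → ℝ) (z : E × J) : Submodule ℝ J :=
  LinearMap.ker (vertHess f z).toLinearMap

/-- The image of the fibrewise Legendre map over `Ω`. -/
def legImage (f : E × J → ℝ) (Ω : Set E) : Set (E × (J →L[ℝ] ℝ)) :=
  {w | w.1 ∈ Ω ∧ ∃ v, vertDeriv f (w.1, v) = w.2}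

/-- Almost regularity of a smooth function on `Ω × J`: the image of the fibrewise Legendre map is
an embedded submanifold onto which the Legendre map is a submersion. -/
structure IsRegularFamily (f : E × J → ℝ) (Ω : Set E) : Prop where
  isOpen : IsOpen Ω
  smooth : ContDiffOn ℝ ∞ f {z | z.1 ∈ Ω}
  slice : ∀ z : E × J, z.1 ∈ Ω →
    ∃ (χ : OpenPartialHomeomorph (E × (J →L[ℝ] ℝ)) (E × (J →L[ℝ] ℝ)))
      (K : Submodule ℝ (E × (J →L[ℝ] ℝ))), legMap f z ∈ χ.source ∧
        IsSliceChart (legImage f Ω) χ K ∧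
        ∀ z' : E × J, z'.1 ∈ Ω → legMap f z' ∈ χ.source →
          range (fderiv ℝ (χ ∘ legMap f) z') = (K : Set (E × (J →L[ℝ] ℝ)))

/-- Restriction of linear forms to a subspace. -/
def restr (S : Submodule ℝ J) : (J →L[ℝ] ℝ) →L[ℝ] (S →L[ℝ] ℝ) :=
  (ContinuousLinearMap.compL ℝ S J ℝ).flip S.subtypeL

variable {f : E × J → ℝ} {Ω : Set E}

theorem mem_nullSpace {z : E × J} {v : J} : v ∈ nullSpace f z ↔ vertHess f z v = 0 := Iff.rfl

theorem legMap_mem_legImage {z : E × J} (hz : z.1 ∈ Ω) : legMap f z ∈ legImage f Ω :=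
  ⟨hz, z.2, rfl⟩

theorem contDiffOn_vertDeriv (hΩ : IsOpen Ω) (hf : ContDiffOn ℝ ∞ f {z | z.1 ∈ Ω}) :
    ContDiffOn ℝ ∞ (vertDeriv f) {z | z.1 ∈ Ω} :=
  (hf.fderiv_of_isOpen (hΩ.preimage continuous_fst) (by simp)).clm_comp contDiffOn_const

namespace IsRegularFamily

variable (h : IsRegularFamily f Ω)
include h

theorem isOpen_domain : IsOpen {z : E × J | z.1 ∈ Ω} := h.isOpen.preimage continuous_fst

theorem contDiffAt {z : E × J} (hz : z.1 ∈ Ω) : ContDiffAt ℝ ∞ f z :=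
  h.smooth.contDiffAt (h.isOpen_domain.mem_nhds hz)

theorem contDiffOn_vertDeriv : ContDiffOn ℝ ∞ (vertDeriv f) {z | z.1 ∈ Ω} :=
  Multimomentum.contDiffOn_vertDeriv h.isOpen h.smooth

theorem contDiffAt_vertDeriv {z : E × J} (hz : z.1 ∈ Ω) : ContDiffAt ℝ ∞ (vertDeriv f) z :=
  h.contDiffOn_vertDeriv.contDiffAt (h.isOpen_domain.mem_nhds hz)

theorem contDiffAt_legMap {z : E × J} (hz : z.1 ∈ Ω) : ContDiffAt ℝ ∞ (legMap f) z :=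
  contDiffAt_fst.prodMk (h.contDiffAt_vertDeriv hz)

theorem hasFDerivAt_vertDeriv {z : E × J} (hz : z.1 ∈ Ω) :
    HasFDerivAt (vertDeriv f) (fderiv ℝ (vertDeriv f) z) z :=
  ((h.contDiffAt_vertDeriv hz).differentiableAt (by simp)).hasFDerivAt

theorem hasFDerivAt_legMap {z : E × J} (hz : z.1 ∈ Ω) :
    HasFDerivAt (legMap f) ((ContinuousLinearMap.fst ℝ E J).prod (fderiv ℝ (vertDeriv f) z)) z :=
  hasFDerivAt_fst.prodMk (h.hasFDerivAt_vertDeriv hz)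

theorem vertHess_symm {z : E × J} (hz : z.1 ∈ Ω) (a b : J) :
    vertHess f z a b = vertHess f z b a := by
  have hs := (h.contDiffAt hz).isSymmSndFDerivAt
    (by simpa using (WithTop.coe_le_coe.2 le_top : ((2 : ℕ∞) : WithTop ℕ∞) ≤ ∞))
  have hd : HasFDerivAt (fderiv ℝ f) (fderiv ℝ (fderiv ℝ f) z) z :=
    (((h.smooth.fderiv_of_isOpen (m := ∞) h.isOpen_domain (by simp)).contDiffAt
      (h.isOpen_domain.mem_nhds hz)).differentiableAt (by simp)).hasFDerivAt
  have key : ∀ a b : J, vertHess f z a b = fderiv ℝ (fderiv ℝ f) z (0, a) (0, b) := by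
    intro a b
    have h1 : HasFDerivAt (vertDeriv f)
        (((ContinuousLinearMap.compL ℝ J (E × J) ℝ).flip (ContinuousLinearMap.inr ℝ E J)) ∘L
          fderiv ℝ (fderiv ℝ f) z) z :=
      (((ContinuousLinearMap.compL ℝ J (E × J) ℝ).flip
        (ContinuousLinearMap.inr ℝ E J)).hasFDerivAt).comp z hd
    simp [vertHess, h1.fderiv]
  rw [key, key, hs.eq]

theorem vertHess_apply_null {z : E × J} (hz : z.1 ∈ Ω) {b : J} (hb : b ∈ nullSpace f z) (w : J) :
    vertHess f z w b = 0 := by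
  rw [h.vertHess_symm hz, mem_nullSpace.1 hb]; rfl

/-- By the symmetry of the Hessian, its values are determined on a complement of the null
space. -/
theorem eq_zero_of_restr_eq_zero {z : E × J} (hz : z.1 ∈ Ω) {S : Submodule ℝ J}
    (hS : nullSpace f z ⊔ S = ⊤) {w : J} (hw : ∀ s ∈ S, vertHess f z w s = 0) :
    vertHess f z w = 0 := by
  ext v
  obtain ⟨b, hb, s, hs, rfl⟩ := Submodule.mem_sup.1 (hS ▸ Submodule.mem_top : v ∈ nullSpace f z ⊔ S)
  simp [h.vertHess_apply_null hz hb, hw s hs]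

end IsRegularFamily

/-- A smooth map with injective derivative at a point is injective near this point. -/
theorem exists_injOn_of_injective_fderiv {V W : Type*} [NormedAddCommGroup V] [NormedSpace ℝ V]
    [FiniteDimensional ℝ V] [NormedAddCommGroup W] [NormedSpace ℝ W] [FiniteDimensional ℝ W]
    {g : V → W} {g' : V →L[ℝ] W} {a : V} (hg : HasStrictFDerivAt g g' a)
    (hinj : Function.Injective g') : ∃ O ∈ 𝓝 a, InjOn g O := by
  have : CompleteSpace V := FiniteDimensional.complete ℝ V
  obtain ⟨T, hT⟩ := LinearMap.exists_leftInverse_of_injective g'.toLinearMap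
    (LinearMap.ker_eq_bot.2 hinj)
  have h1 : HasStrictFDerivAt (T.toContinuousLinearMap ∘ g)
      ((ContinuousLinearEquiv.refl ℝ V : V ≃L[ℝ] V) : V →L[ℝ] V) a := by
    refine (T.toContinuousLinearMap.hasStrictFDerivAt.comp a hg).congr_fderiv ?_
    ext v
    exact DFunLike.congr_fun hT v
  refine ⟨_, (h1.toOpenPartialHomeomorph _).open_source.mem_nhds
    h1.mem_toOpenPartialHomeomorph_source, ?_⟩
  intro x hx y hy hxy
  refine (h1.toOpenPartialHomeomorph _).injOn hx hy ?_
  simp [HasStrictFDerivAt.toOpenPartialHomeomorph_coe, hxy]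

theorem IsSliceChart.hasFDerivAt_symm {V : Type*} [NormedAddCommGroup V] [NormedSpace ℝ V]
    {Q : Set V} {χ : OpenPartialHomeomorph V V} {K : Submodule ℝ V} (hχ : IsSliceChart Q χ K)
    {q : V} (hq : q ∈ χ.source) :
    HasStrictFDerivAt χ.symm (fderiv ℝ χ.symm (χ q)) (χ q) ∧ HasFDerivAt χ (fderiv ℝ χ q) q ∧
      fderiv ℝ χ.symm (χ q) ∘L fderiv ℝ χ q = .id ℝ V := by
  have h1 : ContDiffAt ℝ ∞ χ.symm (χ q) :=
    hχ.smooth_symm.contDiffAt (χ.open_target.mem_nhds (χ.map_source hq))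
  have h2 : HasFDerivAt χ (fderiv ℝ χ q) q :=
    ((hχ.smooth.contDiffAt (χ.open_source.mem_nhds hq)).differentiableAt (by simp)).hasFDerivAt
  refine ⟨h1.hasStrictFDerivAt (by simp), h2, ?_⟩
  have h3 : HasFDerivAt (χ.symm ∘ χ) (fderiv ℝ χ.symm (χ q) ∘L fderiv ℝ χ q) q :=
    (h1.differentiableAt (by simp)).hasFDerivAt.comp q h2
  refine h3.unique ((hasFDerivAt_id q).congr_of_eventuallyEq ?_)
  filter_upwards [χ.open_source.mem_nhds hq] with x hx using χ.left_inv hx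

/-- If `ℓ` is a submersion at `z` onto a submanifold with tangent space `K` in a slice chart, then
`K` is the image of the range of the derivative `D` of `ℓ`, and `dim K` is the rank of `D`. -/
theorem IsSliceChart.exists_eq_of_range_eq {V V' : Type*} [NormedAddCommGroup V]
    [NormedSpace ℝ V] [NormedAddCommGroup V'] [NormedSpace ℝ V'] [FiniteDimensional ℝ V']
    {Q : Set V} {χ : OpenPartialHomeomorph V V} {K : Submodule ℝ V} (hχ : IsSliceChart Q χ K)
    {ℓ : V' → V} {D : V' →L[ℝ] V} {z : V'} (hD : HasFDerivAt ℓ D z) (hz : ℓ z ∈ χ.source)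
    (hK : range (fderiv ℝ (χ ∘ ℓ) z) = (K : Set V)) :
    (∀ k ∈ K, ∃ v, D v = fderiv ℝ χ.symm (χ (ℓ z)) k ∧ (D v = 0 → k = 0)) ∧
      finrank ℝ K + finrank ℝ (LinearMap.ker D.toLinearMap) = finrank ℝ V' := by
  obtain ⟨-, hd, hid⟩ := hχ.hasFDerivAt_symm hz
  have hid' : ∀ v, fderiv ℝ χ.symm (χ (ℓ z)) (fderiv ℝ χ (ℓ z) (D v)) = D v :=
    fun v => DFunLike.congr_fun hid (D v)
  rw [(hd.comp z hD).fderiv] at hK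
  constructor
  · intro k hk
    have hk' : k ∈ (K : Set V) := hk
    rw [← hK] at hk'
    obtain ⟨v, rfl⟩ := hk'
    refine ⟨v, (hid' v).symm, fun h0 => ?_⟩
    simp [h0]
  · rw [← LinearMap.finrank_range_add_finrank_ker (fderiv ℝ χ (ℓ z) ∘L D).toLinearMap]
    congr 1
    · rw [show K = LinearMap.range (fderiv ℝ χ (ℓ z) ∘L D).toLinearMap from
        SetLike.coe_injective hK.symm]
    · rw [show LinearMap.ker (fderiv ℝ χ (ℓ z) ∘L D).toLinearMap = LinearMap.ker D.toLinearMap from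
        ?_]
      ext v
      simp only [LinearMap.mem_ker, ContinuousLinearMap.coe_coe, ContinuousLinearMap.comp_apply]
      refine ⟨fun h0 => ?_, fun h0 => by simp [h0]⟩
      rw [← hid' v, h0, map_zero]

/-- If a linear map is injective on the tangent space of a submanifold at `q`, then it is injective
on the submanifold near `q`. -/
theorem IsSliceChart.exists_injOn {V W : Type*} [NormedAddCommGroup V] [NormedSpace ℝ V]
    [FiniteDimensional ℝ V] [AddCommGroup W] [Module ℝ W]
    {Q : Set V} {χ : OpenPartialHomeomorph V V} {K : Submodule ℝ V} (hχ : IsSliceChart Q χ K)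
    {q : V} (hq : q ∈ χ.source) (hqQ : q ∈ Q) (R : V →ₗ[ℝ] W)
    (hR : ∀ k ∈ K, R (fderiv ℝ χ.symm (χ q) k) = 0 → k = 0) :
    ∃ O, IsOpen O ∧ q ∈ O ∧ O ⊆ χ.source ∧ InjOn R (Q ∩ O) := by
  have hs := (hχ.hasFDerivAt_symm hq).1
  have hkq : χ q ∈ K := (hχ.flat _ hq).1 hqQ
  have hs' : HasStrictFDerivAt χ.symm (fderiv ℝ χ.symm (χ q)) (K.subtypeL ⟨_, hkq⟩) := hs
  obtain ⟨T, hT⟩ := LinearMap.exists_leftInverse_of_injective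
    (R ∘ₗ (fderiv ℝ χ.symm (χ q) ∘L K.subtypeL).toLinearMap) (LinearMap.ker_eq_bot'.2 (by
      rintro ⟨k, hk⟩ hk0
      exact Subtype.ext (hR k hk hk0)))
  have hg : HasStrictFDerivAt ((T ∘ₗ R).toContinuousLinearMap ∘ χ.symm ∘ K.subtypeL)
      ((T ∘ₗ R).toContinuousLinearMap ∘L fderiv ℝ χ.symm (χ q) ∘L K.subtypeL) ⟨_, hkq⟩ :=
    (T ∘ₗ R).toContinuousLinearMap.hasStrictFDerivAt.comp _
      (hs'.comp (⟨_, hkq⟩ : K) K.subtypeL.hasStrictFDerivAt)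
  obtain ⟨O', hO', hinjO⟩ := exists_injOn_of_injective_fderiv hg (by
    intro a b hab
    have ha := DFunLike.congr_fun hT a
    have hb := DFunLike.congr_fun hT b
    exact ha.symm.trans (hab.trans hb))
  rw [nhds_subtype_eq_comap, Filter.mem_comap] at hO'
  obtain ⟨O1, hO1, hO1'⟩ := hO'
  obtain ⟨O2, hO2, hO2o, hO2m⟩ := mem_nhds_iff.1
    (Filter.inter_mem (χ.open_source.mem_nhds hq) ((χ.continuousAt hq).preimage_mem_nhds hO1))
  refine ⟨O2, hO2o, hO2m, fun w hw => (hO2 hw).1, ?_⟩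
  rintro w ⟨hw, hwO⟩ w' ⟨hw', hwO'⟩ heq
  have hk := (hχ.flat _ (hO2 hwO).1).1 hw
  have hk' := (hχ.flat _ (hO2 hwO').1).1 hw'
  have := @hinjO ⟨_, hk⟩ (hO1' (hO2 hwO).2) ⟨_, hk'⟩ (hO1' (hO2 hwO').2) (by
    simp only [Function.comp_apply, Submodule.subtypeL_apply, χ.left_inv (hO2 hwO).1,
      χ.left_inv (hO2 hwO').1, LinearMap.coe_toContinuousLinearMap', LinearMap.comp_apply, heq])
  exact χ.injOn (hO2 hwO).1 (hO2 hwO').1 (congrArg Subtype.val this)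

namespace IsRegularFamily
variable [FiniteDimensional ℝ E] [FiniteDimensional ℝ J]
variable (h : IsRegularFamily f Ω)
include h

/-- Near a point of the image of the Legendre map, the points of the image are determined by their
base point and by their restriction to a complement of the null space of the Hessian. -/
theorem exists_separating_nhds {z : E × J} (hz : z.1 ∈ Ω) {S : Submodule ℝ J}
    (hS : nullSpace f z ⊔ S = ⊤) :
    ∃ O : Set (E × (J →L[ℝ] ℝ)), IsOpen O ∧ legMap f z ∈ O ∧
      (∀ w ∈ legImage f Ω, ∀ w' ∈ legImage f Ω, w ∈ O → w' ∈ O → w.1 = w'.1 →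
        restr S w.2 = restr S w'.2 → w = w') ∧
      ∀ z' : E × J, z'.1 ∈ Ω → legMap f z' ∈ O →
        finrank ℝ (nullSpace f z') = finrank ℝ (nullSpace f z) := by
  obtain ⟨χ, K, hzχ, hχ, hK⟩ := h.slice z hz
  have hD := fun (z' : E × J) (hz' : z'.1 ∈ Ω) (hs' : legMap f z' ∈ χ.source) =>
    hχ.exists_eq_of_range_eq (h.hasFDerivAt_legMap hz') hs' (hK z' hz' hs')
  have hinj : ∀ k ∈ K, (LinearMap.id.prodMap (restr S).toLinearMap)
      (fderiv ℝ χ.symm (χ (legMap f z)) k) = 0 → k = 0 := by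
    intro k hk hk0
    obtain ⟨⟨e, w⟩, hv, hv'⟩ := (hD z hz hzχ).1 k hk
    rw [← hv] at hk0
    have he : e = 0 := congrArg Prod.fst hk0
    have hw : restr S (fderiv ℝ (vertDeriv f) z (e, w)) = 0 := congrArg Prod.snd hk0
    subst he
    have hw0 : vertHess f z w = 0 := h.eq_zero_of_restr_eq_zero hz hS
      fun s hs => DFunLike.congr_fun hw ⟨s, hs⟩
    have hw1 : fderiv ℝ (vertDeriv f) z (0, w) = 0 := hw0
    exact hv' (Prod.ext rfl hw1)
  obtain ⟨O, hO, hzO, hOχ, hinjO⟩ := hχ.exists_injOn hzχ (legMap_mem_legImage hz) _ hinj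
  refine ⟨O, hO, hzO, ?_, ?_⟩
  · intro w hw w' hw' hwO hwO' h1 h2
    exact hinjO ⟨hw, hwO⟩ ⟨hw', hwO'⟩ (Prod.ext h1 h2)
  · have key : ∀ z' : E × J, z'.1 ∈ Ω → legMap f z' ∈ χ.source →
        finrank ℝ K + finrank ℝ (nullSpace f z') = finrank ℝ (E × J) := by
      intro z' hz' hs'
      rw [← (hD z' hz' hs').2]
      congr 1
      rw [(Submodule.equivMapOfInjective (LinearMap.inr ℝ E J) LinearMap.inr_injective
          (nullSpace f z')).finrank_eq]
      rw [show (nullSpace f z').map (LinearMap.inr ℝ E J) = LinearMap.ker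
        ((ContinuousLinearMap.fst ℝ E J).prod (fderiv ℝ (vertDeriv f) z')).toLinearMap from ?_]
      ext ⟨e, w⟩
      constructor
      · rintro ⟨w', hw', heq⟩
        obtain ⟨rfl, rfl⟩ := Prod.mk.inj heq
        exact Prod.ext rfl hw'
      · intro h0
        have he : e = 0 := congrArg Prod.fst h0
        subst he
        exact ⟨w, congrArg Prod.snd h0, rfl⟩
    intro z' hz' hs'
    have e1 := key z hz hzχ
    have e2 := key z' hz' (hOχ hs')
    omega

end IsRegularFamily
end Fibrewise

/-! ### Coordinates adapted to the Legendre map -/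

section AdaptedCharts
open Set Module

/-- The inverse function theorem for a smooth map between spaces of equal finite dimension: the
inverse is smooth on the whole target, and the derivative is injective on the whole source. -/
theorem exists_smooth_local_inverse {V W : Type*} [NormedAddCommGroup V] [NormedSpace ℝ V]
    [FiniteDimensional ℝ V] [NormedAddCommGroup W] [NormedSpace ℝ W] [FiniteDimensional ℝ W]
    (hVW : finrank ℝ V = finrank ℝ W) {g : V → W} {O : Set V} (hO : IsOpen O)
    (hg : ContDiffOn ℝ ∞ g O) {a : V} (ha : a ∈ O)
    (hinj : Function.Injective (fderiv ℝ g a)) :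
    ∃ e : OpenPartialHomeomorph V W, a ∈ e.source ∧ e.source ⊆ O ∧ (∀ z, e z = g z) ∧
      ContDiffOn ℝ ∞ e.symm e.target ∧ ∀ z ∈ e.source, Function.Injective (fderiv ℝ g z) := by
  have : CompleteSpace V := FiniteDimensional.complete ℝ V
  have hat : ∀ z ∈ O, ContDiffAt ℝ ∞ g z := fun z hz => hg.contDiffAt (hO.mem_nhds hz)
  have hfd : ∀ z ∈ O, HasFDerivAt g (fderiv ℝ g z) z := fun z hz =>
    ((hat z hz).differentiableAt (by simp)).hasFDerivAt
  let A : V ≃L[ℝ] W :=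
    (LinearEquiv.ofInjectiveOfFinrankEq (fderiv ℝ g a).toLinearMap hinj hVW).toContinuousLinearEquiv
  have hA : (A : V →L[ℝ] W) = fderiv ℝ g a := by ext v; rfl
  have hcont : ContinuousAt (fderiv ℝ g) a :=
    (hg.fderiv_of_isOpen (m := 0) hO (by simp)).continuousOn.continuousAt (hO.mem_nhds ha)
  have hev : ∀ᶠ z in 𝓝 a, fderiv ℝ g z ∈ range ((↑) : (V ≃L[ℝ] W) → V →L[ℝ] W) :=
    hcont (by rw [← hA]; exact A.nhds)
  obtain ⟨O1, hO1, hO1o, haO1⟩ := mem_nhds_iff.1 (Filter.inter_mem (hO.mem_nhds ha) hev)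
  have hfa : HasFDerivAt g (A : V →L[ℝ] W) a := hA ▸ hfd a ha
  let e0 := (hat a ha).toOpenPartialHomeomorph g hfa (by simp)
  have he0 : ∀ z, e0 z = g z := fun z => rfl
  refine ⟨e0.restrOpen O1 hO1o, ⟨(hat a ha).mem_toOpenPartialHomeomorph_source hfa (by simp), haO1⟩,
    fun z hz => (hO1 hz.2).1, he0, ?_, ?_⟩
  · intro w hw
    have hz := (e0.restrOpen O1 hO1o).map_target hw
    obtain ⟨B, hB⟩ := (hO1 hz.2).2
    refine ContDiffAt.contDiffWithinAt ?_
    refine (e0.restrOpen O1 hO1o).contDiffAt_symm (f₀' := B) hw ?_ (hat _ (hO1 hz.2).1)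
    rw [hB]
    exact hfd _ (hO1 hz.2).1
  · intro z hz
    obtain ⟨B, hB⟩ := (hO1 hz.2).2
    rw [← hB]
    exact B.injective

variable {E J : Type*} [NormedAddCommGroup E] [NormedSpace ℝ E]
  [NormedAddCommGroup J] [NormedSpace ℝ J]

/-- Coordinates on `E × J` adapted to the Legendre map of `f` near `z₀`.  Here `P` is a projection
of `J` onto the null space of the Hessian at `z₀`, and `ι` identifies the linear forms on `ker P`
with vectors of `ker P`, so that the coordinates `(y, ι (∂f/∂v) + P v)` amount to
`(y, ∂f/∂v|_{ker P}, P v)`.  The set `O` is a neighbourhood of the Legendre image of the domain. -/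
structure AdaptedChart (f : E × J → ℝ) (Ω : Set E) (z₀ : E × J) where
  /-- the projection onto the null space -/
  P : J →L[ℝ] J
  P_mem : ∀ v, P v ∈ nullSpace f z₀
  P_apply : ∀ b ∈ nullSpace f z₀, P b = b
  /-- restriction of linear forms to `ker P`, with values in `ker P` -/
  ι : (J →L[ℝ] ℝ) →L[ℝ] J
  P_ι : ∀ p, P (ι p) = 0
  ι_eq_zero : ∀ p, ι p = 0 ↔ ∀ s, P s = 0 → p s = 0
  /-- the coordinates -/
  e : OpenPartialHomeomorph (E × J) (E × J)
  mem_source : z₀ ∈ e.source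
  e_apply : ∀ z, e z = (z.1, ι (vertDeriv f z) + P z.2)
  base_mem : ∀ z ∈ e.source, z.1 ∈ Ω
  smooth_symm : ContDiffOn ℝ ∞ e.symm e.target
  /-- the derivative of the coordinates is injective on the domain -/
  inj : ∀ z ∈ e.source, ∀ w, P w = 0 → (∀ s, P s = 0 → vertHess f z w s = 0) → w = 0
  rank : ∀ z ∈ e.source, finrank ℝ (nullSpace f z) = finrank ℝ (nullSpace f z₀)
  /-- a neighbourhood of the Legendre image -/
  O : Set (E × (J →L[ℝ] ℝ))
  isOpen : IsOpen O
  leg_mem : ∀ z ∈ e.source, legMap f z ∈ O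
  /-- in `O`, a point of the image is determined by its restriction to `ker P` -/
  sep : ∀ w ∈ legImage f Ω, ∀ w' ∈ legImage f Ω, w ∈ O → w' ∈ O → w.1 = w'.1 →
    (∀ s, P s = 0 → w.2 s = w'.2 s) → w = w'

variable {f : E × J → ℝ} {Ω : Set E}

theorem exists_restriction_embedding [FiniteDimensional ℝ J] (P : J →L[ℝ] J) :
    ∃ ι : (J →L[ℝ] ℝ) →L[ℝ] J, (∀ p, P (ι p) = 0) ∧ ∀ p, ι p = 0 ↔ ∀ s, P s = 0 → p s = 0 := by
  let S : Submodule ℝ J := LinearMap.ker P.toLinearMap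
  let θ : Dual ℝ S ≃ₗ[ℝ] S := LinearEquiv.ofFinrankEq _ _ Subspace.dual_finrank_eq
  let ρ : (J →L[ℝ] ℝ) →ₗ[ℝ] Dual ℝ S :=
    { toFun := fun p => p.toLinearMap ∘ₗ S.subtype
      map_add' := fun _ _ => rfl
      map_smul' := fun _ _ => rfl }
  refine ⟨(S.subtype ∘ₗ θ.toLinearMap ∘ₗ ρ).toContinuousLinearMap, fun p => (θ (ρ p)).2, ?_⟩
  intro p
  have h1 : (S.subtype ∘ₗ θ.toLinearMap ∘ₗ ρ).toContinuousLinearMap p = 0 ↔ ρ p = 0 := by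
    change ((θ (ρ p) : S) : J) = 0 ↔ _
    simp
  rw [h1]
  exact ⟨fun h s hs => DFunLike.congr_fun h ⟨s, hs⟩, fun h => LinearMap.ext fun s => h s s.2⟩

theorem contDiffOn_splitting {D' : Type*} [NormedAddCommGroup D'] [NormedSpace ℝ D']
    {φ : E × J → D'} {O : Set (E × J)} (hφ : ContDiffOn ℝ ∞ φ O) (ι : D' →L[ℝ] J) (P : J →L[ℝ] J) :
    ContDiffOn ℝ ∞ (fun z : E × J => (z.1, ι (φ z) + P z.2)) O := by
  have := ι.contDiff.comp_contDiffOn hφ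
  exact contDiffOn_fst.prodMk (this.add (P.contDiff.comp_contDiffOn contDiffOn_snd))

theorem hasFDerivAt_splitting {D' : Type*} [NormedAddCommGroup D'] [NormedSpace ℝ D']
    {φ : E × J → D'} {φ' : E × J →L[ℝ] D'} {z : E × J} (hφ : HasFDerivAt φ φ' z)
    (ι : D' →L[ℝ] J) (P : J →L[ℝ] J) :
    HasFDerivAt (fun z : E × J => (z.1, ι (φ z) + P z.2))
      ((ContinuousLinearMap.fst ℝ E J).prod
        (ι ∘L φ' + P ∘L ContinuousLinearMap.snd ℝ E J)) z := by
  have h1 : HasFDerivAt (fun z => ι (φ z)) (ι ∘L φ') z := ι.hasFDerivAt.comp z hφ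
  have h2 : HasFDerivAt (fun z : E × J => P z.2) (P ∘L ContinuousLinearMap.snd ℝ E J) z :=
    P.hasFDerivAt.comp z hasFDerivAt_snd
  exact hasFDerivAt_fst.prodMk (h1.add h2)

theorem IsRegularFamily.nonempty_adaptedChart [FiniteDimensional ℝ E] [FiniteDimensional ℝ J]
    (h : IsRegularFamily f Ω) {z₀ : E × J} (hz₀ : z₀.1 ∈ Ω) :
    Nonempty (AdaptedChart f Ω z₀) := by
  obtain ⟨P', hP'⟩ := Submodule.ClosedComplemented.of_finiteDimensional (nullSpace f z₀)
  obtain ⟨P, hPm, hP⟩ : ∃ P : J →L[ℝ] J, (∀ v, P v ∈ nullSpace f z₀) ∧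
      ∀ b ∈ nullSpace f z₀, P b = b :=
    ⟨(nullSpace f z₀).subtypeL ∘L P', fun v => (P' v).2,
      fun b hb => congrArg Subtype.val (hP' ⟨b, hb⟩)⟩
  obtain ⟨ι, hPι, hι⟩ := exists_restriction_embedding P
  have hsup : nullSpace f z₀ ⊔ LinearMap.ker P.toLinearMap = ⊤ := by
    rw [eq_top_iff]
    rintro v -
    refine Submodule.mem_sup.2 ⟨P v, hPm v, v - P v, ?_, by simp⟩
    simp [hP _ (hPm v)]
  obtain ⟨O, hO, hzO, hsep, hrank⟩ := h.exists_separating_nhds hz₀ hsup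
  have hO' : IsOpen {z : E × J | z.1 ∈ Ω ∧ legMap f z ∈ O} := by
    have hc : ContinuousOn (legMap f) {z | z.1 ∈ Ω} := fun z hz =>
      (h.contDiffAt_legMap hz).continuousAt.continuousWithinAt
    exact hc.isOpen_inter_preimage h.isOpen_domain hO
  have hg : ContDiffOn ℝ ∞ (fun z : E × J => (z.1, ι (vertDeriv f z) + P z.2))
      {z : E × J | z.1 ∈ Ω ∧ legMap f z ∈ O} :=
    contDiffOn_splitting (h.contDiffOn_vertDeriv.mono fun z hz => hz.1) _ _
  have hfd : ∀ z : E × J, z.1 ∈ Ω → ∀ v,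
      fderiv ℝ (fun z : E × J => (z.1, ι (vertDeriv f z) + P z.2)) z v =
      (v.1, ι (fderiv ℝ (vertDeriv f) z v) + P v.2) := fun z hz v => by
    rw [(hasFDerivAt_splitting (h.hasFDerivAt_vertDeriv hz) ι P).fderiv]
    rfl
  have hι0 : ∀ p v, ι p + P v = 0 → P v = 0 ∧ ∀ s, P s = 0 → p s = 0 := by
    intro p v h0
    have hPv : P v = 0 := by
      have := congrArg P h0
      rwa [map_add, hPι, zero_add, map_zero, hP _ (hPm v)] at this
    rw [hPv, add_zero] at h0
    exact ⟨hPv, (hι p).1 h0⟩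
  have hinj : Function.Injective
      (fderiv ℝ (fun z : E × J => (z.1, ι (vertDeriv f z) + P z.2)) z₀) := by
    rw [injective_iff_map_eq_zero]
    rintro ⟨e, w⟩ h0
    rw [hfd z₀ hz₀] at h0
    have he : e = 0 := congrArg Prod.fst h0
    subst he
    obtain ⟨hPw, hw⟩ := hι0 _ _ (congrArg Prod.snd h0)
    have hwN : w ∈ nullSpace f z₀ := h.eq_zero_of_restr_eq_zero hz₀ hsup hw
    rw [hP w hwN] at hPw
    rw [hPw]; rfl
  obtain ⟨e, he1, he2, he3, he4, he5⟩ := exists_smooth_local_inverse rfl hO' hg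
    (a := z₀) ⟨hz₀, hzO⟩ hinj
  refine ⟨⟨P, hPm, hP, ι, hPι, hι, e, he1, he3, fun z hz => (he2 hz).1, he4, ?_,
    fun z hz => hrank z (he2 hz).1 (he2 hz).2, O, hO, fun z hz => (he2 hz).2, ?_⟩⟩
  · intro z hz w hw hws
    have hi := he5 z hz
    rw [injective_iff_map_eq_zero] at hi
    refine congrArg Prod.snd (hi (0, w) ?_)
    rw [hfd z (he2 hz).1]
    refine Prod.ext rfl ?_
    have : ι (vertHess f z w) = 0 := (hι _).2 hws
    change ι (vertHess f z w) + P w = 0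
    rw [this, hw, add_zero]
  · intro w hw w' hw' hwO hwO' h1 h2
    refine hsep w hw w' hw' hwO hwO' h1 ?_
    ext ⟨s, hs⟩
    exact h2 s hs

end AdaptedCharts

section AdaptedCharts
open Set Module

variable {E J : Type*} [NormedAddCommGroup E] [NormedSpace ℝ E]
  [NormedAddCommGroup J] [NormedSpace ℝ J] {f : E × J → ℝ} {Ω : Set E}

namespace AdaptedChart

variable {z₀ : E × J} (a : AdaptedChart f Ω z₀)

/-- The coordinates of the jets whose Legendre image restricts to the form `w.2` on `ker P` and
whose projection is `P b`. -/
def coord (w : E × (J →L[ℝ] ℝ)) (b : J) : E × J := (w.1, a.ι w.2 + a.P b)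

/-- The vector with coordinates `a.coord w b`. -/
def inv (w : E × (J →L[ℝ] ℝ)) (b : J) : J := (a.e.symm (a.coord w b)).2

theorem P_P (v : J) : a.P (a.P v) = a.P v := a.P_apply _ (a.P_mem v)

theorem sup_eq_top : nullSpace f z₀ ⊔ LinearMap.ker a.P.toLinearMap = ⊤ := by
  rw [eq_top_iff]
  rintro v -
  refine Submodule.mem_sup.2 ⟨a.P v, a.P_mem v, v - a.P v, ?_, by simp⟩
  simp [a.P_P v]

theorem ι_eq_iff {p q : J →L[ℝ] ℝ} : a.ι p = a.ι q ↔ ∀ s, a.P s = 0 → p s = q s := by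
  rw [← sub_eq_zero, ← map_sub, a.ι_eq_zero]
  simp [sub_eq_zero]

theorem symm_eq {w : E × (J →L[ℝ] ℝ)} {b : J} (h : a.coord w b ∈ a.e.target) :
    a.e.symm (a.coord w b) = (w.1, a.inv w b) ∧ a.P (a.inv w b) = a.P b ∧
      a.ι (vertDeriv f (w.1, a.inv w b)) = a.ι w.2 := by
  have h1 := a.e.right_inv h
  rw [a.e_apply] at h1
  have h2 : (a.e.symm (a.coord w b)).1 = w.1 := congrArg Prod.fst h1
  have h3 : a.e.symm (a.coord w b) = (w.1, a.inv w b) := Prod.ext h2 rfl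
  rw [h3] at h1
  have h4 : a.ι (vertDeriv f (w.1, a.inv w b)) + a.P (a.inv w b) = a.ι w.2 + a.P b :=
    congrArg Prod.snd h1
  have h5 := congrArg a.P h4
  simp only [map_add, a.P_ι, a.P_P, zero_add] at h5
  rw [h5] at h4
  exact ⟨h3, h5, add_right_cancel h4⟩

theorem mem_source_inv {w : E × (J →L[ℝ] ℝ)} {b : J} (h : a.coord w b ∈ a.e.target) :
    (w.1, a.inv w b) ∈ a.e.source := by
  rw [← (a.symm_eq h).1]
  exact a.e.map_target h

theorem inv_eq {w : E × (J →L[ℝ] ℝ)} {b v : J} (hv : (w.1, v) ∈ a.e.source)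
    (h1 : a.ι (vertDeriv f (w.1, v)) = a.ι w.2) (h2 : a.P v = a.P b) : a.inv w b = v := by
  have : a.coord w b = a.e (w.1, v) := by rw [a.e_apply, coord, h1, h2]
  rw [inv, this, a.e.left_inv hv]

theorem vertDeriv_inv {w : E × (J →L[ℝ] ℝ)} {b : J} (h : a.coord w b ∈ a.e.target)
    (hw : w ∈ legImage f Ω) (hO : w ∈ a.O) : vertDeriv f (w.1, a.inv w b) = w.2 := by
  have hs := a.mem_source_inv h
  have := a.sep _ (legMap_mem_legImage (a.base_mem _ hs)) w hw (a.leg_mem _ hs) hO rfl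
    (a.ι_eq_iff.1 (a.symm_eq h).2.2)
  exact congrArg Prod.snd this

/-- The domain on which the section of the Legendre map through `z₀` is defined. -/
def dom : Set (E × (J →L[ℝ] ℝ)) := a.O ∩ {w | a.coord w z₀.2 ∈ a.e.target}

theorem contDiff_coord : ContDiff ℝ ∞ fun x : (E × (J →L[ℝ] ℝ)) × J => a.coord x.1 x.2 := by
  have h1 : ContDiff ℝ ∞ a.ι := ContinuousLinearMap.contDiff _
  have h2 : ContDiff ℝ ∞ a.P := ContinuousLinearMap.contDiff _
  exact (contDiff_fst.comp contDiff_fst).prodMk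
    ((h1.comp (contDiff_snd.comp contDiff_fst)).add (h2.comp contDiff_snd))

theorem isOpen_dom : IsOpen a.dom :=
  a.isOpen.inter (a.e.open_target.preimage
    (a.contDiff_coord.continuous.comp (continuous_id.prodMk continuous_const)))

theorem legMap_mem_dom : legMap f z₀ ∈ a.dom := by
  refine ⟨a.leg_mem _ a.mem_source, ?_⟩
  have : a.coord (legMap f z₀) z₀.2 = a.e z₀ := by rw [a.e_apply]; rfl
  rw [mem_ofPred_eq, this]
  exact a.e.map_source a.mem_source

theorem contDiffOn_inv (b : J) :
    ContDiffOn ℝ ∞ (fun w => a.inv w b) {w | a.coord w b ∈ a.e.target} :=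
  contDiff_snd.comp_contDiffOn (a.smooth_symm.comp
    (a.contDiff_coord.comp (contDiff_id.prodMk contDiff_const)).contDiffOn fun _ h => h)

end AdaptedChart

/-- Along a path on which the vertical derivative is a constant form `p`, the function
`p v - f (y, v)` is constant. -/
theorem energy_eq_of_path {y : E} {p : J →L[ℝ] ℝ} {γ : ℝ → J}
    (hf : ∀ v, DifferentiableAt ℝ f (y, v))
    (hγ : ∀ τ ∈ Icc (0 : ℝ) 1, DifferentiableAt ℝ γ τ)
    (hp : ∀ τ ∈ Icc (0 : ℝ) 1, vertDeriv f (y, γ τ) = p) :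
    p (γ 1) - f (y, γ 1) = p (γ 0) - f (y, γ 0) := by
  have hd : ∀ τ ∈ Icc (0 : ℝ) 1, HasDerivAt (fun τ => p (γ τ) - f (y, γ τ)) 0 τ := by
    intro τ hτ
    have h1 := (hγ τ hτ).hasDerivAt
    have h2 : HasDerivAt (fun τ => p (γ τ)) (p (deriv γ τ)) τ := p.hasFDerivAt.comp_hasDerivAt τ h1
    have h3 : HasDerivAt (fun τ => f (y, γ τ)) (fderiv ℝ f (y, γ τ) (0, deriv γ τ)) τ :=
      (hf (γ τ)).hasFDerivAt.comp_hasDerivAt τ ((hasDerivAt_const τ y).prodMk h1)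
    refine (h2.sub h3).congr_deriv ?_
    rw [← hp τ hτ]
    exact sub_self _
  have := constant_of_has_deriv_right_zero (f := fun τ => p (γ τ) - f (y, γ τ)) (a := 0) (b := 1)
    (fun τ hτ => (hd τ hτ).continuousAt.continuousWithinAt)
    (fun τ hτ => (hd τ (Ico_subset_Icc_self hτ)).hasDerivWithinAt) 1 (by simp)
  exact this

namespace IsRegularFamily
variable (h : IsRegularFamily f Ω)
include h

theorem hasDerivAt_line {y : E} (hy : y ∈ Ω) (v w : J) :
    HasDerivAt (fun t : ℝ => vertDeriv f (y, v + t • w)) (vertHess f (y, v) w) 0 := by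
  have h1 : HasDerivAt (fun t : ℝ => (y, v + t • w)) ((0 : E), w) 0 := by
    have : HasDerivAt (fun t : ℝ => v + t • w) w 0 := by
      simpa using ((hasDerivAt_id (0 : ℝ)).smul_const w).const_add v
    exact (hasDerivAt_const _ _).prodMk this
  have h2 : HasFDerivAt (vertDeriv f) (fderiv ℝ (vertDeriv f) (y, v)) (y, v + (0 : ℝ) • w) := by
    simpa using h.hasFDerivAt_vertDeriv (z := (y, v)) hy
  exact h2.comp_hasDerivAt (0 : ℝ) h1

/-- Two nearby jets with the same Legendre image differ by a null vector of the Hessian: the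
function `v ↦ ∂f/∂v · v - f` takes equal values along the two lifts of a curve in the image of
the Legendre map, and its derivative along the lifts gives the claim. -/
theorem exists_sub_mem_nullSpace {z₀ : E × J} (hz₀ : z₀.1 ∈ Ω) (a : AdaptedChart f Ω z₀) :
    ∃ δ > 0, ∀ v, (z₀.1, v) ∈ a.e.source → ‖a.P v - a.P z₀.2‖ < δ →
      vertDeriv f (z₀.1, v) = vertDeriv f z₀ → v - z₀.2 ∈ nullSpace f z₀ := by
  obtain ⟨y, v₀⟩ := z₀
  simp only at hz₀ ⊢
  obtain ⟨δ, hδ, hball⟩ := Metric.isOpen_iff.1 a.e.open_target _ (a.e.map_source a.mem_source)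
  refine ⟨δ, hδ, fun v hv hPv hfib => ?_⟩
  refine h.eq_zero_of_restr_eq_zero hz₀ a.sup_eq_top fun w hw => ?_
  rw [h.vertHess_symm hz₀]
  replace hw : a.P w = 0 := hw
  -- the curve of forms along the line through `v₀` in the direction `w`
  let p : ℝ → J →L[ℝ] ℝ := fun t => vertDeriv f (y, v₀ + t • w)
  have hp : HasDerivAt p (vertHess f (y, v₀) w) 0 := h.hasDerivAt_line hz₀ v₀ w
  have hp0 : p 0 = vertDeriv f (y, v₀) := by simp [p]
  have hf : ∀ v, DifferentiableAt ℝ f (y, v) := fun v =>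
    (h.contDiffAt (z := (y, v)) hz₀).differentiableAt (by simp)
  let c : ℝ → J := fun τ => v₀ + τ • (v - v₀)
  -- coordinates of the lift with projection `P (c τ)`
  have hcoord : ∀ᶠ t in 𝓝 (0 : ℝ), ∀ τ ∈ Icc (0 : ℝ) 1, a.coord (y, p t) (c τ) ∈ a.e.target := by
    have h1 : Filter.Tendsto (fun t => ‖a.ι (p t) - a.ι (p 0)‖) (𝓝 0) (𝓝 0) := by
      have : ContinuousAt (fun t => ‖a.ι (p t) - a.ι (p 0)‖) 0 :=
        (((a.ι.continuous.continuousAt.comp hp.continuousAt).sub continuousAt_const).norm)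
      simpa [ContinuousAt] using this
    filter_upwards [h1.eventually_lt_const (sub_pos.2 hPv), h1.eventually_lt_const hδ]
      with t ht ht' τ hτ
    apply hball
    rw [a.e_apply, mem_ball_iff_norm]
    have e1 : a.coord (y, p t) (c τ) - (y, a.ι (vertDeriv f (y, v₀)) + a.P v₀) =
        (0, (a.ι (p t) - a.ι (p 0)) + τ • (a.P v - a.P v₀)) := by
      refine Prod.ext (sub_self _) ?_
      simp only [AdaptedChart.coord, Prod.snd_sub, hp0, c, map_add, map_smul, map_sub]
      abel
    rw [e1, Prod.norm_mk, norm_zero, max_lt_iff]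
    refine ⟨hδ, (norm_add_le _ _).trans_lt ?_⟩
    rw [norm_smul, Real.norm_of_nonneg hτ.1]
    have := mul_le_mul_of_nonneg_right hτ.2 (norm_nonneg (a.P v - a.P v₀))
    linarith
  have hsrc : ∀ᶠ t in 𝓝 (0 : ℝ), (y, v₀ + t • w) ∈ a.e.source := by
    have : ContinuousAt (fun t : ℝ => (y, v₀ + t • w)) 0 := by fun_prop
    exact this (a.e.open_source.mem_nhds (by simpa using a.mem_source))
  let u : ℝ → J := fun t => a.inv (y, p t) v
  have hu0 : u 0 = v := by
    refine a.inv_eq hv ?_ rfl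
    simp only [hp0, hfib]
  have hc1 : c 1 = v := by simp [c]
  have hc0 : c 0 = v₀ := by simp [c]
  have hu : DifferentiableAt ℝ u 0 := by
    have h1 : a.coord (y, p 0) v ∈ a.e.target := by
      have := hcoord.self_of_nhds 1 (by simp)
      rwa [hc1] at this
    have h2 := ((a.contDiffOn_inv v).contDiffAt ((a.e.open_target.preimage
      (a.contDiff_coord.continuous.comp (continuous_id.prodMk continuous_const))).mem_nhds
        h1)).differentiableAt (by simp)
    have h3 : DifferentiableAt ℝ (fun t => (y, p t)) 0 :=
      (differentiableAt_const _).prodMk hp.differentiableAt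
    exact DifferentiableAt.comp (g := fun w => a.inv w v) (0 : ℝ) h2 h3
  have hE : ∀ᶠ t in 𝓝 (0 : ℝ),
      p t (u t) - f (y, u t) - (p t (v₀ + t • w) - f (y, v₀ + t • w)) = 0 := by
    filter_upwards [hcoord, hsrc] with t ht hst
    have hmem : (y, p t) ∈ legImage f Ω := ⟨hz₀, _, rfl⟩
    have hO : (y, p t) ∈ a.O := a.leg_mem _ hst
    have := energy_eq_of_path (f := f) (y := y) (p := p t) (γ := fun τ => a.inv (y, p t) (c τ)) hf
      (fun τ hτ => by
        have h1 := (a.smooth_symm.contDiffAt (a.e.open_target.mem_nhds (ht τ hτ))).differentiableAt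
          (by simp)
        have h2 : DifferentiableAt ℝ (fun τ => a.coord (y, p t) (c τ)) τ := by
          have := (a.contDiff_coord.differentiable (by simp)) ((y, p t), c τ)
          have hc : DifferentiableAt ℝ c τ := by fun_prop
          exact DifferentiableAt.comp (g := fun x : (E × (J →L[ℝ] ℝ)) × J => a.coord x.1 x.2) τ this
            ((differentiableAt_const (y, p t)).prodMk hc)
        exact (h1.comp τ h2).snd)
      (fun τ hτ => a.vertDeriv_inv (ht τ hτ) hmem hO)
    simp only [hc1, hc0] at this
    rw [a.inv_eq (w := (y, p t)) (b := v₀) hst rfl (by simp [hw])] at this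
    rw [sub_eq_zero]
    exact this
  have hlin : HasDerivAt (fun t : ℝ => v₀ + t • w) w 0 := by
    simpa using ((hasDerivAt_id (0 : ℝ)).smul_const w).const_add v₀
  have hu' := hu.hasDerivAt
  have d1 : HasDerivAt (fun t => p t (u t)) (vertHess f (y, v₀) w (u 0) + p 0 (deriv u 0)) 0 :=
    hp.clm_apply hu'
  have d2 : HasDerivAt (fun t => p t (v₀ + t • w))
      (vertHess f (y, v₀) w (v₀ + (0 : ℝ) • w) + p 0 w) 0 := hp.clm_apply hlin
  have d3 : HasDerivAt (fun t => f (y, u t)) (fderiv ℝ f (y, u 0) (0, deriv u 0)) 0 :=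
    (hf (u 0)).hasFDerivAt.comp_hasDerivAt (0 : ℝ) ((hasDerivAt_const _ _).prodMk hu')
  have d4 : HasDerivAt (fun t : ℝ => f (y, v₀ + t • w))
      (fderiv ℝ f (y, v₀ + (0 : ℝ) • w) (0, w)) 0 :=
    (hf _).hasFDerivAt.comp_hasDerivAt (0 : ℝ) ((hasDerivAt_const _ _).prodMk hlin)
  have d5 := ((d1.sub d3).sub (d2.sub d4)).unique
    ((hasDerivAt_const (0 : ℝ) (0 : ℝ)).congr_of_eventuallyEq hE)
  have e1 : fderiv ℝ f (y, u 0) (0, deriv u 0) = p 0 (deriv u 0) := by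
    rw [hp0, hu0, ← hfib]; rfl
  have e2 : fderiv ℝ f (y, v₀ + (0 : ℝ) • w) (0, w) = p 0 w := rfl
  rw [e1, e2, hu0] at d5
  simp only [zero_smul, add_zero] at d5
  rw [map_sub]
  linarith

end IsRegularFamily
end AdaptedCharts

/-! ### Fibres and local sections of the Legendre map -/

section LocalSections
open Set Module

variable {E J : Type*} [NormedAddCommGroup E] [NormedSpace ℝ E]
  [NormedAddCommGroup J] [NormedSpace ℝ J] {f : E × J → ℝ} {Ω : Set E}
  [FiniteDimensional ℝ E] [FiniteDimensional ℝ J]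

namespace IsRegularFamily
variable (h : IsRegularFamily f Ω)
include h

/-- The fibres of the Legendre map are locally affine: near a jet `z₀` the fibre through `z₀` is
the translate of the null space of the Hessian. -/
theorem eventually_mem_fibre_iff {y : E} (hy : y ∈ Ω) (v₀ : J) :
    ∀ᶠ v in 𝓝 v₀, vertDeriv f (y, v) = vertDeriv f (y, v₀) ↔ v - v₀ ∈ nullSpace f (y, v₀) := by
  obtain ⟨a⟩ := h.nonempty_adaptedChart (z₀ := (y, v₀)) hy
  obtain ⟨δ, hδ, hloc⟩ := h.exists_sub_mem_nullSpace hy a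
  have e1 : ∀ᶠ v in 𝓝 v₀, (y, v) ∈ a.e.source :=
    (by fun_prop : ContinuousAt (fun v : J => (y, v)) v₀)
      (a.e.open_source.mem_nhds a.mem_source)
  have e2 : ∀ᶠ v in 𝓝 v₀, ‖a.P v - a.P v₀‖ < δ := by
    have : Filter.Tendsto (fun v => ‖a.P v - a.P v₀‖) (𝓝 v₀) (𝓝 0) := by
      have : ContinuousAt (fun v => ‖a.P v - a.P v₀‖) v₀ := by fun_prop
      simpa [ContinuousAt] using this
    exact this.eventually_lt_const hδ
  have e3 : ∀ᶠ v in 𝓝 v₀, a.coord (y, vertDeriv f (y, v₀)) v ∈ a.e.target := by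
    refine ((a.contDiff_coord.continuous.comp
      (continuous_const.prodMk continuous_id)).continuousAt).preimage_mem_nhds
      (a.e.open_target.mem_nhds ?_)
    have : a.coord (y, vertDeriv f (y, v₀)) v₀ = a.e (y, v₀) := by rw [a.e_apply]; rfl
    simp only [Function.comp_apply, id]
    rw [this]
    exact a.e.map_source a.mem_source
  filter_upwards [e1, e2, e3] with v h1 h2 h3
  refine ⟨hloc v h1 h2, fun hv => ?_⟩
  -- the point of the fibre with the same projection as `v` coincides with `v`
  have hs := a.symm_eq h3
  have hfib := a.vertDeriv_inv h3 (legMap_mem_legImage (z := (y, v₀)) hy) (a.leg_mem _ a.mem_source)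
  have hn := hloc _ (a.mem_source_inv h3) (by rw [hs.2.1]; exact h2) hfib
  have h4 := a.P_apply _ hn
  rw [map_sub, hs.2.1, ← map_sub, a.P_apply _ hv] at h4
  rw [sub_left_inj.1 h4]
  exact hfib

/-- A connected fibre of the Legendre map is an affine subspace. -/
theorem fibre_eq_of_isPreconnected {y : E} (hy : y ∈ Ω) {q : J →L[ℝ] ℝ}
    (hF : IsPreconnected {v | vertDeriv f (y, v) = q}) {v₀ : J} (hv₀ : vertDeriv f (y, v₀) = q)
    (v : J) : vertDeriv f (y, v) = q ↔ v - v₀ ∈ nullSpace f (y, v₀) := by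
  have hray : ∀ v b : J, Filter.Tendsto (fun t : ℝ => v + t • b) (𝓝[≠] 0) (𝓝 v) := by
    intro v b
    have : ContinuousAt (fun t : ℝ => v + t • b) 0 := by fun_prop
    have h0 := this.tendsto
    simp only [zero_smul, add_zero] at h0
    exact h0.mono_left nhdsWithin_le_nhds
  have hsub : ∀ {v₁ v₂ : J}, vertDeriv f (y, v₁) = q → vertDeriv f (y, v₂) = q →
      nullSpace f (y, v₁) = nullSpace f (y, v₂) ∧ v₂ - v₁ ∈ nullSpace f (y, v₁) := by
    intro v₁ v₂ h1 h2
    refine hF.induction₂ (fun v₁ v₂ => nullSpace f (y, v₁) = nullSpace f (y, v₂) ∧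
      v₂ - v₁ ∈ nullSpace f (y, v₁)) ?_ ?_ ?_ h1 h2
    · intro x hx
      have hev := (h.eventually_mem_fibre_iff hy x).eventually_nhds
      filter_upwards [mem_nhdsWithin_of_mem_nhds hev, self_mem_nhdsWithin] with x' hx' hxF
      have hxF' : vertDeriv f (y, x') = vertDeriv f (y, x) := Eq.trans hxF (Eq.symm hx)
      have hmem := hx'.self_of_nhds.1 hxF'
      refine ⟨?_, hmem⟩
      have hev' := h.eventually_mem_fibre_iff hy x'
      -- near `x'`, the translates of both null spaces describe the fibre
      have key : ∀ b, ∀ᶠ t in 𝓝[≠] (0 : ℝ),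
          (x' + t • b - x ∈ nullSpace f (y, x) ↔ x' + t • b - x' ∈ nullSpace f (y, x')) ∧
            t ≠ 0 := by
        intro b
        filter_upwards [(hray x' b).eventually hx', (hray x' b).eventually hev',
          self_mem_nhdsWithin] with t h1 h2 h3
        exact ⟨by rw [← h1, ← h2, hxF'], h3⟩
      ext b
      obtain ⟨t, ht, ht0⟩ := (key b).exists
      rw [add_sub_cancel_left, Submodule.smul_mem_iff _ ht0, add_sub_right_comm,
        Submodule.add_mem_iff_right _ hmem, Submodule.smul_mem_iff _ ht0] at ht
      exact ht
    · rintro x x' x'' - - - ⟨h1, h2⟩ ⟨h3, h4⟩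
      refine ⟨h1.trans h3, ?_⟩
      rw [← h1] at h4
      simpa using add_mem h4 h2
    · rintro x x' - - ⟨h1, h2⟩
      refine ⟨h1.symm, ?_⟩
      rw [← h1, ← neg_sub]
      exact neg_mem h2
  refine ⟨fun hv => (hsub hv₀ hv).2, fun hv => ?_⟩
  -- within the affine subspace, the fibre is open and closed
  let N := nullSpace f (y, v₀)
  have hclopen : IsClopen {b : N | vertDeriv f (y, v₀ + b) = q} := by
    have hcont : Continuous fun b : N => vertDeriv f (y, v₀ + b) :=
      h.contDiffOn_vertDeriv.continuousOn.comp_continuous (by fun_prop) fun _ => hy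
    refine ⟨isClosed_singleton.preimage hcont, isOpen_iff_mem_nhds.2 fun b hb => ?_⟩
    have hev := h.eventually_mem_fibre_iff hy (v₀ + (b : J))
    have hc : ContinuousAt (fun b : N => v₀ + (b : J)) b := by fun_prop
    filter_upwards [hc.eventually hev] with b' hb'
    have hb : vertDeriv f (y, v₀ + b) = q := hb
    rw [← hb, hb', ← (hsub hv₀ hb).1, add_sub_add_left_eq_sub]
    exact sub_mem b'.2 b.2
  have hall := hclopen.eq_univ ⟨0, by simpa using hv₀⟩
  have : (⟨v - v₀, hv⟩ : N) ∈ {b : N | vertDeriv f (y, v₀ + b) = q} := hall ▸ mem_univ _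
  simpa using this

/-- An almost regular Lagrangian has, near each point of the constraint space, a section of the
Legendre map whose values over a common base point differ by elements of `ker P`, and which
inverts the Legendre map up to forms that vanish on `ker P`. -/
theorem exists_local_section {z₀ : E × J} (hz₀ : z₀.1 ∈ Ω) :
    ∃ (P : J →L[ℝ] J) (U : Set (E × (J →L[ℝ] ℝ))) (Φ : E × (J →L[ℝ] ℝ) → J),
      IsOpen U ∧ legMap f z₀ ∈ U ∧ (∀ w ∈ U, w.1 ∈ Ω) ∧ ContDiffOn ℝ ∞ Φ U ∧
      (∀ w ∈ U, P (Φ w) = P z₀.2) ∧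
      (∀ w ∈ U, ∀ s, P s = 0 → vertDeriv f (w.1, Φ w) s = w.2 s) ∧
      ∀ w ∈ legImage f Ω ∩ U, vertDeriv f (w.1, Φ w) = w.2 := by
  obtain ⟨a⟩ := h.nonempty_adaptedChart hz₀
  exact ⟨a.P, a.dom, fun w => a.inv w z₀.2, a.isOpen_dom, a.legMap_mem_dom,
    fun w hw => a.base_mem _ (a.mem_source_inv hw.2),
    (a.contDiffOn_inv z₀.2).mono fun w hw => hw.2, fun w hw => (a.symm_eq hw.2).2.1,
    fun w hw => a.ι_eq_iff.1 (a.symm_eq hw.2).2.2, fun w hw => a.vertDeriv_inv hw.2.2 hw.1 hw.2.1⟩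

omit [FiniteDimensional ℝ E] in
/-- The derivative of the inverse adapted coordinates in the direction of the null space:
it inverts the projection from the null space at nearby jets to the null space at `z₀`. -/
theorem fderiv_symm_null {z₀ : E × J} (a : AdaptedChart f Ω z₀) {z : E × J}
    (hz : z ∈ a.e.source) {β x : J} (hβ : β ∈ nullSpace f z₀) :
    (x ∈ nullSpace f z ∧ a.P x = β) ↔ (fderiv ℝ a.e.symm (a.e z) (0, β)).2 = x := by
  have hzΩ := a.base_mem z hz
  have hfe : HasFDerivAt a.e ((ContinuousLinearMap.fst ℝ E J).prod
      (a.ι ∘L fderiv ℝ (vertDeriv f) z + a.P ∘L ContinuousLinearMap.snd ℝ E J)) z := by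
    have := hasFDerivAt_splitting (h.hasFDerivAt_vertDeriv hzΩ) a.ι a.P
    exact this.congr_of_eventuallyEq (Filter.Eventually.of_forall fun z => a.e_apply z)
  have hfs : HasFDerivAt a.e.symm (fderiv ℝ a.e.symm (a.e z)) (a.e z) :=
    ((a.smooth_symm.contDiffAt (a.e.open_target.mem_nhds (a.e.map_source hz))).differentiableAt
      (by simp)).hasFDerivAt
  have hcomp := (hfs.comp z hfe).unique ((hasFDerivAt_id z).congr_of_eventuallyEq (by
    filter_upwards [a.e.open_source.mem_nhds hz] with x hx using a.e.left_inv hx))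
  have hsol : ∀ x, x ∈ nullSpace f z → (fderiv ℝ a.e.symm (a.e z) (0, a.P x)).2 = x := by
    intro x hx
    have h1 := DFunLike.congr_fun hcomp (0, x)
    have hx0 : fderiv ℝ (vertDeriv f) z (0, x) = 0 := hx
    simp only [ContinuousLinearMap.comp_apply, ContinuousLinearMap.prod_apply,
      add_apply, ContinuousLinearMap.coe_fst', ContinuousLinearMap.coe_snd',
      hx0, map_zero, zero_add, ContinuousLinearMap.id_apply] at h1
    exact congrArg Prod.snd h1
  refine ⟨fun ⟨h1, h2⟩ => h2 ▸ hsol x h1, fun hx => ?_⟩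
  let T : nullSpace f z →ₗ[ℝ] nullSpace f z₀ :=
    (a.P.toLinearMap ∘ₗ (nullSpace f z).subtype).codRestrict _ fun v => a.P_mem v
  have hT : Function.Injective T := by
    rw [injective_iff_map_eq_zero]
    rintro ⟨v, hv⟩ h0
    refine Subtype.ext (a.inj z hz v (congrArg Subtype.val h0) fun s _ => ?_)
    rw [mem_nullSpace.1 hv]; rfl
  obtain ⟨⟨x', hx'⟩, hTx⟩ := (LinearMap.injective_iff_surjective_of_finrank_eq_finrank
    (a.rank z hz)).1 hT ⟨β, hβ⟩
  have hPx : a.P x' = β := congrArg Subtype.val hTx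
  have := hsol x' hx'
  rw [hPx, hx] at this
  rw [this]
  exact ⟨hx', hPx⟩

/-- If moreover the fibres of the Legendre map are connected, the local sections of
`exists_local_section` form a smooth family that passes through every jet over `U`. -/
theorem exists_local_family {z₀ : E × J} (hz₀ : z₀.1 ∈ Ω)
    (hconn : ∀ w ∈ legImage f Ω, IsPreconnected {v | vertDeriv f (w.1, v) = w.2}) :
    ∃ (P : J →L[ℝ] J) (U : Set (E × (J →L[ℝ] ℝ))) (α : (E × (J →L[ℝ] ℝ)) × J → J),
      IsOpen U ∧ legMap f z₀ ∈ U ∧ (∀ w ∈ U, w.1 ∈ Ω) ∧ ContDiffOn ℝ ∞ α (U ×ˢ univ) ∧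
      (∀ w ∈ U, ∀ b, P (α (w, b)) = P b) ∧
      (∀ w ∈ U, ∀ b s, P s = 0 → vertDeriv f (w.1, α (w, b)) s = w.2 s) ∧
      (∀ w ∈ legImage f Ω ∩ U, ∀ b, vertDeriv f (w.1, α (w, b)) = w.2) ∧
      ∀ z : E × J, z.1 ∈ Ω → legMap f z ∈ U → α (legMap f z, z.2) = z.2 := by
  obtain ⟨a⟩ := h.nonempty_adaptedChart hz₀
  let α : (E × (J →L[ℝ] ℝ)) × J → J := fun x =>
    a.inv x.1 z₀.2 + (fderiv ℝ a.e.symm (a.coord x.1 z₀.2) (0, a.P x.2 - a.P z₀.2)).2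
  have hΩ : ∀ w ∈ a.dom, w.1 ∈ Ω := fun w hw => a.base_mem _ (a.mem_source_inv hw.2)
  have hcoord : ∀ w ∈ a.dom, a.e (w.1, a.inv w z₀.2) = a.coord w z₀.2 := fun w hw => by
    rw [← (a.symm_eq hw.2).1, a.e.right_inv hw.2]
  have hβ : ∀ b, a.P b - a.P z₀.2 ∈ nullSpace f z₀ := fun b => sub_mem (a.P_mem _) (a.P_mem _)
  have hα : ∀ w ∈ a.dom, ∀ b v, α (w, b) = v ↔
      v - a.inv w z₀.2 ∈ nullSpace f (w.1, a.inv w z₀.2) ∧ a.P v = a.P b := by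
    intro w hw b v
    have h1 := h.fderiv_symm_null a (a.mem_source_inv hw.2) (x := v - a.inv w z₀.2) (hβ b)
    rw [hcoord w hw] at h1
    have h2 : a.P (v - a.inv w z₀.2) = a.P b - a.P z₀.2 ↔ a.P v = a.P b := by
      rw [map_sub, (a.symm_eq hw.2).2.1, sub_left_inj]
    rw [← h2, h1, eq_sub_iff_add_eq']
  have hfib : ∀ w ∈ a.dom, ∀ v, vertDeriv f (w.1, v) = vertDeriv f (w.1, a.inv w z₀.2) ↔
      v - a.inv w z₀.2 ∈ nullSpace f (w.1, a.inv w z₀.2) := fun w hw v =>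
    h.fibre_eq_of_isPreconnected (hΩ w hw)
      (hconn (w.1, vertDeriv f (w.1, a.inv w z₀.2)) ⟨hΩ w hw, _, rfl⟩) rfl v
  have hα1 : ∀ w ∈ a.dom, ∀ b,
      vertDeriv f (w.1, α (w, b)) = vertDeriv f (w.1, a.inv w z₀.2) := fun w hw b =>
    (hfib w hw _).2 ((hα w hw b _).1 rfl).1
  have hα2 : ∀ w ∈ legImage f Ω ∩ a.dom, vertDeriv f (w.1, a.inv w z₀.2) = w.2 := fun w hw =>
    a.vertDeriv_inv hw.2.2 hw.1 hw.2.1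
  refine ⟨a.P, a.dom, α, a.isOpen_dom, a.legMap_mem_dom, hΩ, ?_,
    fun w hw b => ((hα w hw b _).1 rfl).2, ?_, ?_, ?_⟩
  · have hc : ContDiff ℝ ∞ fun w : E × (J →L[ℝ] ℝ) => a.coord w z₀.2 :=
      a.contDiff_coord.comp (contDiff_id.prodMk contDiff_const)
    have h1 : ContDiffOn ℝ ∞ (fun x : (E × (J →L[ℝ] ℝ)) × J =>
        fderiv ℝ a.e.symm (a.coord x.1 z₀.2)) (a.dom ×ˢ univ) :=
      (a.smooth_symm.fderiv_of_isOpen a.e.open_target (m := ∞) (by simp)).comp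
        (hc.comp contDiff_fst).contDiffOn fun x hx => hx.1.2
    have h2 : ContDiff ℝ ∞ fun x : (E × (J →L[ℝ] ℝ)) × J => ((0 : E), a.P x.2 - a.P z₀.2) :=
      contDiff_const.prodMk ((a.P.contDiff.comp contDiff_snd).sub contDiff_const)
    exact ((a.contDiffOn_inv z₀.2).comp contDiffOn_fst fun x hx => hx.1.2).add
      (h1.clm_apply h2.contDiffOn).snd
  · intro w hw b s hs
    rw [hα1 w hw]
    exact a.ι_eq_iff.1 (a.symm_eq hw.2).2.2 s hs
  · intro w hw b
    rw [hα1 w hw.2, hα2 w hw]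
  · intro z hz hzU
    have hmem := legMap_mem_legImage (f := f) hz
    exact (hα _ hzU _ _).2 ⟨(hfib _ hzU _).1 (hα2 _ ⟨hmem, hzU⟩).symm, rfl⟩

end IsRegularFamily
end LocalSections

section Charts
open Set Module
set_option linter.unusedSectionVars false

theorem fderiv_vertical_smul {E J V D : Type*} [NormedAddCommGroup E] [NormedSpace ℝ E]
    [NormedAddCommGroup J] [NormedSpace ℝ J] [NormedAddCommGroup V] [NormedSpace ℝ V]
    [NormedAddCommGroup D] [NormedSpace ℝ D] {f : E × J → ℝ} {y : E} {v : J}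
    (hf : DifferentiableAt ℝ f (y, v)) (T : V →L[ℝ] J) (d : D) (σ : V) :
    fderiv ℝ (fun σ => f (y, v + T σ) • d) 0 σ = vertDeriv f (y, v) (T σ) • d := by
  have h1 : HasFDerivAt (fun σ : V => (y, v + T σ)) ((0 : V →L[ℝ] E).prod T) 0 :=
    (hasFDerivAt_const y _).prodMk (T.hasFDerivAt.const_add _)
  have h2 : HasFDerivAt f (fderiv ℝ f (y, v)) (y, v + T 0) := by
    rw [map_zero, add_zero]
    exact hf.hasFDerivAt
  have h3 := ((h2.comp (0 : V) h1).smul_const d).fderiv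
  simp only [Function.comp_def] at h3
  rw [h3]
  rfl

/-! ### Densities -/

variable {n m : ℕ}

theorem stdVol_apply (v : Fin n → Eu n) :
    stdVol n v = (EuclideanSpace.basisFun (Fin n) ℝ).toBasis.det v := rfl

theorem stdVol_unitVec : stdVol n (fun k => unitVec k) = 1 := by
  rw [stdVol_apply]
  have h : (fun k : Fin n => unitVec k) = (EuclideanSpace.basisFun (Fin n) ℝ).toBasis := by
    ext k; simp
  rw [h, Module.Basis.det_self]

theorem Dens.eq_smul_stdVol (D : Dens n) : D = D (fun k => unitVec k) • stdVol n := by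
  have h := AlternatingMap.eq_smul_basis_det (EuclideanSpace.basisFun (Fin n) ℝ).toBasis
    D.toAlternatingMap
  ext v
  have h1 := DFunLike.congr_fun h v
  have h2 : ((EuclideanSpace.basisFun (Fin n) ℝ).toBasis : Fin n → Eu n) =
      fun k : Fin n => unitVec k := by
    ext k; simp
  rw [h2] at h1
  exact h1

theorem Dens.ext_unitVec {D D' : Dens n} (h : D (fun k => unitVec k) = D' fun k => unitVec k) :
    D = D' := by
  rw [D.eq_smul_stdVol, D'.eq_smul_stdVol, h]

/-! ### Fibred charts -/

variable {X : Type*} [TopologicalSpace X] [ChartedSpace (Eu n) X]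
variable {Y : Type*} [TopologicalSpace Y] [ChartedSpace (Eu n × Eu m) Y]
variable {π : FibredManifold n m X Y}

theorem FibredManifold.exists_fibredChart [IsManifold 𝓘(ℝ, Eu n × Eu m) ∞ Y]
    (π : FibredManifold n m X Y) (y : Y) : ∃ c : FibredChart π, y ∈ c.total.source := by
  obtain ⟨F, _, _, hF⟩ := π.submersion
  have h := hF y
  let A := h.equiv
  have hfin : FiniteDimensional ℝ F := by
    refine FiniteDimensional.of_injective (A.symm.toLinearMap ∘ₗ LinearMap.inr ℝ (Eu n) F) ?_
    exact A.symm.injective.comp LinearMap.inr_injective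
  have hdim : finrank ℝ F = finrank ℝ (Eu m) := by
    have h1 := A.toLinearEquiv.finrank_eq
    rw [finrank_prod, finrank_prod] at h1
    omega
  let A' : (Eu n × Eu m) ≃L[ℝ] (Eu n × Eu m) :=
    A.trans ((ContinuousLinearEquiv.refl ℝ (Eu n)).prodCongr (ContinuousLinearEquiv.ofFinrankEq hdim))
  have hmem : h.domChart.transHomeomorph A'.toHomeomorph ∈
      IsManifold.maximalAtlas 𝓘(ℝ, Eu n × Eu m) ∞ Y := by
    refine OpenPartialHomeomorph.mem_maximalAtlas_of_contMDiffOn _ ?_ ?_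
    · exact A'.contDiff.contMDiff.comp_contMDiffOn
        (contMDiffOn_of_mem_maximalAtlas h.domChart_mem_maximalAtlas)
    · exact (contMDiffOn_symm_of_mem_maximalAtlas h.domChart_mem_maximalAtlas).comp
        A'.symm.contDiff.contMDiff.contMDiffOn fun x hx => hx
  refine ⟨⟨h.codChart, h.domChart.transHomeomorph A'.toHomeomorph, h.codChart_mem_maximalAtlas,
    hmem, fun z hz => h.source_subset_preimage_source hz, fun z hz => ?_⟩,
    h.mem_domChart_source⟩
  have hz' : z ∈ h.domChart.source := hz
  have hz'' : h.domChart z ∈ (h.domChart.extend 𝓘(ℝ, Eu n × Eu m)).target := by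
    simpa using h.domChart.map_source hz'
  have h1 := h.writtenInCharts hz''
  simp only [Function.comp_apply, OpenPartialHomeomorph.extend_coe,
    OpenPartialHomeomorph.extend_coe_symm, modelWithCornersSelf_coe, modelWithCornersSelf_coe_symm,
    id, h.domChart.left_inv hz'] at h1
  exact h1

namespace FibredChart

variable (c : FibredChart π)

/-- The density `dx^1 ∧ ... ∧ dx^n` at `x`. -/
def vol (x : X) : Dens n := (stdVol n).compContinuousLinearMap (c.dbase x)

section Base
variable [IsManifold 𝓘(ℝ, Eu n) ∞ X]

theorem base_mdifferentiable : c.base.MDifferentiable 𝓘(ℝ, Eu n) 𝓘(ℝ, Eu n) :=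
  ⟨(contMDiffOn_of_mem_maximalAtlas c.base_mem).mdifferentiableOn (by simp),
    (contMDiffOn_symm_of_mem_maximalAtlas c.base_mem).mdifferentiableOn (by simp)⟩

theorem dbase_dbaseInv {x : X} (hx : x ∈ c.base.source) (v : Eu n) :
    c.dbase x (c.dbaseInv x v) = v := by
  have := c.base_mdifferentiable.comp_symm_deriv (c.base.map_source hx)
  rw [c.base.left_inv hx] at this
  exact DFunLike.congr_fun this v

theorem dbaseInv_dbase {x : X} (hx : x ∈ c.base.source) (v : Eu n) :
    c.dbaseInv x (c.dbase x v) = v :=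
  DFunLike.congr_fun (c.dbaseInv_comp_dbase hx) v

theorem vol_baseFrame {x : X} (hx : x ∈ c.base.source) : c.vol x (c.baseFrame x) = 1 := by
  rw [← stdVol_unitVec (n := n)]
  simp only [vol, ContinuousAlternatingMap.compContinuousLinearMap_apply]
  congr 1
  ext1 k
  exact c.dbase_dbaseInv hx _

theorem dens_eq {x : X} (hx : x ∈ c.base.source) (D : Dens n) :
    D = D (c.baseFrame x) • c.vol x := by
  have h := Dens.eq_smul_stdVol (D.compContinuousLinearMap (c.dbaseInv x))
  ext v
  have h1 := DFunLike.congr_fun h fun k => c.dbase x (v k)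
  simp only [ContinuousAlternatingMap.compContinuousLinearMap_apply, Function.comp_def,
    c.dbaseInv_dbase hx] at h1
  exact h1

end Base

variable [IsManifold 𝓘(ℝ, Eu n) ∞ X] [IsManifold 𝓘(ℝ, Eu n × Eu m) ∞ Y]

theorem total_mdifferentiable :
    c.total.MDifferentiable 𝓘(ℝ, Eu n × Eu m) 𝓘(ℝ, Eu n × Eu m) :=
  ⟨(contMDiffOn_of_mem_maximalAtlas c.total_mem).mdifferentiableOn (by simp),
    (contMDiffOn_symm_of_mem_maximalAtlas c.total_mem).mdifferentiableOn (by simp)⟩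

variable {y : Y} (hy : y ∈ c.total.source)

include hy in
theorem dtotal_dtotalInv (v : Eu n × Eu m) : c.dtotal y (c.dtotalInv y v) = v :=
  DFunLike.congr_fun (c.dtotal_comp_dtotalInv hy) v

include hy in
theorem dtotalInv_dtotal (v : Eu n × Eu m) : c.dtotalInv y (c.dtotal y v) = v :=
  DFunLike.congr_fun (c.total_mdifferentiable.symm_comp_deriv hy) v

include hy in
theorem dproj_apply (v : Eu n × Eu m) :
    dproj π y v = c.dbaseInv (π.proj y) (c.dtotal y v).1 :=
  DFunLike.congr_fun (c.dproj_eq hy) v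

include hy in
theorem dtotal_fst (v : Eu n × Eu m) :
    (c.dtotal y v).1 = c.dbase (π.proj y) (dproj π y v) := by
  rw [c.dproj_apply hy, c.dbase_dbaseInv (c.mapsTo y hy)]

theorem vertOf_apply (A : JetCoef n m) (v : Eu n) :
    (c.vertOf y hy A).1 v = c.dtotalInv y (0, A (c.dbase (π.proj y) v)) := rfl

variable (y) in
/-- The coordinates `σ^i_λ` of `σ ∈ T^*X ⊗ V_yY`. -/
def vertCoord : VertHom π y →L[ℝ] JetCoef n m :=
  (ContinuousLinearMap.compL ℝ (Eu n) (Eu n × Eu m) (Eu m)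
      (ContinuousLinearMap.snd ℝ (Eu n) (Eu m) ∘L c.dtotal y)) ∘L
    ((ContinuousLinearMap.compL ℝ (Eu n) (Eu n) (Eu n × Eu m)).flip (c.dbaseInv (π.proj y))) ∘L
    (VertHom π y).subtypeL

theorem vertCoord_apply (σ : VertHom π y) (v : Eu n) :
    c.vertCoord y σ v = (c.dtotal y (σ.1 (c.dbaseInv (π.proj y) v))).2 := rfl

theorem vertCoord_vertOf (A : JetCoef n m) : c.vertCoord y (c.vertOf y hy A) = A := by
  ext1 v
  rw [vertCoord_apply, vertOf_apply, c.dtotal_dtotalInv hy, c.dbase_dbaseInv (c.mapsTo y hy)]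

theorem vertOf_vertCoord (σ : VertHom π y) : c.vertOf y hy (c.vertCoord y σ) = σ := by
  apply Subtype.ext
  ext1 v
  rw [vertOf_apply, vertCoord_apply, c.dbaseInv_dbase (c.mapsTo y hy)]
  have h : (c.dtotal y (σ.1 v)).1 = 0 := by
    have hσ : dproj π y (σ.1 v) = 0 := DFunLike.congr_fun (show dproj π y ∘L σ.1 = 0 from σ.2) v
    rw [c.dtotal_fst hy, hσ, map_zero]
  rw [← h]
  exact c.dtotalInv_dtotal hy _

/-- The fibre coordinates `y^i_λ` of a jet over `y`. -/
def jetCoef (ℓ : JetAt π y) : JetCoef n m := (c.jetCoord ⟨y, ℓ⟩).2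

theorem jetCoef_apply (ℓ : JetAt π y) (v : Eu n) :
    c.jetCoef ℓ v = (c.dtotal y (ℓ.1 (c.dbaseInv (π.proj y) v))).2 := rfl

theorem jetCoord_eq (ℓ : JetAt π y) : c.jetCoord ⟨y, ℓ⟩ = (c.total y, c.jetCoef ℓ) := rfl

theorem jetAt_apply (A : JetCoef n m) (v : Eu n) : (c.jetAt y hy A).1 v =
    c.dtotalInv y (c.dbase (π.proj y) v, A (c.dbase (π.proj y) v)) := rfl

theorem jetCoef_jetAt (A : JetCoef n m) : c.jetCoef (c.jetAt y hy A) = A := by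
  ext1 v
  rw [jetCoef_apply, jetAt_apply, c.dtotal_dtotalInv hy, c.dbase_dbaseInv (c.mapsTo y hy)]

theorem jetAt_jetCoef (ℓ : JetAt π y) : c.jetAt y hy (c.jetCoef ℓ) = ℓ := by
  apply Subtype.ext
  ext1 v
  rw [jetAt_apply, jetCoef_apply, c.dbaseInv_dbase (c.mapsTo y hy)]
  have h : (c.dtotal y (ℓ.1 v)).1 = c.dbase (π.proj y) v := by
    rw [c.dtotal_fst hy]
    exact congrArg _ (DFunLike.congr_fun ℓ.2 v)
  rw [← h]
  exact c.dtotalInv_dtotal hy _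

include hy in
theorem jetCoef_injective : Function.Injective (c.jetCoef : JetAt π y → JetCoef n m) :=
  fun ℓ ℓ' h => by rw [← c.jetAt_jetCoef hy ℓ, h, c.jetAt_jetCoef hy]

theorem jetCoef_translate (ℓ : JetAt π y) (σ : VertHom π y) :
    c.jetCoef (ℓ.translate σ) = c.jetCoef ℓ + c.vertCoord y σ := by
  ext1 v
  rw [add_apply, jetCoef_apply, jetCoef_apply, vertCoord_apply, ← Prod.snd_add,
    ← map_add]
  rfl

end FibredChart

/-- The difference of two jets over the same point. -/
def JetAt.diff {y : Y} (ℓ ℓ' : JetAt π y) : VertHom π y :=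
  ⟨ℓ.1 - ℓ'.1, by
    change dproj π y ∘L _ = 0
    rw [ContinuousLinearMap.comp_sub, ℓ.2, ℓ'.2, sub_self]⟩

namespace FibredChart

variable (c : FibredChart π)
variable [IsManifold 𝓘(ℝ, Eu n) ∞ X] [IsManifold 𝓘(ℝ, Eu n × Eu m) ∞ Y]
variable {y : Y}

theorem vertCoord_diff (ℓ ℓ' : JetAt π y) :
    c.vertCoord y (ℓ.diff ℓ') = c.jetCoef ℓ - c.jetCoef ℓ' := by
  ext1 v
  rw [sub_apply, jetCoef_apply, jetCoef_apply, vertCoord_apply, ← Prod.snd_sub, ← map_sub]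
  rfl

/-- The fibre coordinates `p^λ_i` of a momentum over `y`. -/
def momCoef (hy : y ∈ c.total.source) (μ : VertHom π y →L[ℝ] Dens n) : MomCoef n m :=
  ContinuousAlternatingMap.apply ℝ (Eu n) ℝ (c.baseFrame (π.proj y)) ∘L μ ∘L c.vertOf y hy

theorem momCoef_apply (hy : y ∈ c.total.source) (μ : VertHom π y →L[ℝ] Dens n) (A : JetCoef n m) :
    c.momCoef hy μ A = μ (c.vertOf y hy A) (c.baseFrame (π.proj y)) := rfl

theorem momCoord_mk (hy : y ∈ c.total.source) (μ : VertHom π y →L[ℝ] Dens n) :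
    c.momCoord ⟨y, μ⟩ = (c.total y, c.momCoef hy μ) := by
  unfold momCoord
  exact dif_pos hy

variable (y) in
/-- The momentum over `y` with fibre coordinates `q`. -/
def momAt (q : MomCoef n m) : VertHom π y →L[ℝ] Dens n :=
  (q ∘L c.vertCoord y).smulRight (c.vol (π.proj y))

theorem momAt_apply (q : MomCoef n m) (σ : VertHom π y) :
    c.momAt y q σ = q (c.vertCoord y σ) • c.vol (π.proj y) := rfl

theorem momOf_eq (v : MomModel n m) : c.momOf v = ⟨c.total.symm v.1, c.momAt _ v.2⟩ := rfl

theorem momCoef_momAt (hy : y ∈ c.total.source) (q : MomCoef n m) :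
    c.momCoef hy (c.momAt y q) = q := by
  ext1 A
  rw [momCoef_apply, momAt_apply, c.vertCoord_vertOf hy, ContinuousAlternatingMap.smul_apply,
    c.vol_baseFrame (c.mapsTo y hy), smul_eq_mul, mul_one]

theorem momAt_momCoef (hy : y ∈ c.total.source) (μ : VertHom π y →L[ℝ] Dens n) :
    c.momAt y (c.momCoef hy μ) = μ := by
  ext1 σ
  rw [momAt_apply, momCoef_apply, c.vertOf_vertCoord hy]
  exact (c.dens_eq (c.mapsTo y hy) _).symm

theorem momOf_total (hy : y ∈ c.total.source) (q : MomCoef n m) :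
    c.momOf (c.total y, q) = ⟨y, c.momAt y q⟩ := by
  have h : ∀ y', y' = y → (⟨y', c.momAt y' q⟩ : Momentum π) = ⟨y, c.momAt y q⟩ := by
    rintro _ rfl; rfl
  exact h _ (c.total.left_inv hy)

theorem momCoord_momOf {v : MomModel n m} (hv : v.1 ∈ c.total.target) :
    c.momCoord (c.momOf v) = v := by
  rw [momOf_eq, c.momCoord_mk (c.total.map_target hv), c.momCoef_momAt, c.total.right_inv hv]

theorem momOf_momCoord {p : Momentum π} (hp : p.pt ∈ c.total.source) :
    c.momOf (c.momCoord p) = p := by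
  obtain ⟨y, μ⟩ := p
  rw [c.momCoord_mk hp, c.momOf_total hp, c.momAt_momCoef]

theorem momCoord_fst {p : Momentum π} (hp : p.pt ∈ c.total.source) :
    (c.momCoord p).1 = c.total p.pt := by
  obtain ⟨y, μ⟩ := p
  rw [c.momCoord_mk hp]

theorem momCoord_mem_momDom {U : Set (Momentum π)} {p : Momentum π} (hp : p.pt ∈ c.total.source) :
    c.momCoord p ∈ c.momDom U ↔ p ∈ U := by
  change _ ∧ _ ↔ _
  rw [c.momOf_momCoord hp, c.momCoord_fst hp]
  exact and_iff_right (c.total.map_source hp)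

end FibredChart

/-! ### The Lagrangian and the Legendre morphism in coordinates -/

/-- The component of the Legendre morphism in the fibre of `Π`. -/
def legendreMom (L : Jet π → Dens n) {y : Y} (ℓ : JetAt π y) : VertHom π y →L[ℝ] Dens n :=
  fderiv ℝ (fun σ : VertHom π y => L ⟨y, ℓ.translate σ⟩) 0

theorem legendre_mk (L : Jet π → Dens n) {y : Y} (ℓ : JetAt π y) :
    legendre L ⟨y, ℓ⟩ = ⟨y, legendreMom L ℓ⟩ := rfl

namespace FibredChart

variable (c : FibredChart π)
variable [IsManifold 𝓘(ℝ, Eu n) ∞ X] [IsManifold 𝓘(ℝ, Eu n × Eu m) ∞ Y]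
variable {y : Y}

variable {L : Jet π → Dens n}

theorem lag_total (hy : y ∈ c.total.source) (A : JetCoef n m) :
    c.lag L (c.total y, A) = L ⟨y, c.jetAt y hy A⟩ (c.baseFrame (π.proj y)) := by
  have h : ∀ (y' : Y) (hy' : y' ∈ c.total.source), y' = y →
      L ⟨y', c.jetAt y' hy' A⟩ (c.baseFrame (π.proj y')) =
        L ⟨y, c.jetAt y hy A⟩ (c.baseFrame (π.proj y)) := by
    rintro _ _ rfl; rfl
  rw [lag, dif_pos (c.total.map_source hy)]
  exact h _ (c.total.map_target (c.total.map_source hy)) (c.total.left_inv hy)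

theorem lag_jetCoord (hy : y ∈ c.total.source) (ℓ : JetAt π y) :
    c.lag L (c.jetCoord ⟨y, ℓ⟩) = L ⟨y, ℓ⟩ (c.baseFrame (π.proj y)) := by
  rw [jetCoord_eq, c.lag_total hy, c.jetAt_jetCoef hy]

theorem isOpen_jetDom : IsOpen {v : JetModel n m | v.1 ∈ c.total.target} :=
  c.total.open_target.preimage continuous_fst

theorem differentiableAt_lag (hL : IsLagrangianDensity L) {v : JetModel n m}
    (hv : v.1 ∈ c.total.target) : DifferentiableAt ℝ (c.lag L) v :=
  ((hL c).contDiffAt (c.isOpen_jetDom.mem_nhds hv)).differentiableAt (by simp)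

theorem momCoef_legendre (hL : IsLagrangianDensity L) (hy : y ∈ c.total.source) (ℓ : JetAt π y) :
    c.momCoef hy (legendreMom L ℓ) = vertDeriv (c.lag L) (c.jetCoord ⟨y, ℓ⟩) := by
  have h1 : (fun σ : VertHom π y => L ⟨y, ℓ.translate σ⟩) = fun σ =>
      c.lag L (c.total y, c.jetCoef ℓ + c.vertCoord y σ) • c.vol (π.proj y) := by
    ext1 σ
    rw [← jetCoef_translate, ← jetCoord_eq, c.lag_jetCoord hy]
    exact c.dens_eq (c.mapsTo y hy) _
  ext1 A
  rw [momCoef_apply]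
  have h2 : DifferentiableAt ℝ (c.lag L) (c.total y, c.jetCoef ℓ) :=
    c.differentiableAt_lag hL (c.total.map_source hy)
  have h3 := fderiv_vertical_smul h2 (c.vertCoord y) (c.vol (π.proj y)) (c.vertOf y hy A)
  rw [legendreMom, h1]
  refine (congrArg (fun D : Dens n => D (c.baseFrame (π.proj y))) h3).trans ?_
  simp only [c.vertCoord_vertOf hy, ContinuousAlternatingMap.smul_apply,
    c.vol_baseFrame (c.mapsTo y hy), smul_eq_mul, mul_one]
  rfl

theorem momCoord_legendre (hL : IsLagrangianDensity L) {z : Jet π} (hz : z.pt ∈ c.total.source) :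
    c.momCoord (legendre L z) = legMap (c.lag L) (c.jetCoord z) := by
  obtain ⟨y, ℓ⟩ := z
  rw [legendre_mk, c.momCoord_mk hz, c.momCoef_legendre hL hz]
  rfl

end FibredChart
end Charts

section LagrangianInCharts
open Set Module
set_option linter.unusedSectionVars false

variable {n m : ℕ}
variable {X : Type*} [TopologicalSpace X] [ChartedSpace (Eu n) X]
variable {Y : Type*} [TopologicalSpace Y] [ChartedSpace (Eu n × Eu m) Y]
variable {π : FibredManifold n m X Y}
variable [IsManifold 𝓘(ℝ, Eu n) ∞ X] [IsManifold 𝓘(ℝ, Eu n × Eu m) ∞ Y]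
variable {L : Jet π → Dens n}

namespace FibredChart

variable (c : FibredChart π)

theorem jetCoord_jetOf {v : JetModel n m} (hv : v.1 ∈ c.total.target) :
    c.jetCoord (c.jetOf v hv) = v := by
  unfold jetOf
  rw [c.jetCoord_eq, c.jetCoef_jetAt, c.total.right_inv hv]

theorem momDom_constraintSpace (hL : IsLagrangianDensity L) :
    c.momDom (constraintSpace L) = legImage (c.lag L) c.total.target := by
  ext ⟨u, q⟩
  constructor
  · rintro ⟨hu, z, hz⟩
    have hu : u ∈ c.total.target := hu
    have hpt : z.pt = c.total.symm u := congrArg Momentum.pt hz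
    have hzs : z.pt ∈ c.total.source := hpt ▸ c.total.map_target hu
    have h1 := c.momCoord_legendre hL hzs
    rw [hz, c.momCoord_momOf hu] at h1
    have h2 : c.jetCoord z = (u, (c.jetCoord z).2) :=
      Prod.ext (by change c.total z.pt = u; rw [hpt, c.total.right_inv hu]) rfl
    refine ⟨hu, (c.jetCoord z).2, ?_⟩
    rw [← h2]
    exact (congrArg Prod.snd h1).symm
  · rintro ⟨hu, A, hA⟩
    have hu : u ∈ c.total.target := hu
    have hA : vertDeriv (c.lag L) (u, A) = q := hA
    refine ⟨hu, c.jetOf (u, A) hu, ?_⟩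
    have h1 := c.momCoord_legendre hL (z := c.jetOf (u, A) hu) (c.total.map_target hu)
    rw [c.jetCoord_jetOf] at h1
    rw [← c.momOf_momCoord (p := legendre L (c.jetOf (u, A) hu)) (c.total.map_target hu), h1,
      legMap, hA]

theorem legendreCoord_eq (hL : IsLagrangianDensity L) {v : JetModel n m}
    (hv : v.1 ∈ c.total.target) : c.legendreCoord L v = legMap (c.lag L) v := by
  unfold legendreCoord
  rw [dif_pos hv, c.momCoord_legendre hL (c.total.map_target hv), c.jetCoord_jetOf]

/-- In fibred coordinates an almost regular Lagrangian density is an almost regular function. -/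
theorem isRegularFamily (hL : IsLagrangianDensity L) (hreg : IsAlmostRegular L) :
    IsRegularFamily (c.lag L) c.total.target where
  isOpen := c.total.open_target
  smooth := hL c
  slice := by
    intro z hz
    obtain ⟨χ, K, hχ, hslice⟩ := hreg.submanifold c (legMap (c.lag L) z)
      (by rw [c.momDom_constraintSpace hL]; exact legMap_mem_legImage hz)
    refine ⟨χ, K, hχ, c.momDom_constraintSpace hL ▸ hslice, fun z' hz' hs' => ?_⟩
    have h1 := hreg.submersion c (c.jetOf z' hz') (c.total.map_target hz') χ K hslice
      (by rw [c.momCoord_legendre hL (c.total.map_target hz'), c.jetCoord_jetOf]; exact hs')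
    rw [c.jetCoord_jetOf] at h1
    rw [← h1]
    congr 2
    refine Filter.EventuallyEq.fderiv_eq ?_
    filter_upwards [c.isOpen_jetDom.mem_nhds hz'] with x hx
    simp only [Function.comp_apply, c.legendreCoord_eq hL hx]

/-- The fibres of the Legendre map in coordinates are connected if `L` is semiregular. -/
theorem isPreconnected_fibre (hL : IsLagrangianDensity L) (hsemi : IsSemiregular L)
    {w : MomModel n m} (hw : w ∈ legImage (c.lag L) c.total.target) :
    IsPreconnected {A | vertDeriv (c.lag L) (w.1, A) = w.2} := by
  have hw' := hw
  rw [← c.momDom_constraintSpace hL] at hw'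
  have hy := c.total.map_target hw.1
  have h1 := (hsemi _ hw'.2).1.isPreconnected
  let T : (Eu n →L[ℝ] (Eu n × Eu m)) →L[ℝ] JetCoef n m :=
    (ContinuousLinearMap.compL ℝ (Eu n) (Eu n × Eu m) (Eu m)
      (ContinuousLinearMap.snd ℝ (Eu n) (Eu m) ∘L c.dtotal (c.total.symm w.1))) ∘L
    ((ContinuousLinearMap.compL ℝ (Eu n) (Eu n) (Eu n × Eu m)).flip
      (c.dbaseInv (π.proj (c.total.symm w.1))))
  have h2 := h1.image T T.continuous.continuousOn
  convert h2 using 1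
  ext A
  constructor
  · intro hA
    have hA : vertDeriv (c.lag L) (w.1, A) = w.2 := hA
    refine ⟨(c.jetAt _ hy A).1, ⟨c.jetAt _ hy A, rfl, ?_⟩, c.jetCoef_jetAt hy A⟩
    have h3 := c.momCoord_legendre hL (z := c.jetOf (w.1, A) hw.1) hy
    rw [c.jetCoord_jetOf] at h3
    have h4 := c.momOf_momCoord (p := legendre L (c.jetOf (w.1, A) hw.1)) hy
    rw [h3, legMap, hA] at h4
    exact h4.symm
  · rintro ⟨_, ⟨(ℓ : JetAt π (c.total.symm w.1)), rfl, hℓ⟩, rfl⟩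
    have hℓ' : legendre L ⟨c.total.symm w.1, ℓ⟩ = c.momOf w := hℓ
    have h3 := c.momCoord_legendre hL (z := ⟨c.total.symm w.1, ℓ⟩) hy
    rw [hℓ', c.momCoord_momOf hw.1, c.jetCoord_eq, c.total.right_inv hw.1] at h3
    exact (congrArg Prod.snd h3).symm

end FibredChart

end LagrangianInCharts

/-! ### Changes of coordinates -/

section Transitions
open Set Module

theorem contDiffOn_transition {V M : Type*} [NormedAddCommGroup V] [NormedSpace ℝ V]
    [TopologicalSpace M] [ChartedSpace V M] {e e' : OpenPartialHomeomorph M V}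
    (he : e ∈ IsManifold.maximalAtlas 𝓘(ℝ, V) ∞ M)
    (he' : e' ∈ IsManifold.maximalAtlas 𝓘(ℝ, V) ∞ M) :
    ContDiffOn ℝ ∞ (e ∘ e'.symm) {u | u ∈ e'.target ∧ e'.symm u ∈ e.source} := by
  rw [← contMDiffOn_iff_contDiffOn]
  exact (contMDiffOn_of_mem_maximalAtlas he).comp
    ((contMDiffOn_symm_of_mem_maximalAtlas he').mono fun u hu => hu.1) fun u hu => hu.2

theorem isOpen_transition {V M : Type*} [TopologicalSpace V] [TopologicalSpace M]
    (e e' : OpenPartialHomeomorph M V) : IsOpen {u | u ∈ e'.target ∧ e'.symm u ∈ e.source} :=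
  e'.symm.isOpen_inter_preimage e.open_source

theorem mfderiv_comp_mfderiv_symm {V M : Type*} [NormedAddCommGroup V] [NormedSpace ℝ V]
    [TopologicalSpace M] [ChartedSpace V M] {e e' : OpenPartialHomeomorph M V}
    (he : e ∈ IsManifold.maximalAtlas 𝓘(ℝ, V) ∞ M)
    (he' : e' ∈ IsManifold.maximalAtlas 𝓘(ℝ, V) ∞ M) {x : M} (hx : x ∈ e.source)
    (hx' : x ∈ e'.source) (v : V) :
    (mfderiv 𝓘(ℝ, V) 𝓘(ℝ, V) e x : V →L[ℝ] V)
      ((mfderiv 𝓘(ℝ, V) 𝓘(ℝ, V) e'.symm (e' x) : V →L[ℝ] V) v) =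
        fderiv ℝ (e ∘ e'.symm) (e' x) v := by
  have h1 : MDifferentiableAt 𝓘(ℝ, V) 𝓘(ℝ, V) e (e'.symm (e' x)) := by
    rw [e'.left_inv hx']
    exact (contMDiffAt_of_mem_maximalAtlas he hx).mdifferentiableAt (by simp)
  have h2 : MDifferentiableAt 𝓘(ℝ, V) 𝓘(ℝ, V) e'.symm (e' x) :=
    (contMDiffAt_symm_of_mem_maximalAtlas he' (e'.map_source hx')).mdifferentiableAt (by simp)
  have h3 := mfderiv_comp (e' x) h1 h2
  rw [mfderiv_eq_fderiv] at h3
  rw [h3, e'.left_inv hx']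
  rfl

end Transitions

section CoordinateChange
open Set Module
set_option linter.unusedSectionVars false

variable {n m : ℕ}
variable {X : Type*} [TopologicalSpace X] [ChartedSpace (Eu n) X]
variable {Y : Type*} [TopologicalSpace Y] [ChartedSpace (Eu n × Eu m) Y]
variable {π : FibredManifold n m X Y}
variable [IsManifold 𝓘(ℝ, Eu n) ∞ X] [IsManifold 𝓘(ℝ, Eu n × Eu m) ∞ Y]

namespace FibredChart

variable (c c' : FibredChart π)

/-- The Jacobian of the change of the coordinates of `Y` from `c` to `c'`. -/
def totalJac (u : Eu n × Eu m) : (Eu n × Eu m) →L[ℝ] (Eu n × Eu m) :=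
  fderiv ℝ (c'.total ∘ c.total.symm) u

/-- The Jacobian of the change of the coordinates of `X` from `c` to `c'`. -/
def baseJac (u : Eu n) : Eu n →L[ℝ] Eu n := fderiv ℝ (c'.base ∘ c.base.symm) u

/-- The domain, in the coordinates of `c`, of the change of coordinates from `c` to `c'`. -/
def changeDom : Set (Eu n × Eu m) := {u | u ∈ c.total.target ∧ c.total.symm u ∈ c'.total.source}

theorem isOpen_changeDom : IsOpen (c.changeDom c') := isOpen_transition c'.total c.total

theorem contDiffOn_change : ContDiffOn ℝ ∞ (c'.total ∘ c.total.symm) (c.changeDom c') :=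
  contDiffOn_transition c'.total_mem c.total_mem

theorem contDiffOn_totalJac : ContDiffOn ℝ ∞ (c.totalJac c') (c.changeDom c') :=
  (c.contDiffOn_change c').fderiv_of_isOpen (c.isOpen_changeDom c') (by simp)

theorem base_symm_fst {u : Eu n × Eu m} (hu : u ∈ c.total.target) :
    c.base (π.proj (c.total.symm u)) = u.1 := by
  rw [c.fibred _ (c.total.map_target hu), c.total.right_inv hu]

theorem contDiffOn_baseJac :
    ContDiffOn ℝ ∞ (fun u : Eu n × Eu m => c.baseJac c' u.1) (c.changeDom c') := by
  have h : ContDiffOn ℝ ∞ (c.baseJac c')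
      {u | u ∈ c.base.target ∧ c.base.symm u ∈ c'.base.source} :=
    (contDiffOn_transition c'.base_mem c.base_mem).fderiv_of_isOpen
      (isOpen_transition c'.base c.base) (by simp)
  refine h.comp contDiffOn_fst fun u hu => ?_
  have h1 := c.mapsTo _ (c.total.map_target hu.1)
  have h2 := c'.mapsTo _ hu.2
  rw [mem_ofPred_eq, ← c.base_symm_fst hu.1, c.base.left_inv h1]
  exact ⟨c.base.map_source h1, h2⟩

theorem mapsTo_change : MapsTo (c'.total ∘ c.total.symm) (c.changeDom c') (c'.changeDom c) := by
  intro u hu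
  refine ⟨c'.total.map_source hu.2, ?_⟩
  rw [Function.comp_apply, c'.total.left_inv hu.2]
  exact c.total.map_target hu.1

variable {y : Y} (hy : y ∈ c.total.source) (hy' : y ∈ c'.total.source)
include hy hy'

theorem dtotal_dtotalInv_eq (v : Eu n × Eu m) :
    c'.dtotal y (c.dtotalInv y v) = c.totalJac c' (c.total y) v :=
  mfderiv_comp_mfderiv_symm c'.total_mem c.total_mem hy' hy v

theorem dbase_dbaseInv_eq (v : Eu n) :
    c'.dbase (π.proj y) (c.dbaseInv (π.proj y) v) = c.baseJac c' (c.total y).1 v := by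
  rw [← c.fibred y hy]
  exact mfderiv_comp_mfderiv_symm c'.base_mem c.base_mem (c'.mapsTo y hy') (c.mapsTo y hy) v

theorem jetCoef_change (ℓ : JetAt π y) : c'.jetCoef ℓ =
    ContinuousLinearMap.snd ℝ (Eu n) (Eu m) ∘L c.totalJac c' (c.total y) ∘L
      ((ContinuousLinearMap.id ℝ (Eu n)).prod (c.jetCoef ℓ)) ∘L c'.baseJac c (c'.total y).1 := by
  ext1 v
  rw [jetCoef_apply]
  conv_lhs => rw [← c.jetAt_jetCoef hy ℓ]
  rw [c.jetAt_apply hy, c.dtotal_dtotalInv_eq c' hy hy', c'.dbase_dbaseInv_eq c hy' hy]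
  rfl

theorem vertCoord_change (A : JetCoef n m) : c'.vertCoord y (c.vertOf y hy A) =
    ContinuousLinearMap.snd ℝ (Eu n) (Eu m) ∘L c.totalJac c' (c.total y) ∘L
      ContinuousLinearMap.inr ℝ (Eu n) (Eu m) ∘L A ∘L c'.baseJac c (c'.total y).1 := by
  ext1 v
  rw [vertCoord_apply, vertOf_apply, c.dtotal_dtotalInv_eq c' hy hy',
    c'.dbase_dbaseInv_eq c hy' hy]
  rfl

theorem vol_change : c'.vol (π.proj y) (c.baseFrame (π.proj y)) =
    stdVol n fun k => c.baseJac c' (c.total y).1 (unitVec k) := by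
  simp only [vol, ContinuousAlternatingMap.compContinuousLinearMap_apply]
  congr 1
  ext1 k
  exact c.dbase_dbaseInv_eq c' hy hy' _

omit hy hy'

/-- The change of momentum coordinates is smooth. -/
theorem contDiffOn_momChange : ContDiffOn ℝ ∞ (fun v : MomModel n m => c'.momCoord (c.momOf v))
    {v | v.1 ∈ c.changeDom c'} := by
  have hfst : MapsTo (Prod.fst : MomModel n m → _) {v | v.1 ∈ c.changeDom c'} (c.changeDom c') :=
    fun v hv => hv
  have hg : ContDiffOn ℝ ∞ (fun v : MomModel n m => c'.total (c.total.symm v.1))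
      {v | v.1 ∈ c.changeDom c'} := (c.contDiffOn_change c').comp contDiffOn_fst hfst
  have hg' : MapsTo (fun v : MomModel n m => c'.total (c.total.symm v.1))
      {v | v.1 ∈ c.changeDom c'} (c'.changeDom c) := fun v hv => c.mapsTo_change c' hv
  have h1 : ContDiffOn ℝ ∞ (fun v : MomModel n m => c'.totalJac c (c'.total (c.total.symm v.1)))
      {v | v.1 ∈ c.changeDom c'} := (c'.contDiffOn_totalJac c).comp hg hg'
  have h2 : ContDiffOn ℝ ∞ (fun v : MomModel n m => c.baseJac c' v.1.1)
      {v | v.1 ∈ c.changeDom c'} := (c.contDiffOn_baseJac c').comp contDiffOn_fst hfst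
  have h3 : ContDiffOn ℝ ∞
      (fun v : MomModel n m => c'.baseJac c (c'.total (c.total.symm v.1)).1)
      {v | v.1 ∈ c.changeDom c'} := (c'.contDiffOn_baseJac c).comp hg hg'
  have h4 : ContDiffOn ℝ ∞ (fun v : MomModel n m => stdVol n fun k =>
      c'.baseJac c (c'.total (c.total.symm v.1)).1 (unitVec k)) {v | v.1 ∈ c.changeDom c'} :=
    (stdVol n).toContinuousMultilinearMap.contDiff.comp_contDiffOn
      (contDiffOn_pi.2 fun k => h3.clm_apply contDiffOn_const)
  have h5 : ∀ A : JetCoef n m, ContDiffOn ℝ ∞ (fun v : MomModel n m =>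
      ContinuousLinearMap.snd ℝ (Eu n) (Eu m) ∘L c'.totalJac c (c'.total (c.total.symm v.1)) ∘L
        ContinuousLinearMap.inr ℝ (Eu n) (Eu m) ∘L A ∘L c.baseJac c' v.1.1)
      {v | v.1 ∈ c.changeDom c'} := fun A =>
    contDiffOn_const.clm_comp (h1.clm_comp (contDiffOn_const.clm_comp
      (contDiffOn_const.clm_comp h2)))
  have h6 : ContDiffOn ℝ ∞ (fun v : MomModel n m => (c'.momCoord (c.momOf v)).2)
      {v | v.1 ∈ c.changeDom c'} := by
    rw [contDiffOn_clm_apply]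
    intro A
    refine ((contDiffOn_snd.clm_apply (h5 A)).mul h4).congr fun v hv => ?_
    have hy := c.total.map_target hv.1
    rw [momOf_eq, c'.momCoord_mk hv.2, momCoef_apply, momAt_apply,
      c'.vertCoord_change c hv.2 hy, ContinuousAlternatingMap.smul_apply,
      c'.vol_change c hv.2 hy, c.total.right_inv hv.1, smul_eq_mul]
  refine (hg.prodMk h6).congr fun v hv => Prod.ext ?_ rfl
  exact c'.momCoord_fst (p := c.momOf v) hv.2

/-- Smoothness of a field of jets in one chart implies smoothness in another chart. -/
theorem contDiffOn_jetCoef_change {Φ : ∀ p : Momentum π, JetAt π p.pt} {s : Set (MomModel n m)}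
    (hs : ∀ v ∈ s, v.1 ∈ c.changeDom c')
    (h : ContDiffOn ℝ ∞ (fun v => c'.jetCoef (Φ (c.momOf v))) s) :
    ContDiffOn ℝ ∞ (fun v => c.jetCoef (Φ (c.momOf v))) s := by
  have hg : ContDiffOn ℝ ∞ (fun v : MomModel n m => c'.total (c.total.symm v.1)) s :=
    (c.contDiffOn_change c').comp contDiffOn_fst hs
  have h1 : ContDiffOn ℝ ∞ (fun v : MomModel n m => c'.totalJac c (c'.total (c.total.symm v.1))) s :=
    (c'.contDiffOn_totalJac c).comp hg fun v hv => c.mapsTo_change c' (hs v hv)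
  have h2 : ContDiffOn ℝ ∞ (fun v : MomModel n m => c.baseJac c' v.1.1) s :=
    (c.contDiffOn_baseJac c').comp contDiffOn_fst hs
  have h3 : ContDiffOn ℝ ∞ (fun v =>
      (ContinuousLinearMap.id ℝ (Eu n)).prod (c'.jetCoef (Φ (c.momOf v)))) s := by
    rw [contDiffOn_clm_apply]
    intro A
    exact contDiffOn_const.prodMk (h.clm_apply contDiffOn_const)
  refine (contDiffOn_const (c := ContinuousLinearMap.snd ℝ (Eu n) (Eu m)).clm_comp
    (h1.clm_comp (h3.clm_comp h2))).congr fun v hv => ?_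
  have hv' := hs v hv
  have := c'.jetCoef_change c (y := c.total.symm v.1) hv'.2 (c.total.map_target hv'.1)
    (Φ (c.momOf v))
  rw [c.total.right_inv hv'.1] at this
  exact this

/-- The set of momenta whose coordinates lie in `U`. -/
def momSet (U : Set (MomModel n m)) : Set (Momentum π) :=
  {p | p.pt ∈ c.total.source ∧ c.momCoord p ∈ U}

theorem isOpen_momSet {U : Set (MomModel n m)} (hU : IsOpen U) : IsOpen (c.momSet U) := by
  intro c'
  have h1 : IsOpen {v : MomModel n m | v.1 ∈ c'.changeDom c} :=
    (c'.isOpen_changeDom c).preimage continuous_fst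
  have h2 := (c'.contDiffOn_momChange c).continuousOn.isOpen_inter_preimage h1 hU
  have h3 : c'.momDom (c.momSet U) = {v : MomModel n m | v.1 ∈ c'.changeDom c} ∩
      (fun v => c.momCoord (c'.momOf v)) ⁻¹' U := by
    ext v
    exact ⟨fun h => ⟨⟨h.1, h.2.1⟩, h.2.2⟩, fun h => ⟨h.1.1, h.1.2, h.2⟩⟩
  rw [h3]
  exact h2

/-- A smooth map in one chart defines a momentum morphism. -/
theorem isMomentumMorphism_of_chart {U : Set (MomModel n m)} {Φ : ∀ p : Momentum π, JetAt π p.pt}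
    {φ : MomModel n m → JetCoef n m} (hφ : ContDiffOn ℝ ∞ φ U)
    (hΦ : ∀ p ∈ c.momSet U, c.jetCoef (Φ p) = φ (c.momCoord p)) :
    IsMomentumMorphism (c.momSet U) Φ := by
  intro c'
  refine c'.contDiffOn_jetCoef_change c (fun v hv => ⟨hv.1, hv.2.1⟩) ?_
  have h0 : ∀ v ∈ c'.momDom (c.momSet U), v.1 ∈ c'.changeDom c := fun v hv => ⟨hv.1, hv.2.1⟩
  have h1 : ContDiffOn ℝ ∞ (fun v => c.momCoord (c'.momOf v)) (c'.momDom (c.momSet U)) :=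
    (c'.contDiffOn_momChange c).mono h0
  exact (hφ.comp h1 fun v hv => hv.2.2).congr fun v hv => hΦ _ hv.2

end FibredChart
end CoordinateChange

/-! ### Hamiltonian forms and their momentum morphisms -/

section Calculus

variable {E J : Type*} [NormedAddCommGroup E] [NormedSpace ℝ E]
  [NormedAddCommGroup J] [NormedSpace ℝ J]

/-- The derivative of `p φ(y, p) - f (y, φ(y, p))`, the coordinate form of a Hamiltonian. -/
theorem fderiv_pairing_sub {f : E × J → ℝ} {φ : E × (J →L[ℝ] ℝ) → J}
    {φ' : E × (J →L[ℝ] ℝ) →L[ℝ] J} {v : E × (J →L[ℝ] ℝ)} (hφ : HasFDerivAt φ φ' v)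
    (hf : DifferentiableAt ℝ f (v.1, φ v)) (δ : E × (J →L[ℝ] ℝ)) :
    fderiv ℝ (fun v => v.2 (φ v) - f (v.1, φ v)) v δ =
      δ.2 (φ v) + v.2 (φ' δ) - fderiv ℝ f (v.1, φ v) (δ.1, φ' δ) := by
  have h1 : HasFDerivAt (fun v : E × (J →L[ℝ] ℝ) => v.2) (ContinuousLinearMap.snd ℝ _ _) v :=
    hasFDerivAt_snd
  have h2 : HasFDerivAt (fun v : E × (J →L[ℝ] ℝ) => v.1) (ContinuousLinearMap.fst ℝ _ _) v :=
    hasFDerivAt_fst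
  have h3 := HasFDerivAt.comp v (g := f) (f := fun v => (v.1, φ v)) hf.hasFDerivAt (h2.prodMk hφ)
  have h4 := ((h1.clm_apply hφ).sub h3).fderiv
  refine (DFunLike.congr_fun h4 δ).trans ?_
  change v.2 (φ' δ) + δ.2 (φ v) - fderiv ℝ f (v.1, φ v) (δ.1, φ' δ) = _
  rw [add_comm (v.2 _)]

/-- If `p` and `q` agree on the increments of `φ` along the second factor, then they agree on its
partial derivatives. -/
theorem apply_fderiv_vertical_eq {φ : E × (J →L[ℝ] ℝ) → J} {φ' : E × (J →L[ℝ] ℝ) →L[ℝ] J}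
    {v : E × (J →L[ℝ] ℝ)} (hφ : HasFDerivAt φ φ' v)
    {S : Set (E × (J →L[ℝ] ℝ))} (hS : IsOpen S) (hv : v ∈ S) (p q : J →L[ℝ] ℝ)
    (hq : ∀ w, (v.1, w) ∈ S → p (φ (v.1, w) - φ v) = q (φ (v.1, w) - φ v)) (η : J →L[ℝ] ℝ) :
    p (φ' (0, η)) = q (φ' (0, η)) := by
  have h1 : HasDerivAt (fun t : ℝ => v + t • ((0 : E), η)) (0, η) 0 := by
    simpa using ((hasDerivAt_id (0 : ℝ)).smul_const ((0 : E), η)).const_add v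
  have h2 : HasFDerivAt φ φ' (v + (0 : ℝ) • ((0 : E), η)) := by simpa using hφ
  have h4 := (p - q).hasFDerivAt.comp_hasDerivAt (0 : ℝ) (h2.comp_hasDerivAt (0 : ℝ) h1)
  have h5 : ∀ᶠ t in 𝓝 (0 : ℝ), v + t • ((0 : E), η) ∈ S :=
    h1.continuousAt (by simpa using hS.mem_nhds hv)
  rw [← sub_eq_zero]
  refine h4.unique ((hasDerivAt_const (0 : ℝ) ((p - q) (φ v))).congr_of_eventuallyEq ?_)
  filter_upwards [h5] with t ht
  have h6 : v + t • ((0 : E), η) = (v.1, v.2 + t • η) := by ext <;> simp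
  rw [Function.comp_apply, Function.comp_apply, ← sub_eq_zero, ← map_sub]
  rw [h6] at ht ⊢
  exact sub_eq_zero.2 (hq _ ht)

end Calculus

section HamiltonianForms
open Set Module
set_option linter.unusedSectionVars false

variable {n m : ℕ}

theorem stdVol_update_unitVec (k : Fin n) (w : Eu n) :
    stdVol n (Function.update (fun j => unitVec j) k w) = w k := by
  have h1 : w = ∑ j : Fin n, w j • (unitVec j : Eu n) := by
    conv_lhs => rw [← (EuclideanSpace.basisFun (Fin n) ℝ).sum_repr w]
    simp
  have h2 : ∀ j : Fin n, stdVol n (Function.update (fun j => unitVec j) k (unitVec j)) =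
      if j = k then 1 else 0 := by
    intro j
    split_ifs with hj
    · subst hj
      rw [Function.update_eq_self j (fun j : Fin n => (unitVec j : Eu n)), stdVol_unitVec]
    · exact (stdVol n).toAlternatingMap.map_update_self (fun j => unitVec j) (Ne.symm hj)
  have h3 : stdVol n (Function.update (fun j => unitVec j) k (∑ j : Fin n, w j • (unitVec j : Eu n)))
      = ∑ j : Fin n, w j • stdVol n (Function.update (fun j => unitVec j) k (unitVec j)) := by
    have := (stdVol n).toMultilinearMap.map_update_sum Finset.univ k
      (fun j : Fin n => w j • (unitVec j : Eu n)) (fun j => unitVec j)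
    refine this.trans (Finset.sum_congr rfl fun j _ => ?_)
    exact (stdVol n).toMultilinearMap.map_update_smul _ _ _ _
  conv_lhs => rw [h1]
  rw [h3]
  simp [h2]

variable {X : Type*} [TopologicalSpace X] [ChartedSpace (Eu n) X]
variable {Y : Type*} [TopologicalSpace Y] [ChartedSpace (Eu n × Eu m) Y]
variable {π : FibredManifold n m X Y}

theorem JetAt.dproj_apply {y : Y} (ℓ : JetAt π y) (v : Eu n) : dproj π y (ℓ.1 v) = v :=
  DFunLike.congr_fun ℓ.2 v

theorem JetAt.tensorVert_apply {y : Y} (ℓ : JetAt π y) (α : Eu n →L[ℝ] ℝ) (v : Eu n × Eu m)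
    (a : Eu n) : (ℓ.tensorVert α v).1 a = α a • (v - ℓ.1 (dproj π y v)) := rfl

/-- The decomposition `ℓ - ℓ' = dx^k ⊗ (ℓ - ℓ') e_k`. -/
theorem JetAt.sum_tensorVert {y : Y} (ℓ ℓ' : JetAt π y) :
    ∑ k : Fin n, ℓ'.tensorVert (EuclideanSpace.proj k) (ℓ.1 (unitVec k)) = ℓ.diff ℓ' := by
  apply Subtype.ext
  ext1 a
  have h1 : a = ∑ j : Fin n, a j • (unitVec j : Eu n) := by
    conv_lhs => rw [← (EuclideanSpace.basisFun (Fin n) ℝ).sum_repr a]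
    simp
  rw [AddSubmonoidClass.coe_finsetSum, sum_apply]
  conv_rhs => rw [h1, map_sum]
  refine Finset.sum_congr rfl fun k _ => ?_
  rw [JetAt.tensorVert_apply, ℓ.dproj_apply, map_smul]
  rfl

theorem Momentum.contraction_apply (p : Momentum π) (ℓ : JetAt π p.pt) (v : Eu n × Eu m)
    (k : Fin n) : p.contraction ℓ v k =
      p.mom (ℓ.tensorVert (EuclideanSpace.proj k) v) fun j => unitVec j := by
  simp [Momentum.contraction, Pi.single_apply]

theorem formOfMorphism_apply (Φ : ∀ p : Momentum π, JetAt π p.pt) (p : Momentum π)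
    (v : Fin n → Eu n × Eu m) : formOfMorphism Φ p v = ∑ k : Fin n, stdVol n
      (Function.update (fun j => dproj π p.pt (v j)) k (p.contraction (Φ p) (v k))) := by
  change (stdVol n).fderivCompContinuousLinearMap (dproj π p.pt) (p.contraction (Φ p)) v = _
  rw [ContinuousAlternatingMap.fderivCompContinuousLinearMap_apply]
  refine Finset.sum_congr rfl fun k _ => ?_
  congr 1
  ext1 j
  by_cases hj : j = k
  · subst hj; simp
  · simp [hj]

/-- The pullback of `H_Φ` by a jet `ℓ` is the value of the momentum on the vertical part
`ℓ - Φ`; the sum in the definition of `H_Φ` becomes a trace. -/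
theorem formOfMorphism_pullback (Φ : ∀ p : Momentum π, JetAt π p.pt) (p : Momentum π)
    (ℓ : JetAt π p.pt) :
    (formOfMorphism Φ p).compContinuousLinearMap ℓ.1 = p.mom (ℓ.diff (Φ p)) := by
  apply Dens.ext_unitVec
  rw [ContinuousAlternatingMap.compContinuousLinearMap_apply, formOfMorphism_apply,
    ← JetAt.sum_tensorVert, map_sum, ContinuousAlternatingMap.sum_apply]
  refine Finset.sum_congr rfl fun k _ => ?_
  simp only [Function.comp_apply, ℓ.dproj_apply]
  rw [stdVol_update_unitVec, Momentum.contraction_apply]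

theorem formOfLagrangian_pullback (L : Jet π → Dens n) (Φ : ∀ p : Momentum π, JetAt π p.pt)
    (p : Momentum π) (ℓ : JetAt π p.pt) :
    (formOfLagrangian L Φ p).compContinuousLinearMap ℓ.1 =
      p.mom (ℓ.diff (Φ p)) + L ⟨p.pt, Φ p⟩ := by
  rw [← formOfMorphism_pullback]
  ext v
  have h : ∀ v, dproj π p.pt (ℓ.1 v) = v := ℓ.dproj_apply
  simp only [formOfLagrangian, ContinuousAlternatingMap.compContinuousLinearMap_apply,
    ContinuousAlternatingMap.add_apply, Function.comp_def, h]

theorem formOfLagrangian_semibasic (L : Jet π → Dens n) (Φ : ∀ p : Momentum π, JetAt π p.pt)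
    (p : Momentum π) (v : Fin n → Eu n × Eu m) (i j : Fin n) (hij : i ≠ j)
    (hi : dproj π p.pt (v i) = 0) (hj : dproj π p.pt (v j) = 0) : formOfLagrangian L Φ p v = 0 := by
  have h1 : formOfMorphism Φ p v = 0 := by
    rw [formOfMorphism_apply]
    refine Finset.sum_eq_zero fun k _ => ?_
    by_cases hk : i = k
    · exact (stdVol n).map_coord_zero j (by
        rw [Function.update_of_ne (fun h => hij (hk.trans h.symm)), hj])
    · exact (stdVol n).map_coord_zero i (by rw [Function.update_of_ne hk, hi])
  have h2 : (L ⟨p.pt, Φ p⟩).compContinuousLinearMap (dproj π p.pt) v = 0 :=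
    (L ⟨p.pt, Φ p⟩).map_coord_zero i hi
  rw [formOfLagrangian, ContinuousAlternatingMap.add_apply, h1, h2, add_zero]

variable [IsManifold 𝓘(ℝ, Eu n) ∞ X] [IsManifold 𝓘(ℝ, Eu n × Eu m) ∞ Y]
variable {L : Jet π → Dens n} {U : Set (Momentum π)} {Φ : ∀ p : Momentum π, JetAt π p.pt}

/-- The values of `Φ` over one point of `Y` differ by elements on which `p` and `L̂ (Φ p)` agree.
Infinitesimally this says `(p - L̂ ∘ Φ) · ∂Φ/∂p = 0`, which is the condition that `Φ` is
the momentum morphism of `H_{LΦ}`. -/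
def IsFlat (L : Jet π → Dens n) (U : Set (Momentum π)) (Φ : ∀ p : Momentum π, JetAt π p.pt) : Prop :=
  ∀ (y : Y) (μ μ' : VertHom π y →L[ℝ] Dens n), (⟨y, μ⟩ : Momentum π) ∈ U →
    (⟨y, μ'⟩ : Momentum π) ∈ U →
      μ ((Φ ⟨y, μ'⟩).diff (Φ ⟨y, μ⟩)) = legendreMom L (Φ ⟨y, μ⟩) ((Φ ⟨y, μ'⟩).diff (Φ ⟨y, μ⟩))

namespace FibredChart

variable (c : FibredChart π)

theorem momCoef_sub {y : Y} (hy : y ∈ c.total.source) (μ : VertHom π y →L[ℝ] Dens n)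
    (ℓ ℓ' : JetAt π y) :
    c.momCoef hy μ (c.jetCoef ℓ - c.jetCoef ℓ') = μ (ℓ.diff ℓ') (c.baseFrame (π.proj y)) := by
  rw [momCoef_apply, ← c.vertCoord_diff, c.vertOf_vertCoord]

theorem isFlat_iff (hL : IsLagrangianDensity L) {y : Y} (hy : y ∈ c.total.source)
    (μ : VertHom π y →L[ℝ] Dens n) (ℓ ℓ' : JetAt π y) :
    μ (ℓ'.diff ℓ) = legendreMom L ℓ (ℓ'.diff ℓ) ↔
      c.momCoef hy μ (c.jetCoef ℓ' - c.jetCoef ℓ) =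
        vertDeriv (c.lag L) (c.total y, c.jetCoef ℓ) (c.jetCoef ℓ' - c.jetCoef ℓ) := by
  rw [← c.jetCoord_eq, ← c.momCoef_legendre hL hy, c.momCoef_sub, c.momCoef_sub]
  refine ⟨fun h => by rw [h], fun h => ?_⟩
  rw [c.dens_eq (c.mapsTo y hy) (μ _), h, ← c.dens_eq (c.mapsTo y hy)]

theorem totalFrame_eq {y : Y} (hy : y ∈ c.total.source) :
    c.totalFrame y = fun k => (c.jetAt y hy 0).1 (c.baseFrame (π.proj y) k) := by
  ext1 k
  rw [c.jetAt_apply hy, baseFrame, c.dbase_dbaseInv (c.mapsTo y hy)]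
  rfl

/-- The left side is the value of `H_{LΦ}` on the coordinate frame `∂_λ` of `Y`, which is the image of
the frame of `X` under the jet with coordinates `0`. -/
theorem pullback_zero_jet_eq {u : Eu n × Eu m} (hu : u ∈ c.total.target)
    (q : MomCoef n m) (ℓ : JetAt π (c.total.symm u)) :
    c.momAt (c.total.symm u) q
        ((c.jetAt (c.total.symm u) (c.total.map_target hu) 0).diff ℓ)
        (c.baseFrame (π.proj (c.total.symm u))) +
      L ⟨c.total.symm u, ℓ⟩ (c.baseFrame (π.proj (c.total.symm u))) =
      -(q (c.jetCoef ℓ) - c.lag L (u, c.jetCoef ℓ)) := by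
  have hy : c.total.symm u ∈ c.total.source := c.total.map_target hu
  have h2 := c.lag_jetCoord (L := L) hy ℓ
  rw [c.jetCoord_eq, c.total.right_inv hu] at h2
  have h3 := c.momCoef_sub hy (c.momAt _ q) (c.jetAt (c.total.symm u) hy 0) ℓ
  rw [c.momCoef_momAt, c.jetCoef_jetAt, zero_sub, map_neg] at h3
  rw [← h2, ← h3]
  ring

/-- In coordinates, `ℋ = p^λ_i Φ^i_λ - 𝓛 ∘ Φ` for the Hamiltonian form `H_{LΦ}`. -/
theorem hamiltonian_formOfLagrangian {v : MomModel n m} (hv : v.1 ∈ c.total.target) :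
    c.hamiltonian (formOfLagrangian L Φ) v =
      v.2 (c.jetCoef (Φ (c.momOf v))) - c.lag L (v.1, c.jetCoef (Φ (c.momOf v))) := by
  have hy : c.total.symm v.1 ∈ c.total.source := c.total.map_target hv
  have h0 := formOfLagrangian_pullback L Φ (c.momOf v) (c.jetAt (c.total.symm v.1) hy 0)
  have h1 : formOfLagrangian L Φ (c.momOf v) (c.totalFrame (c.total.symm v.1)) =
      -(v.2 (c.jetCoef (Φ (c.momOf v))) - c.lag L (v.1, c.jetCoef (Φ (c.momOf v)))) := by
    rw [c.totalFrame_eq hy]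
    exact (DFunLike.congr_fun h0 (c.baseFrame (π.proj (c.total.symm v.1)))).trans
      (c.pullback_zero_jet_eq hv v.2 (Φ (c.momOf v)))
  rw [hamiltonian, h1, neg_neg]

theorem isOpen_momDom (hU : IsOpen U) : IsOpen (c.momDom U) := hU c

theorem hasFDerivAt_hamiltonian (hL : IsLagrangianDensity L) (hU : IsOpen U)
    (hΦ : IsMomentumMorphism U Φ) {v : MomModel n m} (hv : v ∈ c.momDom U) :
    ∃ φ' : MomModel n m →L[ℝ] JetCoef n m,
      HasFDerivAt (fun v => c.jetCoef (Φ (c.momOf v))) φ' v ∧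
      ∀ δ, fderiv ℝ (c.hamiltonian (formOfLagrangian L Φ)) v δ =
        δ.2 (c.jetCoef (Φ (c.momOf v))) + v.2 (φ' δ) -
          fderiv ℝ (c.lag L) (v.1, c.jetCoef (Φ (c.momOf v))) (δ.1, φ' δ) := by
  have hφ := ((hΦ c).contDiffAt ((c.isOpen_momDom hU).mem_nhds hv)).differentiableAt (by simp)
  refine ⟨_, hφ.hasFDerivAt, fun δ => ?_⟩
  have h5 : c.hamiltonian (formOfLagrangian L Φ) =ᶠ[𝓝 v] fun v =>
      v.2 (c.jetCoef (Φ (c.momOf v))) - c.lag L (v.1, c.jetCoef (Φ (c.momOf v))) := by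
    filter_upwards [(c.isOpen_momDom hU).mem_nhds hv] with x hx
    exact c.hamiltonian_formOfLagrangian hx.1
  rw [h5.fderiv_eq]
  exact fderiv_pairing_sub hφ.hasFDerivAt (c.differentiableAt_lag hL hv.1) δ

/-- Flatness in the infinitesimal form `(p - ∂𝓛/∂v) ∂Φ/∂p = 0`. -/
theorem _root_.Multimomentum.IsFlat.apply_fderiv_eq (hL : IsLagrangianDensity L) (hU : IsOpen U)
    (hflat : IsFlat L U Φ) {v : MomModel n m} (hv : v ∈ c.momDom U)
    {φ' : MomModel n m →L[ℝ] JetCoef n m}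
    (hφ' : HasFDerivAt (fun v => c.jetCoef (Φ (c.momOf v))) φ' v) (η : MomCoef n m) :
    v.2 (φ' (0, η)) =
      vertDeriv (c.lag L) (v.1, c.jetCoef (Φ (c.momOf v))) (φ' (0, η)) := by
  have key : ∀ q', (v.1, q') ∈ c.momDom U →
      v.2 (c.jetCoef (Φ (c.momOf (v.1, q'))) - c.jetCoef (Φ (c.momOf v))) =
      vertDeriv (c.lag L) (v.1, c.jetCoef (Φ (c.momOf v)))
        (c.jetCoef (Φ (c.momOf (v.1, q'))) - c.jetCoef (Φ (c.momOf v))) := by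
    intro q' ht
    have h7 := (c.isFlat_iff hL (c.total.map_target hv.1) (c.momAt _ v.2) _ _).1
      (hflat _ (c.momAt (c.total.symm v.1) v.2) (c.momAt (c.total.symm v.1) q') hv.2 ht.2)
    rw [c.momCoef_momAt, c.total.right_inv hv.1] at h7
    exact h7
  exact apply_fderiv_vertical_eq (φ := fun v => c.jetCoef (Φ (c.momOf v))) hφ'
    (c.isOpen_momDom hU) hv v.2 (vertDeriv (c.lag L) (v.1, c.jetCoef (Φ (c.momOf v)))) key η

/-- A flat momentum morphism is the momentum morphism of its Hamiltonian form `H_{LΦ}`. -/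
theorem _root_.Multimomentum.IsFlat.isMorphismOfForm (hL : IsLagrangianDensity L) (hU : IsOpen U)
    (hΦ : IsMomentumMorphism U Φ) (hflat : IsFlat L U Φ) :
    IsMorphismOfForm U (formOfLagrangian L Φ) Φ := by
  intro c p hp hpt l i
  have hpv : c.momOf (c.momCoord p) = p := c.momOf_momCoord hpt
  have hv : c.momCoord p ∈ c.momDom U := (c.momCoord_mem_momDom hpt).2 hp
  generalize c.momCoord p = v at hv hpv
  subst hpv
  obtain ⟨φ', hφ', hder⟩ := c.hasFDerivAt_hamiltonian hL hU hΦ hv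
  have hzero := hflat.apply_fderiv_eq c hL hU hv hφ' (momUnit l i)
  rw [hder]
  have h8 : fderiv ℝ (c.lag L) (v.1, c.jetCoef (Φ (c.momOf v))) (0, φ' (0, momUnit l i)) =
      vertDeriv (c.lag L) (v.1, c.jetCoef (Φ (c.momOf v))) (φ' (0, momUnit l i)) := rfl
  simp only
  rw [h8, hzero, add_sub_cancel_right]
  rfl

end FibredChart

theorem isHamiltonianForm_formOfLagrangian (hL : IsLagrangianDensity L)
    (hΦ : IsMomentumMorphism U Φ) : IsHamiltonianForm U (formOfLagrangian L Φ) where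
  semibasic := fun p _ => formOfLagrangian_semibasic L Φ p
  linearPart := by
    intro p _ ℓ σ
    rw [formOfLagrangian_pullback, formOfLagrangian_pullback]
    have h : (ℓ.translate σ).diff (Φ p) = ℓ.diff (Φ p) + σ :=
      Subtype.ext (add_sub_right_comm ℓ.1 σ.1 (Φ p).1)
    rw [h, map_add, add_right_comm]
  smooth := by
    intro c
    have h1 : ContDiffOn ℝ ∞ (fun v => c.jetCoef (Φ (c.momOf v))) (c.momDom U) := hΦ c
    have h2 : ContDiffOn ℝ ∞ (fun v : MomModel n m => v.2 (c.jetCoef (Φ (c.momOf v))))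
      (c.momDom U) := contDiffOn_snd.clm_apply h1
    have h3 : ContDiffOn ℝ ∞ (fun v : MomModel n m => c.lag L (v.1, c.jetCoef (Φ (c.momOf v))))
      (c.momDom U) := (hL c).comp (contDiffOn_fst.prodMk h1) fun v hv => hv.1
    exact (h2.sub h3).congr fun v hv => c.hamiltonian_formOfLagrangian hv.1

theorem isAssociatedForm_formOfLagrangian (hL : IsLagrangianDensity L) (hU : IsOpen U)
    (hΦ : IsMomentumMorphism U Φ) (hflat : IsFlat L U Φ) (hass : IsAssociatedMorphism L U Φ) :
    IsAssociatedForm L U (formOfLagrangian L Φ) :=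
  ⟨isHamiltonianForm_formOfLagrangian hL hΦ, Φ, hΦ, hflat.isMorphismOfForm hL hU hΦ, hass,
    fun _ _ => rfl⟩

end HamiltonianForms

/-! ### Momentum morphisms given in one chart -/

section ChartMorphism
open Set Module
set_option linter.unusedSectionVars false

variable {n m : ℕ}
variable {X : Type*} [TopologicalSpace X] [ChartedSpace (Eu n) X]
variable {Y : Type*} [TopologicalSpace Y] [ChartedSpace (Eu n × Eu m) Y]
variable {π : FibredManifold n m X Y}
variable [IsManifold 𝓘(ℝ, Eu n) ∞ X] [IsManifold 𝓘(ℝ, Eu n × Eu m) ∞ Y]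

instance JetAt.nonempty (y : Y) : Nonempty (JetAt π y) := by
  obtain ⟨c, hc⟩ := π.exists_fibredChart y
  exact ⟨c.jetAt y hc 0⟩

namespace FibredChart

variable (c : FibredChart π)

open Classical in
/-- The field of jets with components `φ` in the chart `c`; its values outside the domain of the
chart are arbitrary. -/
def morphism (φ : MomModel n m → JetCoef n m) (p : Momentum π) : JetAt π p.pt :=
  if hp : p.pt ∈ c.total.source then c.jetAt p.pt hp (φ (c.momCoord p)) else Classical.arbitrary _

theorem jetCoef_morphism (φ : MomModel n m → JetCoef n m) {p : Momentum π}
    (hp : p.pt ∈ c.total.source) : c.jetCoef (c.morphism φ p) = φ (c.momCoord p) := by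
  rw [morphism, dif_pos hp, c.jetCoef_jetAt]

variable {L : Jet π → Dens n} {U : Set (MomModel n m)} {φ : MomModel n m → JetCoef n m}

theorem isMomentumMorphism_morphism (hφ : ContDiffOn ℝ ∞ φ U) :
    IsMomentumMorphism (c.momSet U) (c.morphism φ) :=
  c.isMomentumMorphism_of_chart hφ fun _ hp => c.jetCoef_morphism φ hp.1

theorem isFlat_morphism (hL : IsLagrangianDensity L) {P : JetCoef n m →L[ℝ] JetCoef n m}
    (hP : ∀ u q q', (u, q) ∈ U → (u, q') ∈ U → P (φ (u, q)) = P (φ (u, q')))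
    (hker : ∀ w ∈ U, ∀ a, P a = 0 → vertDeriv (c.lag L) (w.1, φ w) a = w.2 a) :
    IsFlat L (c.momSet U) (c.morphism φ) := by
  intro y μ μ' hμ hμ'
  have hy : y ∈ c.total.source := hμ.1
  have h1 : c.jetCoef (c.morphism φ ⟨y, μ⟩) = φ (c.total y, c.momCoef hy μ) := by
    rw [c.jetCoef_morphism φ hy, c.momCoord_mk hy]
  have h2 : c.jetCoef (c.morphism φ ⟨y, μ'⟩) = φ (c.total y, c.momCoef hy μ') := by
    rw [c.jetCoef_morphism φ hy, c.momCoord_mk hy]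
  have h3 := hμ.2
  have h4 := hμ'.2
  rw [c.momCoord_mk hy] at h3 h4
  refine (c.isFlat_iff hL hy μ _ _).2 ?_
  rw [h1, h2]
  exact (hker _ h3 _ (by rw [map_sub, hP _ _ _ h4 h3, sub_self])).symm

theorem legendre_morphism (hL : IsLagrangianDensity L) {p : Momentum π} (hp : p.pt ∈ c.total.source)
    (h : vertDeriv (c.lag L) ((c.momCoord p).1, φ (c.momCoord p)) = (c.momCoord p).2) :
    legendre L ⟨p.pt, c.morphism φ p⟩ = p := by
  have h1 := c.momCoord_legendre hL (z := ⟨p.pt, c.morphism φ p⟩) hp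
  rw [c.jetCoord_eq, c.jetCoef_morphism φ hp, ← c.momCoord_fst hp] at h1
  have h2 : c.momCoord (legendre L ⟨p.pt, c.morphism φ p⟩) = c.momCoord p :=
    h1.trans (Prod.ext rfl h)
  exact (c.momOf_momCoord (p := legendre L ⟨p.pt, c.morphism φ p⟩) hp).symm.trans
    ((congrArg c.momOf h2).trans (c.momOf_momCoord hp))

theorem isAssociatedMorphism_morphism (hL : IsLagrangianDensity L)
    (hφ : ∀ w ∈ legImage (c.lag L) c.total.target ∩ U, vertDeriv (c.lag L) (w.1, φ w) = w.2) :
    IsAssociatedMorphism L (c.momSet U) (c.morphism φ) := by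
  intro p hp
  refine c.legendre_morphism hL hp.2.1 (hφ _ ⟨?_, hp.2.2⟩)
  rw [← c.momDom_constraintSpace hL]
  exact (c.momCoord_mem_momDom hp.2.1).2 hp.1

theorem legendre_mem_momSet (hL : IsLagrangianDensity L) {z : Jet π} (hz : z.pt ∈ c.total.source) :
    legendre L z ∈ c.momSet U ↔ legMap (c.lag L) (c.jetCoord z) ∈ U := by
  rw [← c.momCoord_legendre hL hz]
  exact and_iff_right hz

end FibredChart

/-- Near each point of the constraint space there is a flat momentum morphism associated with `L`. -/
theorem exists_local_flat_morphism {L : Jet π → Dens n} (hL : IsLagrangianDensity L)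
    (hreg : IsAlmostRegular L) {q : Momentum π} (hq : q ∈ constraintSpace L) :
    ∃ U : Set (Momentum π), IsOpen U ∧ q ∈ U ∧ ∃ Φ : ∀ p : Momentum π, JetAt π p.pt,
      IsMomentumMorphism U Φ ∧ IsAssociatedMorphism L U Φ ∧ IsFlat L U Φ := by
  obtain ⟨z, rfl⟩ := hq
  obtain ⟨c, hc⟩ := π.exists_fibredChart z.pt
  obtain ⟨P, U, φ, hU, hz, -, hφ, hP, hker, hass⟩ :=
    (c.isRegularFamily hL hreg).exists_local_section (z₀ := c.jetCoord z) (c.total.map_source hc)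
  exact ⟨c.momSet U, c.isOpen_momSet hU, (c.legendre_mem_momSet hL hc).2 hz, c.morphism φ,
    c.isMomentumMorphism_morphism hφ, c.isAssociatedMorphism_morphism hL hass,
    c.isFlat_morphism hL (P := P) (fun u q q' h h' => (hP _ h).trans (hP _ h').symm) hker⟩

end ChartMorphism

/-! ### Extension of smooth functions -/

section Cutoff
open Set

/-- A smooth function on an open set `W` extends to an open set `O` after shrinking `W` to a
neighbourhood of a subset `W \ V` that is closed in `O`. -/
theorem exists_contDiffOn_extension {E F : Type*} [NormedAddCommGroup E] [NormedSpace ℝ E]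
    [FiniteDimensional ℝ E] [NormedAddCommGroup F] [NormedSpace ℝ F] {O W V : Set E}
    (hO : IsOpen O) (hW : IsOpen W) (hV : IsOpen V) (hcov : O ⊆ W ∪ V) {b : E → F}
    (hb : ContDiffOn ℝ ∞ b W) :
    ∃ (b' : E → F) (W' : Set E), ContDiffOn ℝ ∞ b' O ∧ IsOpen W' ∧ W' ⊆ W ∧ O \ V ⊆ W' ∧
      ∀ x ∈ W', b' x = b x := by
  obtain ⟨f, hfs, hf, hf0⟩ := hW.exists_contDiff_support_eq (n := ⊤)
  obtain ⟨g, hgs, hg, hg0⟩ := hV.exists_contDiff_support_eq (n := ⊤)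
  have hf' : ∀ x, x ∈ W ↔ f x ≠ 0 := fun x => by rw [← hfs, Function.mem_support]
  have hg' : ∀ x, x ∈ V ↔ g x ≠ 0 := fun x => by rw [← hgs, Function.mem_support]
  have hfn : ∀ x, 0 ≤ f x := fun x => (hf0 ⟨x, rfl⟩).1
  have hgn : ∀ x, 0 ≤ g x := fun x => (hg0 ⟨x, rfl⟩).1
  have hpos : ∀ x ∈ O, 0 < f x + g x := by
    intro x hx
    rcases hcov hx with h | h
    · exact add_pos_of_pos_of_nonneg ((hfn x).lt_of_ne' ((hf' x).1 h)) (hgn x)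
    · exact add_pos_of_nonneg_of_pos (hfn x) ((hgn x).lt_of_ne' ((hg' x).1 h))
  -- `h = f / (f + g)` is `1` on `O \ V` and `0` on `O \ W`
  let h : E → ℝ := fun x => f x / (f x + g x)
  have hh : ContDiffOn ℝ ∞ h O :=
    hf.contDiffOn.div (hf.add hg).contDiffOn fun x hx => (hpos x hx).ne'
  let ρ : E → ℝ := fun x => Real.smoothTransition (3 * h x - 1)
  have hρ : ContDiffOn ℝ ∞ ρ O :=
    Real.smoothTransition.contDiff.comp_contDiffOn ((contDiffOn_const.mul hh).sub contDiffOn_const)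
  have hopen : ∀ s : Set ℝ, IsOpen s → IsOpen (O ∩ h ⁻¹' s) := fun s hs =>
    hh.continuousOn.isOpen_inter_preimage hO hs
  refine ⟨fun x => ρ x • b x, O ∩ h ⁻¹' Ioi (2 / 3), ?_, hopen _ isOpen_Ioi, ?_, ?_, ?_⟩
  · intro x hx
    by_cases hxW : x ∈ W
    · exact ((hρ.contDiffAt (hO.mem_nhds hx)).smul
        (hb.contDiffAt (hW.mem_nhds hxW))).contDiffWithinAt
    · have hx0 : h x = 0 := by
        have : f x = 0 := by_contra fun h => hxW ((hf' x).2 h)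
        simp [h, this]
      have hn : O ∩ h ⁻¹' Iio (1 / 3) ∈ 𝓝 x :=
        (hopen _ isOpen_Iio).mem_nhds ⟨hx, by rw [mem_preimage, hx0]; norm_num⟩
      refine (contDiffAt_const (c := (0 : F)).congr_of_eventuallyEq ?_).contDiffWithinAt
      filter_upwards [hn] with x' hx'
      have h1 : h x' < 1 / 3 := hx'.2
      simp only [ρ]
      rw [Real.smoothTransition.zero_of_nonpos (by linarith), zero_smul]
  · intro x hx
    rw [hf']
    intro hx0
    have h1 : 2 / 3 < h x := hx.2
    simp only [h, hx0, zero_div] at h1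
    norm_num at h1
  · intro x hx
    have hx0 : g x = 0 := by_contra fun h => hx.2 ((hg' x).2 h)
    have hfx := hpos x hx.1
    rw [hx0, add_zero] at hfx
    refine ⟨hx.1, ?_⟩
    change 2 / 3 < f x / (f x + g x)
    rw [hx0, add_zero, div_self hfx.ne']
    norm_num
  · intro x hx
    have h1 : 2 / 3 < h x := hx.2
    simp only [ρ]
    rw [Real.smoothTransition.one_of_one_le (by linarith), one_smul]

end Cutoff

/-! ### From the Euler-Lagrange to the Hamilton equations -/

section Sections
open Set Module
set_option linter.unusedSectionVars false

theorem fderiv_apply_of_comp {E F : Type*} [NormedAddCommGroup E] [NormedSpace ℝ E]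
    [NormedAddCommGroup F] [NormedSpace ℝ F] {γ : E → F} {g : F → ℝ} {h : E → ℝ} {u : E}
    (hg : DifferentiableAt ℝ g (γ u)) (hγ : DifferentiableAt ℝ γ u)
    (heq : h =ᶠ[𝓝 u] fun x => g (γ x)) (e : E) :
    fderiv ℝ h u e = fderiv ℝ g (γ u) (fderiv ℝ γ u e) := by
  rw [heq.fderiv_eq]
  exact DFunLike.congr_fun (fderiv_comp u hg hγ) e

theorem fderiv_prod_apply {E A B : Type*} [NormedAddCommGroup E] [NormedSpace ℝ E]
    [NormedAddCommGroup A] [NormedSpace ℝ A] [NormedAddCommGroup B] [NormedSpace ℝ B]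
    {γ : E → A × B} {u : E} (hγ : DifferentiableAt ℝ γ u) (e : E) :
    fderiv ℝ γ u e = (fderiv ℝ (fun x => (γ x).1) u e, fderiv ℝ (fun x => (γ x).2) u e) := by
  rw [fderiv.fst hγ, fderiv.snd hγ]
  rfl

theorem differentiableAt_fderiv_apply {F : Type*} [NormedAddCommGroup F] [NormedSpace ℝ F]
    {f : F → ℝ} {x : F} (hf : ContDiffAt ℝ ∞ f x) (v : F) :
    DifferentiableAt ℝ (fun z => fderiv ℝ f z v) x :=
  ((hf.fderiv_right (m := 1) (by norm_cast)).differentiableAt (by simp)).clm_apply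
    (differentiableAt_const v)

theorem neg_pairing_sub_fderiv {E J : Type*} [NormedAddCommGroup E] [NormedSpace ℝ E]
    [NormedAddCommGroup J] [NormedSpace ℝ J] (f : E × J → ℝ) (z : E × J) (e : E) (a b : J) :
    -((0 : J →L[ℝ] ℝ) b + (legMap f z).2 a - fderiv ℝ f z (e, a)) = fderiv ℝ f z (e, 0) := by
  have h1 : (e, a) = (e, (0 : J)) + ((0 : E), a) := by simp
  have h2 : (legMap f z).2 a = fderiv ℝ f z (0, a) := rfl
  rw [h1, map_add, h2, zero_apply]
  ring

variable {n m : ℕ}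
variable {X : Type*} [TopologicalSpace X] [ChartedSpace (Eu n) X]
variable {Y : Type*} [TopologicalSpace Y] [ChartedSpace (Eu n × Eu m) Y]
variable {π : FibredManifold n m X Y}
variable [IsManifold 𝓘(ℝ, Eu n) ∞ X] [IsManifold 𝓘(ℝ, Eu n × Eu m) ∞ Y]
variable {L : Jet π → Dens n} {s : X → Jet π} {W : Set X}

namespace FibredChart

variable (c : FibredChart π)

/-- The domain in the coordinates of `c` of a section `s` of `J¹Y → X` over `W`. -/
def sectionDom (s : X → Jet π) (W : Set X) : Set (Eu n) :=
  {u | u ∈ c.base.target ∧ c.base.symm u ∈ W ∧ (s (c.base.symm u)).pt ∈ c.total.source}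

theorem isOpen_sectionDom (hs : IsJetSection s W) : IsOpen (c.sectionDom s W) := by
  have h1 : IsOpen (W ∩ (fun x => (s x).pt) ⁻¹' c.total.source) :=
    hs.smooth.continuousOn.isOpen_inter_preimage hs.isOpen c.total.open_source
  exact c.base.symm.isOpen_inter_preimage h1

theorem mem_base_source (hs : IsJetSection s W) {x : X} (hx : x ∈ W)
    (hc : (s x).pt ∈ c.total.source) : x ∈ c.base.source := by
  have h := c.mapsTo _ hc
  rwa [hs.isSection x hx] at h

theorem base_mem_sectionDom (hs : IsJetSection s W) {x : X} (hx : x ∈ W)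
    (hc : (s x).pt ∈ c.total.source) : c.base x ∈ c.sectionDom s W := by
  have h := c.mem_base_source hs hx hc
  refine ⟨c.base.map_source h, ?_, ?_⟩ <;> rwa [c.base.left_inv h]

/-- The coordinate expression of a section `s` of `J¹Y → X`. -/
def sectionCoord (s : X → Jet π) (u : Eu n) : JetModel n m := c.jetCoord (s (c.base.symm u))

theorem sectionCoord_base (hs : IsJetSection s W) {x : X} (hx : x ∈ W)
    (hc : (s x).pt ∈ c.total.source) : c.sectionCoord s (c.base x) = c.jetCoord (s x) := by
  rw [sectionCoord, c.base.left_inv (c.mem_base_source hs hx hc)]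

theorem contDiffOn_sectionCoord (hs : IsJetSection s W) :
    ContDiffOn ℝ ∞ (c.sectionCoord s) (c.sectionDom s W) := hs.smooth_coord c

theorem differentiableAt_sectionCoord (hs : IsJetSection s W) {u : Eu n}
    (hu : u ∈ c.sectionDom s W) : DifferentiableAt ℝ (c.sectionCoord s) u :=
  ((c.contDiffOn_sectionCoord hs).contDiffAt ((c.isOpen_sectionDom hs).mem_nhds hu)).differentiableAt
    (by simp)

theorem sectionCoord_base_fst (hs : IsJetSection s W) {u : Eu n} (hu : u ∈ c.sectionDom s W) :
    (c.sectionCoord s u).1.1 = u := by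
  change (c.total (s (c.base.symm u)).pt).1 = u
  rw [← c.fibred _ hu.2.2, hs.isSection _ hu.2.1, c.base.right_inv hu.1]

/-- The holonomy equation `∂_λ s^i = s^i_λ`. -/
theorem fderiv_sectionCoord_fst (hs : IsEulerLagrangeSolution L s W) {x : X} (hx : x ∈ W)
    (hc : (s x).pt ∈ c.total.source) (e : Eu n) :
    fderiv ℝ (fun u => (c.sectionCoord s u).1) (c.base x) e = (e, (c.jetCoord (s x)).2 e) := by
  have hu := c.base_mem_sectionDom hs.isJetSection hx hc
  have hd := c.differentiableAt_sectionCoord hs.isJetSection hu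
  rw [fderiv_prod_apply hd.fst]
  refine Prod.ext ?_ ?_
  · have h : (fun u => (c.sectionCoord s u).1.1) =ᶠ[𝓝 (c.base x)] id := by
      filter_upwards [(c.isOpen_sectionDom hs.isJetSection).mem_nhds hu] with u hu
      exact c.sectionCoord_base_fst hs.isJetSection hu
    change fderiv ℝ (fun u => (c.sectionCoord s u).1.1) (c.base x) e = e
    rw [h.fderiv_eq, fderiv_id]
    rfl
  · have h : (fderiv ℝ (fun u => (c.sectionCoord s u).1.2) (c.base x)).toLinearMap =
        ((c.jetCoord (s x)).2).toLinearMap := by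
      refine (EuclideanSpace.basisFun (Fin n) ℝ).toBasis.ext fun l => ?_
      ext i
      rw [OrthonormalBasis.coe_toBasis, EuclideanSpace.basisFun_apply]
      exact hs.holonomic c x hx hc l i
    exact LinearMap.congr_fun h e

theorem fderiv_sectionCoord (hs : IsEulerLagrangeSolution L s W) {x : X} (hx : x ∈ W)
    (hc : (s x).pt ∈ c.total.source) (e : Eu n) :
    fderiv ℝ (c.sectionCoord s) (c.base x) e = ((e, (c.jetCoord (s x)).2 e),
      fderiv ℝ (fun u => (c.sectionCoord s u).2) (c.base x) e) := by
  rw [fderiv_prod_apply (c.differentiableAt_sectionCoord hs.isJetSection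
    (c.base_mem_sectionDom hs.isJetSection hx hc)), c.fderiv_sectionCoord_fst hs hx hc]

end FibredChart

/-- A solution of the first order Euler-Lagrange equations is the jet prolongation of its
projection to `Y`. -/
theorem IsEulerLagrangeSolution.jet_eq_mfderiv (hs : IsEulerLagrangeSolution L s W) {x : X}
    (hx : x ∈ W) :
    (s x).jet.1 = mfderiv 𝓘(ℝ, Eu n) 𝓘(ℝ, Eu n × Eu m) (fun x' => (s x').pt) x := by
  obtain ⟨c, hc⟩ := π.exists_fibredChart (s x).pt
  have hxb := c.mem_base_source hs.isJetSection hx hc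
  have hproj : π.proj (s x).pt = x := hs.isJetSection.isSection x hx
  have hT : MDifferentiableAt 𝓘(ℝ, Eu n) 𝓘(ℝ, Eu n × Eu m) (fun x' => (s x').pt) x :=
    (hs.isJetSection.smooth.contMDiffAt (hs.isJetSection.isOpen.mem_nhds hx)).mdifferentiableAt
      (by simp)
  obtain ⟨T, hTdef⟩ : ∃ T : Eu n →L[ℝ] (Eu n × Eu m),
    T = mfderiv 𝓘(ℝ, Eu n) 𝓘(ℝ, Eu n × Eu m) (fun x' => (s x').pt) x := ⟨_, rfl⟩
  have hT' : HasMFDerivAt 𝓘(ℝ, Eu n) 𝓘(ℝ, Eu n × Eu m) (fun x' => (s x').pt)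
      (c.base.symm (c.base x)) T := by
    rw [c.base.left_inv hxb, hTdef]; exact hT.hasMFDerivAt
  have hinv : HasMFDerivAt 𝓘(ℝ, Eu n) 𝓘(ℝ, Eu n) c.base.symm (c.base x) (c.dbaseInv x) :=
    ((contMDiffAt_symm_of_mem_maximalAtlas c.base_mem
      (c.base.map_source hxb)).mdifferentiableAt (by simp)).hasMFDerivAt
  have htot : HasMFDerivAt 𝓘(ℝ, Eu n × Eu m) 𝓘(ℝ, Eu n × Eu m) c.total
      (s (c.base.symm (c.base x))).pt (c.dtotal (s x).pt) := by
    rw [c.base.left_inv hxb]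
    exact ((contMDiffAt_of_mem_maximalAtlas c.total_mem hc).mdifferentiableAt
      (by simp)).hasMFDerivAt
  have h1 := HasMFDerivAt.comp (c.base x) (g := fun x' => (s x').pt) (f := c.base.symm) hT' hinv
  have h2 := HasMFDerivAt.comp (c.base x) (g := c.total)
    (f := (fun x' => (s x').pt) ∘ c.base.symm) htot h1
  have h3 : HasFDerivAt (fun u => (c.sectionCoord s u).1)
      (c.dtotal (s x).pt ∘L T ∘L c.dbaseInv x) (c.base x) := h2.hasFDerivAt
  have h4 : ∀ e, c.dtotal (s x).pt (T (c.dbaseInv x e)) = (e, (c.jetCoord (s x)).2 e) := by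
    intro e
    rw [← c.fderiv_sectionCoord_fst hs hx hc, h3.fderiv]
    rfl
  rw [← hTdef]
  ext1 v
  have h5 := h4 (c.dbase x v)
  rw [c.dbaseInv_dbase hxb] at h5
  rw [← c.dtotalInv_dtotal hc (T v), h5]
  conv_lhs => rw [← c.jetAt_jetCoef hc (s x).jet]
  rw [c.jetAt_apply hc, hproj]
  rfl

/-- The Legendre morphism maps smooth sections of `J¹Y` to smooth sections of `Π`. -/
theorem IsJetSection.legendre (hL : IsLagrangianDensity L) (hs : IsJetSection s W) :
    IsMomentumSection (fun x => legendre L (s x)) W where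
  isOpen := hs.isOpen
  isSection := hs.isSection
  smooth := hs.smooth
  smooth_coord := by
    intro c
    have h1 : ContDiffOn ℝ ∞ (legMap (c.lag L)) {z : JetModel n m | z.1 ∈ c.total.target} :=
      contDiffOn_fst.prodMk
        (contDiffOn_vertDeriv c.total.open_target (hL c))
    have h2 : MapsTo (c.sectionCoord s) (c.sectionDom s W) {z | z.1 ∈ c.total.target} :=
      fun u hu => c.total.map_source hu.2.2
    exact (h1.comp (c.contDiffOn_sectionCoord hs) h2).congr fun u hu =>
      c.momCoord_legendre hL hu.2.2

/-- If a flat momentum morphism `Φ` takes the section `L̂ ∘ s` back to the solution `s` of the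
Euler-Lagrange equations, then `L̂ ∘ s` solves the Hamilton equations of `H_{LΦ}`. -/
theorem IsEulerLagrangeSolution.isHamiltonSolution {U : Set (Momentum π)}
    {Φ : ∀ p : Momentum π, JetAt π p.pt} (hL : IsLagrangianDensity L) (hU : IsOpen U)
    (hΦ : IsMomentumMorphism U Φ) (hflat : IsFlat L U Φ) (hs : IsEulerLagrangeSolution L s W)
    (hmem : ∀ x ∈ W, legendre L (s x) ∈ U) (hsΦ : ∀ x ∈ W, Φ (legendre L (s x)) = (s x).jet) :
    IsHamiltonSolution U (formOfLagrangian L Φ) (fun x => legendre L (s x)) W where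
  isMomentumSection := hs.isJetSection.legendre hL
  mem := hmem
  equation_field := by
    intro c x hx hc l i
    have hc : (s x).pt ∈ c.total.source := hc
    have hu := c.base_mem_sectionDom hs.isJetSection hx hc
    have h1 : (fun u => (c.momCoord (legendre L (s (c.base.symm u)))).1.2) =ᶠ[𝓝 (c.base x)]
        fun u => (c.jetCoord (s (c.base.symm u))).1.2 := by
      filter_upwards [(c.isOpen_sectionDom hs.isJetSection).mem_nhds hu] with u hu
      rw [c.momCoord_legendre hL hu.2.2]
      rfl
    rw [h1.fderiv_eq, hs.holonomic c x hx hc, ← hflat.isMorphismOfForm hL hU hΦ c _ (hmem x hx) hc]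
    have h2 := hsΦ x hx
    change _ = c.jetCoef (Φ (legendre L (s x))) (unitVec l) i
    rw [h2]
    rfl
  equation_momentum := by
    intro c x hx hc i
    have hc : (s x).pt ∈ c.total.source := hc
    have hu := c.base_mem_sectionDom hs.isJetSection hx hc
    have hγ := c.differentiableAt_sectionCoord hs.isJetSection hu
    have hγ0 := c.sectionCoord_base hs.isJetSection hx hc
    have h1 : ∀ l : Fin n,
        fderiv ℝ (fun u => (c.momCoord (legendre L (s (c.base.symm u)))).2 (jetUnit l i))
          (c.base x) (unitVec l) =
        fderiv ℝ (fun v => fderiv ℝ (c.lag L) v (0, jetUnit l i)) (c.jetCoord (s x))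
            ((unitVec l, (c.jetCoord (s x)).2 (unitVec l)),
              fderiv ℝ (fun u => (c.jetCoord (s (c.base.symm u))).2) (c.base x) (unitVec l)) := by
      intro l
      have h2 : (fun u => (c.momCoord (legendre L (s (c.base.symm u)))).2 (jetUnit l i))
          =ᶠ[𝓝 (c.base x)] fun u => fderiv ℝ (c.lag L) (c.sectionCoord s u) (0, jetUnit l i) := by
        filter_upwards [(c.isOpen_sectionDom hs.isJetSection).mem_nhds hu] with u hu
        rw [c.momCoord_legendre hL hu.2.2]
        rfl
      have h3 : DifferentiableAt ℝ (fun v => fderiv ℝ (c.lag L) v (0, jetUnit l i))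
          (c.sectionCoord s (c.base x)) := by
        rw [hγ0]
        exact differentiableAt_fderiv_apply ((hL c).contDiffAt
          (c.isOpen_jetDom.mem_nhds (c.total.map_source hc))) _
      have h4 := fderiv_apply_of_comp h3 hγ h2 (unitVec l)
      rw [hγ0, c.fderiv_sectionCoord hs hx hc] at h4
      exact h4
    rw [Finset.sum_congr rfl fun l _ => h1 l]
    have hv : c.momCoord (legendre L (s x)) ∈ c.momDom U :=
      (c.momCoord_mem_momDom hc).2 (hmem x hx)
    obtain ⟨φ', -, hder⟩ := c.hasFDerivAt_hamiltonian hL hU hΦ hv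
    have h5 : ((c.momCoord (legendre L (s x))).1,
        c.jetCoef (Φ (c.momOf (c.momCoord (legendre L (s x)))))) = c.jetCoord (s x) := by
      rw [c.momOf_momCoord (p := legendre L (s x)) hc, c.momCoord_legendre hL hc]
      exact congrArg (fun ℓ => (c.total (s x).pt, c.jetCoef ℓ)) (hsΦ x hx)
    -- `∂ℋ/∂y = -∂𝓛/∂y` because the momentum is the fibre derivative of `𝓛` at the jet `s x`
    rw [hder, h5, c.momCoord_legendre hL hc, eq_comm]
    have h6 := hs.equation c x hx hc i
    rw [sub_eq_zero] at h6
    rw [← h6]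
    exact neg_pairing_sub_fderiv (c.lag L) (c.jetCoord (s x)) (0, unitVec i) _ _

end Sections

/-! ### Complete families -/

section CompleteFamilies
open Set Module
set_option linter.unusedSectionVars false

variable {n m : ℕ}
variable {X : Type*} [TopologicalSpace X] [ChartedSpace (Eu n) X]
variable {Y : Type*} [TopologicalSpace Y] [ChartedSpace (Eu n × Eu m) Y]
variable {π : FibredManifold n m X Y}
variable [IsManifold 𝓘(ℝ, Eu n) ∞ X] [IsManifold 𝓘(ℝ, Eu n × Eu m) ∞ Y]
variable {L : Jet π → Dens n} {s : X → Jet π} {W : Set X}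

theorem IsEulerLagrangeSolution.mono (hs : IsEulerLagrangeSolution L s W) {W' : Set X}
    (hW' : IsOpen W') (hsub : W' ⊆ W) : IsEulerLagrangeSolution L s W' where
  isJetSection :=
    { isOpen := hW'
      isSection := fun x hx => hs.isJetSection.isSection x (hsub hx)
      smooth := hs.isJetSection.smooth.mono hsub
      smooth_coord := fun c => (hs.isJetSection.smooth_coord c).mono
        fun _ hu => ⟨hu.1, hsub hu.2.1, hu.2.2⟩ }
  holonomic := fun c x hx => hs.holonomic c x (hsub hx)
  equation := fun c x hx => hs.equation c x (hsub hx)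

namespace FibredChart

variable (c : FibredChart π) {U : Set (MomModel n m)}

/-- A flat momentum morphism associated with `L` that takes `L̂ ∘ s` back to `s` near a given
relatively closed set.  It is the member of the family `α` through `s`, after `s` has been cut off
outside a neighbourhood of this set. -/
theorem exists_morphism_through (hL : IsLagrangianDensity L) (hU : IsOpen U)
    (hUt : ∀ w ∈ U, w.1 ∈ c.total.target) {α : MomModel n m × JetCoef n m → JetCoef n m}
    (hα : ContDiffOn ℝ ∞ α (U ×ˢ univ))
    (hthrough : ∀ z : JetModel n m, z.1 ∈ c.total.target → legMap (c.lag L) z ∈ U →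
      α (legMap (c.lag L) z, z.2) = z.2)
    (hs : IsJetSection s W) (hmem : ∀ x ∈ W, legendre L (s x) ∈ c.momSet U) {C D : Set X}
    (hCW : C ⊆ W) (hD : IsClosed D)
    (hC : C = D ∩ (fun p : Momentum π => π.proj p.pt) '' c.momSet U) :
    ∃ (b : Eu n → JetCoef n m) (W' : Set X), IsOpen W' ∧ C ⊆ W' ∧ W' ⊆ W ∧
      ContDiffOn ℝ ∞ (fun w => α (w, b w.1.1)) U ∧
      ∀ x ∈ W', c.morphism (fun w => α (w, b w.1.1)) (legendre L (s x)) = (s x).jet := by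
  let O : Set (Eu n) := (fun w : MomModel n m => w.1.1) '' U
  have hO : IsOpen O := (isOpenMap_fst.comp isOpenMap_fst) U hU
  let V : Set (Eu n) := c.base.target ∩ c.base.symm ⁻¹' Dᶜ
  have hV : IsOpen V := c.base.symm.isOpen_inter_preimage hD.isOpen_compl
  have hcov : O ⊆ c.sectionDom s W ∪ V := by
    rintro _ ⟨w, hw, rfl⟩
    have ht := hUt w hw
    have hpt := c.total.map_target ht
    have h1 := c.mapsTo _ hpt
    have h2 : c.base (π.proj (c.total.symm w.1)) = w.1.1 := c.base_symm_fst ht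
    have h3 : w.1.1 ∈ c.base.target := h2 ▸ c.base.map_source h1
    have h4 : c.base.symm w.1.1 = π.proj (c.total.symm w.1) := by
      rw [← h2, c.base.left_inv h1]
    by_cases hxD : c.base.symm w.1.1 ∈ D
    · left
      have h5 : c.momOf w ∈ c.momSet U := ⟨hpt, by rwa [c.momCoord_momOf ht]⟩
      have h6 : c.base.symm w.1.1 ∈ W := hCW (hC ▸ ⟨hxD, c.momOf w, h5, h4.symm⟩)
      exact ⟨h3, h6, (hmem _ h6).1⟩
    · exact Or.inr ⟨h3, hxD⟩
  have hb : ContDiffOn ℝ ∞ (fun u => (c.sectionCoord s u).2) (c.sectionDom s W) :=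
    contDiff_snd.comp_contDiffOn (c.contDiffOn_sectionCoord hs)
  obtain ⟨b, N, hbO, hN, -, hVN, hbN⟩ :=
    exists_contDiffOn_extension hO (c.isOpen_sectionDom hs) hV hcov hb
  have hbase : ∀ x ∈ W, (c.momCoord (legendre L (s x))).1.1 = c.base x := by
    intro x hx
    have hpt : (s x).pt ∈ c.total.source := (hmem x hx).1
    rw [c.momCoord_legendre hL hpt]
    change (c.total (s x).pt).1 = c.base x
    rw [← c.fibred _ hpt, hs.isSection x hx]
  refine ⟨b, W ∩ (c.base.source ∩ c.base ⁻¹' N),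
    hs.isOpen.inter (c.base.isOpen_inter_preimage hN), ?_, inter_subset_left, ?_, ?_⟩
  · intro x hx
    have hxW := hCW hx
    have hxb := c.mem_base_source hs hxW (hmem x hxW).1
    refine ⟨hxW, hxb, hVN ⟨⟨_, (hmem x hxW).2, hbase x hxW⟩, fun h => h.2 ?_⟩⟩
    rw [c.base.left_inv hxb]
    rw [hC] at hx
    exact hx.1
  · have h1 : ContDiffOn ℝ ∞ (fun w : MomModel n m => w.1.1) U :=
      contDiffOn_fst.comp contDiffOn_fst fun _ _ => mem_univ _
    have h2 : ContDiffOn ℝ ∞ (fun w : MomModel n m => b w.1.1) U :=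
      hbO.comp h1 fun w hw => ⟨w, hw, rfl⟩
    exact hα.comp (contDiffOn_id.prodMk h2) fun w hw => ⟨hw, mem_univ _⟩
  · rintro x ⟨hxW, hxb, hxN⟩
    have hpt := (hmem x hxW).1
    have h1 : b (c.base x) = (c.jetCoord (s x)).2 := by
      rw [hbN _ hxN, c.sectionCoord_base hs hxW hpt]
    refine c.jetCoef_injective (y := (s x).pt) hpt ?_
    refine (c.jetCoef_morphism _ (p := legendre L (s x)) hpt).trans ?_
    rw [hbase x hxW, h1, c.momCoord_legendre hL hpt]
    exact hthrough _ (c.total.map_source hpt) ((c.legendre_mem_momSet hL hpt).1 (hmem x hxW))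

end FibredChart

/-- Near each point of the constraint space of a semiregular `L`, the Hamiltonian forms
associated with `L` are a complete family. -/
theorem exists_local_completeFamily (hL : IsLagrangianDensity L) (hreg : IsAlmostRegular L)
    (hsemi : IsSemiregular L) {p : Momentum π} (hp : p ∈ constraintSpace L) :
    ∃ U : Set (Momentum π), IsOpen U ∧ p ∈ U ∧ IsCompleteFamily L U {H | IsAssociatedForm L U H} := by
  obtain ⟨z, rfl⟩ := hp
  obtain ⟨c, hc⟩ := π.exists_fibredChart z.pt
  obtain ⟨P, U, α, hU, hz, hUt, hα, hP, hker, hass, hthrough⟩ :=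
    (c.isRegularFamily hL hreg).exists_local_family (z₀ := c.jetCoord z) (c.total.map_source hc)
      fun w hw => c.isPreconnected_fibre hL hsemi hw
  have hUo := c.isOpen_momSet hU
  refine ⟨c.momSet U, hUo, (c.legendre_mem_momSet hL hc).2 hz, ?_⟩
  rintro s W hs hmem C hCW ⟨D, hD, hC⟩
  obtain ⟨b, W', hW', hCW', hsub, hφ, hsΦ⟩ :=
    c.exists_morphism_through hL hU hUt hα hthrough hs.isJetSection hmem hCW hD hC
  have hΦ := c.isMomentumMorphism_morphism hφ
  -- the jets `α (w, b)` over one point of `Y` differ by elements of `ker P`, because `b` depends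
  -- only on the point of `X`
  have hflat : IsFlat L (c.momSet U) (c.morphism fun w => α (w, b w.1.1)) :=
    c.isFlat_morphism hL (P := P)
      (fun u q q' h h' => (hP _ h (b u.1)).trans (hP _ h' (b u.1)).symm)
      fun w hw => hker w hw _
  have hass' : IsAssociatedMorphism L (c.momSet U) (c.morphism fun w => α (w, b w.1.1)) :=
    c.isAssociatedMorphism_morphism hL fun w hw => hass w hw _
  refine ⟨_, isAssociatedForm_formOfLagrangian hL hUo hΦ hflat hass', _,
    hflat.isMorphismOfForm hL hUo hΦ, W', hCW', hsub, fun x => legendre L (s x),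
    (hs.mono hW' hsub).isHamiltonSolution hL hUo hΦ hflat (fun x hx => hmem x (hsub hx)) hsΦ,
    fun x hx => ⟨rfl, ?_, hs.jet_eq_mfderiv (hsub hx)⟩⟩
  exact congrArg (Jet.mk (s x).pt) (hsΦ x hx).symm

end CompleteFamilies

end Multimomentum

end

theorem proposition11 {n m : ℕ}
    {X : Type*} [TopologicalSpace X] [T2Space X] [SecondCountableTopology X] [ConnectedSpace X]
    [ChartedSpace (Eu n) X] [IsManifold 𝓘(ℝ, Eu n) ∞ X]
    {Y : Type*} [TopologicalSpace Y] [T2Space Y] [SecondCountableTopology Y] [ConnectedSpace Y]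
    [ChartedSpace (Eu n × Eu m) Y] [IsManifold 𝓘(ℝ, Eu n × Eu m) ∞ Y]
    (π : FibredManifold n m X Y) (L : Jet π → Dens n)
    (hL : IsLagrangianDensity L) (hreg : IsAlmostRegular L) :
    (∀ q ∈ constraintSpace L, ∃ U : Set (Momentum π), IsOpen U ∧ q ∈ U ∧
      ∃ Φ : ∀ p : Momentum π, JetAt π p.pt,
        IsMomentumMorphism U Φ ∧ IsAssociatedMorphism L U Φ ∧
        IsMorphismOfForm U (formOfLagrangian L Φ) Φ ∧
        IsAssociatedForm L U (formOfLagrangian L Φ)) ∧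
    (IsSemiregular L → ∀ p ∈ constraintSpace L, ∃ U : Set (Momentum π), IsOpen U ∧ p ∈ U ∧
      ∃ F : Set (Momentum π → TotForm n m),
        (∀ H ∈ F, IsAssociatedForm L U H) ∧ IsCompleteFamily L U F) := by
  refine ⟨fun q hq => ?_, fun hsemi p hp => ?_⟩
  · obtain ⟨U, hU, hqU, Φ, hΦ, hass, hflat⟩ := exists_local_flat_morphism hL hreg hq
    exact ⟨U, hU, hqU, Φ, hΦ, hass, hflat.isMorphismOfForm hL hU hΦ,
      isAssociatedForm_formOfLagrangian hL hU hΦ hflat hass⟩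
  · obtain ⟨U, hU, hpU, hF⟩ := exists_local_completeFamily hL hreg hsemi hp
    exact ⟨U, hU, hpU, _, fun H hH => hH, hF⟩
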